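/- Let $G=(V,E)$ be a finite simple graph that is cubic, 2-connected, has at least 10 vertices, and is \emph{reduced}, meaning that no 6-cycle of $G$ has a chord. A perfect matching of $G$ is \emph{3-cut perfect} if it meets every 3-cut of $G$ (every edge cut $\delta(S)$ with exactly three edges) in exactly one edge. Let $M_1,\dots,M_k$ be 3-cut perfect matchings of $G$ and let $\lambda_1,\dots,\lambda_k>0$ satisfy $\sum_i\lambda_i=1$ and $\sum_{i:\,e\in M_i}\lambda_i=\frac13$ for every $e\in E$. An \emph{Eulerian subgraph cover} is a collection of connected Eulerian multi-subgraphs of $G$ (its \emph{components}) such that every vertex lies in exactly one component and no edge is used more than twice in a component; a \emph{cycle cover} is one whose components are all cycles. For each $i$ start with the cycle cover $\mathcal C_i$ consisting of the cycles of $E\setminus M_i$, and apply first (U1), then (U2), then (U3), each as many times as possible, where - (U1): if three distinct cycles of the current cycle cover all meet a 6-cycle $C$ of $G$, merge them into one cycle by taking the symmetric difference of their edge sets with $E(C)$; - (U2): if two distinct cycles of the current cycle cover both meet a 4-cycle $C$ of $G$, merge them into one cycle by taking the symmetric difference of their edge sets with $E(C)$; - (U3): if two distinct components $\gamma_1,\gamma_2$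 of the current cover, each with at least 5 vertices, both meet a 5-cycle $C$ of $G$ (then one of them, say $\gamma_1$, has exactly two vertices on $C$), replace them by one component: add the edges of $C$ to $\gamma_1$ (counting multiplicities) and remove two edges so that the result is connected and Eulerian, add the edges of $\gamma_2$ to it and again remove two edges so that the result is connected and Eulerian, and finally remove two edges from each group of three or four parallel edges. Let $\Gamma_i$ be any cover that can result from $\mathcal C_i$ in this way. For $v\in V$ let $z_i(v)=(\ell+2)/h$, where $\ell$ and $h$ are the numbers of edges (with multiplicity) and of vertices of the component of $\Gamma_i$ containing $v$, let $z(v)=\sum_i\lambda_i z_i(v)$, and let $\Gamma(v)$ be the set of the components containing $v$ in the covers $\Gamma_1,\dots,\Gamma_k$. Call a 4-cycle with a chord \emph{isolated} if the edges of $G$ leaving its vertex set are not incident to another chorded 4-cycle. Then for every $v\in V$: - (P1) if $v$ is in an isolated chorded 4-cycle of $G$, then $z(v)\le \frac43$; - (P2) if $v$ is in a non-isolated chorded 4-cycle of $G$, then $z(v)\le\frac{13}{10}$; - (P3) else, if $\Gamma(v)$ contains an induced 4-cycle, then $z(v)\le\frac43-\frac1{60}$; - (P4) else, if $\Gamma(v)$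 contains an induced 5-cycle, then $z(v)\le\frac43-\frac1{60}$; - (P5) else, if $\Gamma(v)$ contains an induced 6-cycle, then $z(v)\le\frac43$, and for every induced 6-cycle $\gamma\in\Gamma(v)$ we have $\sum_{w\in V(\gamma)}z(w)\le 6\left(\frac43-\frac1{729}\right)$; - (P6) in any other case, $z(v)\le\frac{13}{10}$. -/

import Mathlib

namespace CubicTour

/-! ### Graphs -/

section Graphs

/-- A graph is 2-connected if it has at least three vertices, is connected, and stays connected
after deleting any one vertex. -/
def IsTwoConnected {V : Type*} (G : SimpleGraph V) : Prop :=
  3 ≤ Nat.card V ∧ G.Connected ∧ ∀ v : V, (G.induce {v}ᶜ).Connected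

/-- A graph is reduced if no 6-cycle of it has a chord. -/
def IsReduced {V : Type*} (G : SimpleGraph V) : Prop :=
  ∀ (u : V) (p : G.Walk u u), p.IsCycle → p.length = 6 → p.IsChordless

/-- The vertex set of a walk. -/
def walkVerts {V : Type*} {G : SimpleGraph V} {u w : V} (p : G.Walk u w) : Set V :=
  {x | x ∈ p.support}

/-- The edge set of a walk. -/
def walkEdges {V : Type*} {G : SimpleGraph V} {u w : V} (p : G.Walk u w) : Set (Sym2 V) :=
  {e | e ∈ p.edges}

/-- The cut `δ(S)`: the edges of `G` with exactly one end in `S`. -/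
def cut {V : Type*} (G : SimpleGraph V) (S : Set V) : Set (Sym2 V) :=
  {e | e ∈ G.edgeSet ∧ ∃ x ∈ S, ∃ y ∉ S, e = s(x, y)}

/-- A 3-cut perfect matching: a perfect matching that meets every 3-cut in exactly one edge. -/
def IsThreeCutPerfect {V : Type*} {G : SimpleGraph V} (M : G.Subgraph) : Prop :=
  M.IsPerfectMatching ∧
    ∀ S : Set V, (cut G S).ncard = 3 → (M.edgeSet ∩ cut G S).ncard = 1

/-- `D` is the vertex set of a 4-cycle of `G` that has a chord. -/
def IsChordedFourCycle {V : Type*} (G : SimpleGraph V) (D : Set V) : Prop :=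
  ∃ (u : V) (p : G.Walk u u), p.IsCycle ∧ p.length = 4 ∧ ¬ p.IsChordless ∧ D = walkVerts p

/-- A chorded 4-cycle is isolated if the edges leaving it are not incident to another
chorded 4-cycle. -/
def IsIsolated {V : Type*} (G : SimpleGraph V) (D : Set V) : Prop :=
  ∀ e ∈ cut G D, ∀ D' : Set V, IsChordedFourCycle G D' → D' ≠ D → ∀ x ∈ e, x ∉ D'

end Graphs

/-! ### Covers

A cycle cover is given by the spanning 2-regular subgraph formed by its edges; its cycles are the
connected components of that subgraph. An Eulerian subgraph cover is given by the multiplicity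
`m e` with which it uses each edge `e`; its components are the connected components of the graph
of the edges that are used at least once. -/

section Covers

/-- The graph formed by the edges of positive multiplicity. -/
def support {V : Type*} (m : Sym2 V → ℕ) : SimpleGraph V :=
  SimpleGraph.fromEdgeSet {e | 0 < m e}

/-- The vertex set of the component containing `v`. -/
def compVerts {V : Type*} (m : Sym2 V → ℕ) (v : V) : Set V :=
  ((support m).connectedComponentMk v).supp

open Classical in
/-- The multiset of those edges that have both ends in `W`. -/
noncomputable def restrict {V : Type*} (m : Sym2 V → ℕ) (W : Set V) : Sym2 V → ℕ :=
  fun e => if ∀ x ∈ e, x ∈ W then m e else 0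

open Classical in
/-- The multiplicity function of a set of edges. -/
noncomputable def ofSet {V : Type*} (E : Set (Sym2 V)) : Sym2 V → ℕ :=
  fun e => if e ∈ E then 1 else 0

/-- The number of edges, counted with multiplicity. -/
def numEdges {V : Type*} [Fintype V] [DecidableEq V] (m : Sym2 V → ℕ) : ℕ :=
  ∑ e : Sym2 V, m e

/-- The degree of a vertex, counted with multiplicity (no loops occur). -/
def mdegree {V : Type*} [Fintype V] [DecidableEq V] (m : Sym2 V → ℕ) (v : V) : ℕ :=
  ∑ e : Sym2 V, if v ∈ e then m e else 0

/-- The contribution `z_Γ(v) = (ℓ + 2) / h`, where `ℓ` and `h` are the numbers of edges and of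
vertices of the component of the cover containing `v`. -/
noncomputable def contribution {V : Type*} [Fintype V] [DecidableEq V]
    (m : Sym2 V → ℕ) (v : V) : ℝ :=
  ((numEdges (restrict m (compVerts m v)) : ℝ) + 2) / ((compVerts m v).ncard : ℝ)

/-- The average contribution `z(v)` for the distribution `{(Γ i, lam i)}`. -/
noncomputable def avgContribution {V : Type*} [Fintype V] [DecidableEq V] {k : ℕ}
    (lam : Fin k → ℝ) (Γ : Fin k → Sym2 V → ℕ) (v : V) : ℝ :=
  ∑ i, lam i * contribution (Γ i) v

/-- The component of the cover `m` containing `v` is the induced cycle `p` of length `n`. -/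
def IsInducedCycleAt {V : Type*} {G : SimpleGraph V} (m : Sym2 V → ℕ) (n : ℕ) (v : V)
    {u : V} (p : G.Walk u u) : Prop :=
  p.IsCycle ∧ p.length = n ∧ p.IsChordless ∧
    compVerts m v = walkVerts p ∧ restrict m (compVerts m v) = ofSet (walkEdges p)

/-- In some cover of the family `Γ`, the component containing `v` is an induced `n`-cycle
of `G`. -/
def HasInducedCycle {V : Type*} (G : SimpleGraph V) {k : ℕ} (Γ : Fin k → Sym2 V → ℕ)
    (n : ℕ) (v : V) : Prop :=
  ∃ (i : Fin k) (u : V) (p : G.Walk u u), IsInducedCycleAt (Γ i) n v p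

end Covers

/-! ### The local operations -/

section Operations

/-- `b` is obtained from `a` by applying an operation as many times as possible. -/
def IsExhaustive {α : Type*} (step : α → α → Prop) (a b : α) : Prop :=
  Relation.ReflTransGen step a b ∧ ∀ b', ¬ step b b'

/-- Operation (U1) on cycle covers: three cycles of the cover `F` that meet a 6-cycle `C` of `G`
are merged by taking the symmetric difference with `C`. -/
def StepU1 {V : Type*} (G F F' : SimpleGraph V) : Prop :=
  ∃ (u : V) (C : G.Walk u u) (c₁ c₂ c₃ : F.ConnectedComponent),
    C.IsCycle ∧ C.length = 6 ∧ c₁ ≠ c₂ ∧ c₁ ≠ c₃ ∧ c₂ ≠ c₃ ∧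
    (c₁.supp ∩ walkVerts C).Nonempty ∧ (c₂.supp ∩ walkVerts C).Nonempty ∧
    (c₃.supp ∩ walkVerts C).Nonempty ∧
    F'.edgeSet = symmDiff F.edgeSet (walkEdges C)

/-- Operation (U2) on cycle covers: two cycles of the cover `F` that meet a 4-cycle `C` of `G`
are merged by taking the symmetric difference with `C`. -/
def StepU2 {V : Type*} (G F F' : SimpleGraph V) : Prop :=
  ∃ (u : V) (C : G.Walk u u) (c₁ c₂ : F.ConnectedComponent),
    C.IsCycle ∧ C.length = 4 ∧ c₁ ≠ c₂ ∧
    (c₁.supp ∩ walkVerts C).Nonempty ∧ (c₂.supp ∩ walkVerts C).Nonempty ∧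
    F'.edgeSet = symmDiff F.edgeSet (walkEdges C)

/-- The multigraph with vertex set `W` and edge multiplicities `m` is connected and Eulerian. -/
def IsEulerianOn {V : Type*} [Fintype V] [DecidableEq V] (W : Set V) (m : Sym2 V → ℕ) : Prop :=
  ((support m).induce W).Connected ∧ ∀ v, Even (mdegree m v)

/-- `m'` arises from the sum of the multigraphs `(W₁, m₁)` and `(W₂, m₂)` by removing two edges
so that the result is still connected and Eulerian. -/
def IsMerge {V : Type*} [Fintype V] [DecidableEq V] (W₁ : Set V) (m₁ : Sym2 V → ℕ)
    (W₂ : Set V) (m₂ : Sym2 V → ℕ) (m' : Sym2 V → ℕ) : Prop :=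
  (∃ e₁ e₂ : Sym2 V, m' + Pi.single e₁ 1 + Pi.single e₂ 1 = m₁ + m₂) ∧
    IsEulerianOn (W₁ ∪ W₂) m'

/-- Remove two edges from each group of three or more parallel edges. -/
def trim {V : Type*} (m : Sym2 V → ℕ) : Sym2 V → ℕ :=
  fun e => if 3 ≤ m e then m e - 2 else m e

open Classical in
/-- Operation (U3) on Eulerian subgraph covers: two components `γ₁`, `γ₂` with at least 5 vertices
each that meet a 5-cycle `C` of `G` are combined, where `γ₁` is the one with exactly two vertices
on `C`. First `γ₁` is merged with `C`, then the result with `γ₂`, removing two edges each time, and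
finally two edges are removed from each group of three or four parallel edges. -/
def StepU3 {V : Type*} [Fintype V] [DecidableEq V] (G : SimpleGraph V)
    (m m' : Sym2 V → ℕ) : Prop :=
  ∃ (u : V) (C : G.Walk u u) (γ₁ γ₂ : (support m).ConnectedComponent) (h h' : Sym2 V → ℕ),
    C.IsCycle ∧ C.length = 5 ∧ γ₁ ≠ γ₂ ∧
    5 ≤ γ₁.supp.ncard ∧ 5 ≤ γ₂.supp.ncard ∧
    (γ₁.supp ∩ walkVerts C).ncard = 2 ∧ (γ₂.supp ∩ walkVerts C).Nonempty ∧
    IsMerge γ₁.supp (restrict m γ₁.supp) (walkVerts C) (ofSet (walkEdges C)) h ∧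
    IsMerge (γ₁.supp ∪ walkVerts C) h γ₂.supp (restrict m γ₂.supp) h' ∧
    m' = fun e => if ∀ x ∈ e, x ∈ γ₁.supp ∪ γ₂.supp then trim h' e else m e

/-- `Γ` is a final Eulerian subgraph cover obtained from the perfect matching `M`: start with the
cycle cover formed by the edges outside `M` and apply (U1), then (U2), then (U3), each as many
times as possible. -/
def IsFinalCover {V : Type*} [Fintype V] [DecidableEq V] (G : SimpleGraph V) (M : G.Subgraph)
    (Γ : Sym2 V → ℕ) : Prop :=
  ∃ F₁ F₂ : SimpleGraph V,
    IsExhaustive (StepU1 G) (G.deleteEdges M.edgeSet) F₁ ∧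
    IsExhaustive (StepU2 G) F₁ F₂ ∧
    IsExhaustive (StepU3 G) (ofSet F₂.edgeSet) Γ

end Operations

end CubicTour

/-! A component that is a single cycle on h vertices contributes 1 + 2/h, so only small components
are costly. The theorem holds because the covers in which v lies in a small cycle are balanced by
covers in which v lies in a large component. Three ingredients make this precise.

Merged components. A (U3) step joins two components and adds one edge in total (five edges of the
5-cycle come in, four edges go out; trimming parallel edges only helps). Each cycle absorbed in this
way has at least five vertices. Hence a component with ℓ edges and h vertices satisfies 5ℓ + |C| ≤
6h for every cycle C of the cover before (U3) that lies in it (`IsCoverFrom.bound`). So a vertex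
lying on such a cycle with at least t ≤ 10 vertices contributes at most 1 + 2/t, and a vertex of a
merged component at most 13/10.

Local axioms. `LocalCover` forgets the operations. It keeps the partner map μ of the matching and
three increasingly coarse partitions of the vertices: the components after (U1), (U2) and (U3). A
non-matching edge never leaves a class, because every operation only merges. Exhaustiveness says
that a 6-cycle does not meet three s₁-classes, a 4-cycle lies in one s₂-class, and large s-classes
meeting a common 5-cycle coincide. Finally, an odd set closed under non-matching edges is left by at
least four matching edges (`four_le_exits`). Their number is odd; one would be a bridge contained in
every matching, against the value 1/3, and three would be a 3-cut inside one matching. This rules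
out many small odd classes, and is how class sizes are pushed up by one.

Averaging. Every edge has total weight 1/3. A bound z_i(v) ≤ α + Σ c_e [e ∈ M_i] that holds in every
cover therefore gives z(v) ≤ α + (1/3) Σ c_e (`CoverFamily.avg_le`). For chorded 4-cycles and
induced 4- and 5-cycles it remains to list how a matching can meet the cycle and its outgoing edges,
to bound the class of v from below in each case, and to choose weights c_e. Reducedness supplies the
non-adjacencies that keep the listed vertices distinct.

Induced 6-cycles need the sum over the cycle. If one of its vertices falls under the 4- or 5-cycle
case, that vertex saves 1/60. Otherwise every vertex contributes at most 4/3 in every cover, and a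
cover saves 1/30 unless it is heavy, meaning that all six vertices contribute more than 13/10. In a
heavy cover all six vertices lie in s₂-classes of exactly six vertices. This forces so much
structure that splits of the hexagon into two paths, by matching edges leaving it at two opposite
vertices, occur along at most one of the three axes (`not_split_of_split`). With the axis a–d chosen
so that no other one is split, a combination of matching indicators with mean 1/3 is at most 1
everywhere and at most 0 on heavy covers, which saves 1/90 on average. -/

namespace CubicTour
open SimpleGraph

/-! ### Short cycles given by their vertices -/

section ShortCycles

variable {V : Type*} {G : SimpleGraph V}

/-- `a, b, c, d` are the consecutive vertices of a 4-cycle. -/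
def IsCyc4 (G : SimpleGraph V) (a b c d : V) : Prop :=
  [a, b, c, d].Nodup ∧ G.Adj a b ∧ G.Adj b c ∧ G.Adj c d ∧ G.Adj d a

/-- `a, b, c, d, e` are the consecutive vertices of a 5-cycle. -/
def IsCyc5 (G : SimpleGraph V) (a b c d e : V) : Prop :=
  [a, b, c, d, e].Nodup ∧ G.Adj a b ∧ G.Adj b c ∧ G.Adj c d ∧ G.Adj d e ∧ G.Adj e a

/-- `a, b, c, d, e, f` are the consecutive vertices of a 6-cycle. -/
def IsCyc6 (G : SimpleGraph V) (a b c d e f : V) : Prop :=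
  [a, b, c, d, e, f].Nodup ∧
    G.Adj a b ∧ G.Adj b c ∧ G.Adj c d ∧ G.Adj d e ∧ G.Adj e f ∧ G.Adj f a

lemma exists_isCyc4 {u : V} {p : G.Walk u u} (hp : p.IsCycle) (hl : p.length = 4) :
    ∃ b c d, IsCyc4 G u b c d ∧ p.support = [u, b, c, d, u] ∧
      p.edges = [s(u, b), s(b, c), s(c, d), s(d, u)] := by
  have hn := hp.support_nodup
  match p, hl with
  | .cons (v := b) h₁ (.cons (v := c) h₂ (.cons (v := d) h₃ (.cons h₄ .nil))), _ =>
    refine ⟨b, c, d, ⟨?_, h₁, h₂, h₃, h₄⟩, rfl, rfl⟩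
    simp only [Walk.support_cons, Walk.support_nil, List.tail_cons] at hn
    grind

lemma exists_isCyc5 {u : V} {p : G.Walk u u} (hp : p.IsCycle) (hl : p.length = 5) :
    ∃ b c d e, IsCyc5 G u b c d e ∧ p.support = [u, b, c, d, e, u] ∧
      p.edges = [s(u, b), s(b, c), s(c, d), s(d, e), s(e, u)] := by
  have hn := hp.support_nodup
  match p, hl with
  | .cons (v := b) h₁ (.cons (v := c) h₂ (.cons (v := d) h₃ (.cons (v := e) h₄
      (.cons h₅ .nil)))), _ =>
    refine ⟨b, c, d, e, ⟨?_, h₁, h₂, h₃, h₄, h₅⟩, rfl, rfl⟩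
    simp only [Walk.support_cons, Walk.support_nil, List.tail_cons] at hn
    grind

lemma exists_isCyc6 {u : V} {p : G.Walk u u} (hp : p.IsCycle) (hl : p.length = 6) :
    ∃ b c d e f, IsCyc6 G u b c d e f ∧ p.support = [u, b, c, d, e, f, u] ∧
      p.edges = [s(u, b), s(b, c), s(c, d), s(d, e), s(e, f), s(f, u)] := by
  have hn := hp.support_nodup
  match p, hl with
  | .cons (v := b) h₁ (.cons (v := c) h₂ (.cons (v := d) h₃ (.cons (v := e) h₄
      (.cons (v := f) h₅ (.cons h₆ .nil))))), _ =>
    refine ⟨b, c, d, e, f, ⟨?_, h₁, h₂, h₃, h₄, h₅, h₆⟩, rfl, rfl⟩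
    simp only [Walk.support_cons, Walk.support_nil, List.tail_cons] at hn
    grind

lemma IsCyc4.exists_walk {a b c d : V} (h : IsCyc4 G a b c d) :
    ∃ p : G.Walk a a, p.IsCycle ∧ p.length = 4 ∧ p.support = [a, b, c, d, a] ∧
      p.edges = [s(a, b), s(b, c), s(c, d), s(d, a)] := by
  obtain ⟨hn, h₁, h₂, h₃, h₄⟩ := h
  refine ⟨.cons h₁ (.cons h₂ (.cons h₃ (.cons h₄ .nil))), ?_, rfl, rfl, rfl⟩
  simp only [List.nodup_cons, List.mem_cons, List.not_mem_nil, not_or, or_false] at hn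
  simp only [Walk.cons_isCycle_iff, Walk.cons_isPath_iff, Walk.IsPath.nil, Walk.support_cons,
    Walk.support_nil, Walk.edges_cons, Walk.edges_nil, List.mem_cons, List.not_mem_nil, or_false,
    Sym2.eq_iff]
  grind

lemma IsCyc5.exists_walk {a b c d e : V} (h : IsCyc5 G a b c d e) :
    ∃ p : G.Walk a a, p.IsCycle ∧ p.length = 5 ∧ p.support = [a, b, c, d, e, a] ∧
      p.edges = [s(a, b), s(b, c), s(c, d), s(d, e), s(e, a)] := by
  obtain ⟨hn, h₁, h₂, h₃, h₄, h₅⟩ := h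
  refine ⟨.cons h₁ (.cons h₂ (.cons h₃ (.cons h₄ (.cons h₅ .nil)))), ?_, rfl, rfl, rfl⟩
  simp only [List.nodup_cons, List.mem_cons, List.not_mem_nil, not_or, or_false] at hn
  simp only [Walk.cons_isCycle_iff, Walk.cons_isPath_iff, Walk.IsPath.nil, Walk.support_cons,
    Walk.support_nil, Walk.edges_cons, Walk.edges_nil, List.mem_cons, List.not_mem_nil, or_false,
    Sym2.eq_iff]
  grind

lemma IsCyc6.exists_walk {a b c d e f : V} (h : IsCyc6 G a b c d e f) :
    ∃ p : G.Walk a a, p.IsCycle ∧ p.length = 6 ∧ p.support = [a, b, c, d, e, f, a] ∧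
      p.edges = [s(a, b), s(b, c), s(c, d), s(d, e), s(e, f), s(f, a)] := by
  obtain ⟨hn, h₁, h₂, h₃, h₄, h₅, h₆⟩ := h
  refine ⟨.cons h₁ (.cons h₂ (.cons h₃ (.cons h₄ (.cons h₅ (.cons h₆ .nil))))), ?_, rfl, rfl, rfl⟩
  simp only [List.nodup_cons, List.mem_cons, List.not_mem_nil, not_or, or_false] at hn
  simp only [Walk.cons_isCycle_iff, Walk.cons_isPath_iff, Walk.IsPath.nil, Walk.support_cons,
    Walk.support_nil, Walk.edges_cons, Walk.edges_nil, List.mem_cons, List.not_mem_nil, or_false,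
    Sym2.eq_iff]
  grind

lemma IsCyc5.rotate {a b c d e : V} (h : IsCyc5 G a b c d e) : IsCyc5 G b c d e a := by
  unfold IsCyc5 at *; grind

lemma IsCyc6.rotate {a b c d e f : V} (h : IsCyc6 G a b c d e f) : IsCyc6 G b c d e f a := by
  unfold IsCyc6 at *; grind

lemma IsCyc4.rotate {a b c d : V} (h : IsCyc4 G a b c d) : IsCyc4 G b c d a := by
  unfold IsCyc4 at *; grind

/-- In a reduced graph a 6-cycle has no chord. -/
lemma IsReduced.not_adj (hG : IsReduced G) {a b c d e f : V} (h : IsCyc6 G a b c d e f) :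
    ¬ G.Adj a c ∧ ¬ G.Adj a d := by
  obtain ⟨p, hp, hl, hs, he⟩ := h.exists_walk
  have hc := hG a p hp hl
  rw [Walk.isChordless_iff_forall_mem_edges] at hc
  have hn := h.1
  constructor <;> intro hadj
  · have := hc (u' := a) (v' := c) (by simp [hs]) (by simp [hs]) hadj
    simp only [he, List.mem_cons, List.not_mem_nil, or_false, Sym2.eq_iff] at this
    simp only [List.nodup_cons, List.mem_cons, List.not_mem_nil, not_or, or_false] at hn
    grind
  · have := hc (u' := a) (v' := d) (by simp [hs]) (by simp [hs]) hadj
    simp only [he, List.mem_cons, List.not_mem_nil, or_false, Sym2.eq_iff] at this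
    simp only [List.nodup_cons, List.mem_cons, List.not_mem_nil, not_or, or_false] at hn
    grind

lemma isChordedFourCycle_of_adj {a b c d : V} (h : IsCyc4 G a b c d) (hbd : G.Adj b d) :
    IsChordedFourCycle G {a, b, c, d} := by
  obtain ⟨p, hp, hl, hs, he⟩ := h.exists_walk
  refine ⟨a, p, hp, hl, ?_, ?_⟩
  · rw [Walk.isChordless_iff_forall_mem_edges]
    intro hc
    have := hc (u' := b) (v' := d) (by simp [hs]) (by simp [hs]) hbd
    have hn := h.1
    simp only [he, List.mem_cons, List.not_mem_nil, or_false, Sym2.eq_iff] at this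
    simp only [List.nodup_cons, List.mem_cons, List.not_mem_nil, not_or, or_false] at hn
    grind
  · ext x; simp only [walkVerts, hs]; grind

lemma IsChordedFourCycle.exists_isCyc4 {D : Set V} (h : IsChordedFourCycle G D) :
    ∃ a b c d, IsCyc4 G a b c d ∧ G.Adj b d ∧ D = {a, b, c, d} := by
  obtain ⟨u, p, hp, hl, hc, hD⟩ := h
  obtain ⟨b, c, d, h4, hs, he⟩ := CubicTour.exists_isCyc4 hp hl
  have hDe : D = {u, b, c, d} := by rw [hD]; ext x; simp only [walkVerts, hs]; grind
  rw [Walk.isChordless_iff_forall_mem_edges] at hc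
  push Not at hc
  obtain ⟨x, y, hx, hy, hxy, hne⟩ := hc
  rw [hs] at hx hy
  rw [he] at hne
  have hxy' := hxy.ne
  have : G.Adj u c ∨ G.Adj b d := by
    have := hxy.symm
    simp only [List.mem_cons, List.not_mem_nil, or_false] at hx hy hne
    rcases hx with rfl | rfl | rfl | rfl | rfl <;> rcases hy with rfl | rfl | rfl | rfl | rfl <;>
      simp_all
  rcases this with h1 | h1
  · exact ⟨b, c, d, u, h4.rotate, h1.symm, by rw [hDe]; ext; grind⟩
  · exact ⟨u, b, c, d, h4, h1, hDe⟩

end ShortCycles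

end CubicTour

namespace CubicTour
open SimpleGraph

/-! ### Two-factors of cubic graphs and switching along a cycle -/

section TwoFactors

variable {V : Type*} {G F F' : SimpleGraph V}

/-- `a, b, c` are the three neighbours of `v`. -/
def IsNbrs (G : SimpleGraph V) (v a b c : V) : Prop :=
  a ≠ b ∧ a ≠ c ∧ b ≠ c ∧ ∀ x, G.Adj v x ↔ x = a ∨ x = b ∨ x = c

lemma exists_isNbrs [Fintype V] [DecidableRel G.Adj] (hG : G.IsRegularOfDegree 3) {v a b : V}
    (ha : G.Adj v a) (hb : G.Adj v b) (hab : a ≠ b) : ∃ c, IsNbrs G v a b c := by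
  classical
  have h3 : (G.neighborFinset v).card = 3 := hG v
  have hsub : {a, b} ⊆ G.neighborFinset v := by
    intro x; simp only [Finset.mem_insert, Finset.mem_singleton, mem_neighborFinset]
    rintro (rfl | rfl) <;> assumption
  have h1 : (G.neighborFinset v \ {a, b}).card = 1 := by
    rw [Finset.card_sdiff_of_subset hsub, h3, Finset.card_pair hab]
  obtain ⟨c, hc⟩ := Finset.card_eq_one.mp h1
  have key : ∀ x, (G.Adj v x ∧ ¬ (x = a ∨ x = b)) ↔ x = c := fun x => by
    have := Finset.ext_iff.mp hc x
    simpa using this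
  refine ⟨c, hab, ?_, ?_, fun x => ?_⟩
  · rintro rfl; exact ((key a).2 rfl).2 (.inl rfl)
  · rintro rfl; exact ((key b).2 rfl).2 (.inr rfl)
  · have := key x
    constructor
    · intro h; tauto
    · rintro (rfl | rfl | rfl)
      · exact ha
      · exact hb
      · exact ((key x).2 rfl).1

lemma exists_isNbrs_self [Fintype V] [DecidableRel G.Adj] (hG : G.IsRegularOfDegree 3) (v : V) :
    ∃ a b c, IsNbrs G v a b c := by
  have h3 : (G.neighborFinset v).card = 3 := hG v
  obtain ⟨a, ha, b, hb, hab⟩ := Finset.one_lt_card.mp (by omega : 1 < (G.neighborFinset v).card)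
  rw [mem_neighborFinset] at ha hb
  exact ⟨a, b, exists_isNbrs hG ha hb hab⟩

/-- `F` is a spanning 2-regular subgraph of `G`. -/
def IsTwoFactor (G F : SimpleGraph V) : Prop :=
  F ≤ G ∧ ∀ v, (F.neighborSet v).ncard = 2

lemma IsTwoFactor.exists_nbrs (hF : IsTwoFactor G F) (v : V) :
    ∃ a b, a ≠ b ∧ ∀ x, F.Adj v x ↔ x = a ∨ x = b := by
  obtain ⟨a, b, hab, h⟩ := Set.ncard_eq_two.mp (hF.2 v)
  refine ⟨a, b, hab, fun x => ?_⟩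
  have := Set.ext_iff.mp h x
  simpa using this

lemma isTwoFactor_of_nbrs (hF : F ≤ G)
    (h : ∀ v, ∃ a b, a ≠ b ∧ ∀ x, F.Adj v x ↔ x = a ∨ x = b) : IsTwoFactor G F := by
  refine ⟨hF, fun v => ?_⟩
  obtain ⟨a, b, hab, h⟩ := h v
  rw [Set.ncard_eq_two]
  exact ⟨a, b, hab, by ext x; simp [h]⟩

lemma IsTwoFactor.isCycles (hF : IsTwoFactor G F) : F.IsCycles := fun v _ => hF.2 v

/-- `F` omits exactly one of the three edges at `v`, so it cannot omit two. -/
lemma IsTwoFactor.adj_or_adj (hF : IsTwoFactor G F) {v p n o : V} (hv : IsNbrs G v p n o) :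
    F.Adj v p ∨ F.Adj v n := by
  obtain ⟨a, b, hab, h⟩ := hF.exists_nbrs v
  have ha := (hv.2.2.2 a).1 (hF.1 ((h a).2 (.inl rfl)))
  have hb := (hv.2.2.2 b).1 (hF.1 ((h b).2 (.inr rfl)))
  have := hv.1; have := hv.2.1; have := hv.2.2.1
  rw [h, h]
  grind

lemma IsTwoFactor.adj_iff (hF : IsTwoFactor G F) {v p n o : V} (hv : IsNbrs G v p n o)
    (hn : ¬ F.Adj v n) (x : V) : F.Adj v x ↔ x = p ∨ x = o := by
  obtain ⟨a, b, hab, h⟩ := hF.exists_nbrs v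
  have ha := (hv.2.2.2 a).1 (hF.1 ((h a).2 (.inl rfl)))
  have hb := (hv.2.2.2 b).1 (hF.1 ((h b).2 (.inr rfl)))
  have := hv.1; have := hv.2.1; have := hv.2.2.1
  rw [h] at hn ⊢
  grind

/-- Replacing, in a two-factor, the edges of `E` by the complementary ones yields a two-factor
with larger components, provided that every component uses at most one edge of `E`. -/
lemma IsTwoFactor.switch [Finite V] (hF : IsTwoFactor G F) {E : Set (Sym2 V)}
    (hF' : F'.edgeSet = symmDiff F.edgeSet E)
    (hloc : ∀ v, (∀ x, s(v, x) ∉ E) ∨ ∃ p n o, IsNbrs G v p n o ∧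
      (∀ x, s(v, x) ∈ E ↔ x = p ∨ x = n) ∧ ∀ x, F.Adj v x ↔ x = p ∨ x = o)
    (hone : ∀ x y x' y', s(x, y) ∈ E → s(x', y') ∈ E → F.Adj x y → F.Adj x' y' →
      F.Reachable x x' → s(x, y) = s(x', y')) :
    IsTwoFactor G F' ∧ ∀ x y, F.Reachable x y → F'.Reachable x y := by
  have hadj : ∀ x y, F'.Adj x y ↔ (F.Adj x y ∧ s(x, y) ∉ E) ∨ (s(x, y) ∈ E ∧ ¬ F.Adj x y) := by
    intro x y
    rw [← mem_edgeSet, hF', Set.mem_symmDiff, mem_edgeSet]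
  have hnb : ∀ v, ∃ a b, a ≠ b ∧ ∀ x, F'.Adj v x ↔ x = a ∨ x = b := by
    intro v
    rcases hloc v with h | ⟨p, n, o, hv, hE, hFv⟩
    · obtain ⟨a, b, hab, h2⟩ := hF.exists_nbrs v
      exact ⟨a, b, hab, fun x => by rw [hadj, h2]; simp [h]⟩
    · refine ⟨n, o, hv.2.2.1, fun x => ?_⟩
      have := hv.1; have := hv.2.1; have := hv.2.2.1
      rw [hadj, hE, hFv]
      grind
  refine ⟨isTwoFactor_of_nbrs ?_ hnb, fun x y hxy => ?_⟩
  · intro x y hxy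
    rcases (hadj x y).1 hxy with h | h
    · exact hF.1 h.1
    · rcases hloc x with h' | ⟨p, n, o, hv, hE, -⟩
      · exact absurd h.1 (h' y)
      · rw [hv.2.2.2]
        rcases (hE y).1 h.1 with rfl | rfl <;> simp
  · suffices hstep : ∀ a b, F.Adj a b → F'.Reachable a b by
      obtain ⟨w⟩ := hxy
      induction w with
      | nil => rfl
      | cons h _ ih => exact (hstep _ _ h).trans ih
    intro a b hab
    by_cases he : s(a, b) ∈ E
    -- The deleted edge lies on a cycle of `F`. By `hone` this is the only edge of `E` on that
    -- cycle, so the rest of the cycle survives and still joins `a` to `b`.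
    · obtain ⟨w⟩ := hF.isCycles.reachable_deleteEdges hab
      have key : ∀ {u v : V} (w : (F.deleteEdges {s(a, b)}).Walk u v), F.Reachable u a →
          F'.Reachable u v := by
        intro u v w
        induction w with
        | nil => intro _; rfl
        | @cons u z v h _ ih =>
          intro hu
          rw [deleteEdges_adj] at h
          have h1 : F'.Adj u z := by
            rw [hadj]
            refine .inl ⟨h.1, fun h2 => h.2 ?_⟩
            exact hone u z a b h2 he h.1 hab hu
          exact h1.reachable.trans (ih (h.1.symm.reachable.trans hu))
      exact key w (.refl _)
    · exact ((hadj a b).2 (.inl ⟨hab, he⟩)).reachable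

end TwoFactors

/-! ### Switching along 6-cycles and 4-cycles. -/

section Switching

variable {V : Type*} [Fintype V] {G F F' : SimpleGraph V} [DecidableRel G.Adj]

/-- Switching a two-factor along a 6-cycle that meets three of its components in one edge each. -/
lemma IsTwoFactor.switch_cyc6 (hG : G.IsRegularOfDegree 3) (hF : IsTwoFactor G F)
    {a b c d e f : V} (h : IsCyc6 G a b c d e f) {E : Set (Sym2 V)}
    (hE : ∀ x, x ∈ E ↔ x = s(a, b) ∨ x = s(b, c) ∨ x = s(c, d) ∨ x = s(d, e) ∨ x = s(e, f) ∨
      x = s(f, a))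
    (hF' : F'.edgeSet = symmDiff F.edgeSet E)
    (hab : F.Reachable a b) (hcd : F.Reachable c d) (hef : F.Reachable e f)
    (hac : ¬ F.Reachable a c) (hce : ¬ F.Reachable c e) (hea : ¬ F.Reachable e a) :
    IsTwoFactor G F' ∧ ∀ x y, F.Reachable x y → F'.Reachable x y := by
  obtain ⟨hn, h1, h2, h3, h4, h5, h6⟩ := h
  simp only [List.nodup_cons, List.mem_cons, List.not_mem_nil, not_or, or_false] at hn
  have hbc : ¬ F.Reachable b c := fun h => hac (hab.trans h)
  have hde : ¬ F.Reachable d e := fun h => hce (hcd.trans h)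
  have hfa : ¬ F.Reachable f a := fun h => hea (hef.trans h)
  -- At each vertex of the hexagon one hexagon edge leads to another component, hence is not in `F`;
  -- so `F` uses the other hexagon edge and the outer edge.
  have loc : ∀ v p n, G.Adj v p → G.Adj v n → p ≠ n → ¬ F.Reachable v n →
      (∀ x, s(v, x) ∈ E ↔ x = p ∨ x = n) → ∃ p n o, IsNbrs G v p n o ∧
      (∀ x, s(v, x) ∈ E ↔ x = p ∨ x = n) ∧ ∀ x, F.Adj v x ↔ x = p ∨ x = o := by
    intro v p n hp hn hpn hr hx
    obtain ⟨o, ho⟩ := exists_isNbrs hG hp hn hpn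
    exact ⟨p, n, o, ho, hx, hF.adj_iff ho fun h => hr h.reachable⟩
  refine hF.switch hF' (fun v => ?_) ?_
  · by_cases hva : v = a
    · subst hva; right
      exact loc v b f h1 h6.symm (by grind) (fun h => hfa h.symm)
        (fun x => by simp only [hE, Sym2.eq_iff]; grind)
    by_cases hvb : v = b
    · subst hvb; right
      exact loc v a c h1.symm h2 (by grind) hbc (fun x => by simp only [hE, Sym2.eq_iff]; grind)
    by_cases hvc : v = c
    · subst hvc; right
      exact loc v d b h3 h2.symm (by grind) (fun h => hbc h.symm)
        (fun x => by simp only [hE, Sym2.eq_iff]; grind)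
    by_cases hvd : v = d
    · subst hvd; right
      exact loc v c e h3.symm h4 (by grind) hde (fun x => by simp only [hE, Sym2.eq_iff]; grind)
    by_cases hve : v = e
    · subst hve; right
      exact loc v f d h5 h4.symm (by grind) (fun h => hde h.symm)
        (fun x => by simp only [hE, Sym2.eq_iff]; grind)
    by_cases hvf : v = f
    · subst hvf; right
      exact loc v e a h5.symm h6 (by grind) hfa (fun x => by simp only [hE, Sym2.eq_iff]; grind)
    left
    intro x
    simp only [hE, Sym2.eq_iff]; grind
  -- The edges `bc`, `de`, `fa` join different components, so `F` contains at most `ab`, `cd`, `ef`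
  -- of the hexagon, and these lie in three different components.
  · have key : ∀ x y, s(x, y) ∈ E → F.Adj x y →
        (F.Reachable a x ∧ s(x, y) = s(a, b)) ∨ (F.Reachable c x ∧ s(x, y) = s(c, d)) ∨
        (F.Reachable e x ∧ s(x, y) = s(e, f)) := by
      intro x y hxy hadj
      have hr := hadj.reachable
      have hr' := hr.symm
      rw [hE] at hxy
      rcases hxy with h | h | h | h | h | h
      · refine .inl ⟨?_, h⟩; rcases Sym2.eq_iff.mp h with ⟨rfl, rfl⟩ | ⟨rfl, rfl⟩
        · exact .refl _
        · exact hr'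
      · rcases Sym2.eq_iff.mp h with ⟨rfl, rfl⟩ | ⟨rfl, rfl⟩ <;> contradiction
      · refine .inr (.inl ⟨?_, h⟩); rcases Sym2.eq_iff.mp h with ⟨rfl, rfl⟩ | ⟨rfl, rfl⟩
        · exact .refl _
        · exact hr'
      · rcases Sym2.eq_iff.mp h with ⟨rfl, rfl⟩ | ⟨rfl, rfl⟩ <;> contradiction
      · refine .inr (.inr ⟨?_, h⟩); rcases Sym2.eq_iff.mp h with ⟨rfl, rfl⟩ | ⟨rfl, rfl⟩
        · exact .refl _
        · exact hr'
      · rcases Sym2.eq_iff.mp h with ⟨rfl, rfl⟩ | ⟨rfl, rfl⟩ <;> contradiction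
    intro x y x' y' hx hx' hxy hxy' hr
    rcases key x y hx hxy with ⟨r, k⟩ | ⟨r, k⟩ | ⟨r, k⟩ <;>
    rcases key x' y' hx' hxy' with ⟨r', k'⟩ | ⟨r', k'⟩ | ⟨r', k'⟩
    · rw [k, k']
    · exact absurd (r.trans (hr.trans r'.symm)) hac
    · exact absurd (r.trans (hr.trans r'.symm)).symm hea
    · exact absurd (r.trans (hr.trans r'.symm)).symm hac
    · rw [k, k']
    · exact absurd (r.trans (hr.trans r'.symm)) hce
    · exact absurd (r.trans (hr.trans r'.symm)) hea
    · exact absurd (r.trans (hr.trans r'.symm)).symm hce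
    · rw [k, k']

/-- Switching a two-factor along a 4-cycle that meets two of its components in one edge each. -/
lemma IsTwoFactor.switch_cyc4 (hG : G.IsRegularOfDegree 3) (hF : IsTwoFactor G F)
    {a b c d : V} (h : IsCyc4 G a b c d) {E : Set (Sym2 V)}
    (hE : ∀ x, x ∈ E ↔ x = s(a, b) ∨ x = s(b, c) ∨ x = s(c, d) ∨ x = s(d, a))
    (hF' : F'.edgeSet = symmDiff F.edgeSet E)
    (hab : F.Reachable a b) (hcd : F.Reachable c d) (hac : ¬ F.Reachable a c) :
    IsTwoFactor G F' ∧ ∀ x y, F.Reachable x y → F'.Reachable x y := by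
  obtain ⟨hn, h1, h2, h3, h4⟩ := h
  simp only [List.nodup_cons, List.mem_cons, List.not_mem_nil, not_or, or_false] at hn
  have hbc : ¬ F.Reachable b c := fun h => hac (hab.trans h)
  have hda : ¬ F.Reachable d a := fun h => hac (hcd.trans h).symm
  have loc : ∀ v p n, G.Adj v p → G.Adj v n → p ≠ n → ¬ F.Reachable v n →
      (∀ x, s(v, x) ∈ E ↔ x = p ∨ x = n) → ∃ p n o, IsNbrs G v p n o ∧
      (∀ x, s(v, x) ∈ E ↔ x = p ∨ x = n) ∧ ∀ x, F.Adj v x ↔ x = p ∨ x = o := by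
    intro v p n hp hn hpn hr hx
    obtain ⟨o, ho⟩ := exists_isNbrs hG hp hn hpn
    exact ⟨p, n, o, ho, hx, hF.adj_iff ho fun h => hr h.reachable⟩
  refine hF.switch hF' (fun v => ?_) ?_
  · by_cases hva : v = a
    · subst hva; right
      exact loc v b d h1 h4.symm (by grind) (fun h => hda h.symm)
        (fun x => by simp only [hE, Sym2.eq_iff]; grind)
    by_cases hvb : v = b
    · subst hvb; right
      exact loc v a c h1.symm h2 (by grind) hbc (fun x => by simp only [hE, Sym2.eq_iff]; grind)
    by_cases hvc : v = c
    · subst hvc; right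
      exact loc v d b h3 h2.symm (by grind) (fun h => hbc h.symm)
        (fun x => by simp only [hE, Sym2.eq_iff]; grind)
    by_cases hvd : v = d
    · subst hvd; right
      exact loc v c a h3.symm h4 (by grind) hda (fun x => by simp only [hE, Sym2.eq_iff]; grind)
    left
    intro x
    simp only [hE, Sym2.eq_iff]; grind
  · have key : ∀ x y, s(x, y) ∈ E → F.Adj x y →
        (F.Reachable a x ∧ s(x, y) = s(a, b)) ∨ (F.Reachable c x ∧ s(x, y) = s(c, d)) := by
      intro x y hxy hadj
      have hr := hadj.reachable
      have hr' := hr.symm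
      rw [hE] at hxy
      rcases hxy with h | h | h | h
      · refine .inl ⟨?_, h⟩; rcases Sym2.eq_iff.mp h with ⟨rfl, rfl⟩ | ⟨rfl, rfl⟩
        · exact .refl _
        · exact hr'
      · rcases Sym2.eq_iff.mp h with ⟨rfl, rfl⟩ | ⟨rfl, rfl⟩ <;> contradiction
      · refine .inr ⟨?_, h⟩; rcases Sym2.eq_iff.mp h with ⟨rfl, rfl⟩ | ⟨rfl, rfl⟩
        · exact .refl _
        · exact hr'
      · rcases Sym2.eq_iff.mp h with ⟨rfl, rfl⟩ | ⟨rfl, rfl⟩ <;> contradiction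
    intro x y x' y' hx hx' hxy hxy' hr
    rcases key x y hx hxy with ⟨r, k⟩ | ⟨r, k⟩ <;>
    rcases key x' y' hx' hxy' with ⟨r', k'⟩ | ⟨r', k'⟩
    · rw [k, k']
    · exact absurd (r.trans (hr.trans r'.symm)) hac
    · exact absurd (r.trans (hr.trans r'.symm)).symm hac
    · rw [k, k']

end Switching
end CubicTour

namespace CubicTour
open SimpleGraph

/-! ### The operations (U1) and (U2) -/

section Classes

/-- Read the labels cyclically: every label agrees with a neighbouring one, so blocks have length at
least two, and three labels on six places leave only three blocks of length two. -/
lemma three_classes_hexagon {Q : Type*} {a b c d e f x y z : Q}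
    (hx : x ∈ [a, b, c, d, e, f]) (hy : y ∈ [a, b, c, d, e, f]) (hz : z ∈ [a, b, c, d, e, f])
    (hxy : x ≠ y) (hxz : x ≠ z) (hyz : y ≠ z)
    (ha : a = b ∨ a = f) (hb : b = a ∨ b = c) (hc : c = b ∨ c = d) (hd : d = c ∨ d = e)
    (he : e = d ∨ e = f) (hf : f = e ∨ f = a) :
    (a = b ∧ c = d ∧ e = f ∧ a ≠ c ∧ c ≠ e ∧ e ≠ a) ∨
      (b = c ∧ d = e ∧ f = a ∧ b ≠ d ∧ d ≠ f ∧ f ≠ b) := by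
  have key : ∀ p q, (∀ w ∈ [a, b, c, d, e, f], w = p ∨ w = q) → False := by
    intro p q h
    have := h x hx; have := h y hy; have := h z hz
    grind
  simp only [List.mem_cons, List.not_mem_nil, or_false, forall_eq_or_imp, forall_eq] at key
  clear hx hy hz hxy hxz hyz
  have k1 := key a b; have k2 := key a c; have k3 := key a d; have k4 := key a e
  have k5 := key b d
  have k6 := key b f
  have k7 := key c e
  have k8 := key d f
  clear key
  grind (splits := 40)

lemma two_classes_square {Q : Type*} {a b c d x y : Q}
    (hx : x ∈ [a, b, c, d]) (hy : y ∈ [a, b, c, d]) (hxy : x ≠ y)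
    (ha : a = b ∨ a = d) (hb : b = a ∨ b = c) (hc : c = b ∨ c = d) (hd : d = c ∨ d = a) :
    (a = b ∧ c = d ∧ a ≠ c) ∨ (b = c ∧ d = a ∧ b ≠ d) := by
  grind (splits := 40)

end Classes

section SimpleSteps

variable {V : Type*} [Fintype V] {G F F' : SimpleGraph V} [DecidableRel G.Adj]

lemma IsTwoFactor.adj_cycle (hG : G.IsRegularOfDegree 3) (hF : IsTwoFactor G F) {v p n : V}
    (hp : G.Adj v p) (hn : G.Adj v n) (hpn : p ≠ n) : F.Adj v p ∨ F.Adj v n := by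
  obtain ⟨o, ho⟩ := exists_isNbrs hG hp hn hpn
  exact hF.adj_or_adj ho

/-- Each vertex of the hexagon has an `F`-neighbour on the hexagon, so the component labels satisfy
the hypotheses of `three_classes_hexagon`. -/
lemma IsTwoFactor.hexagon_classes (hG : G.IsRegularOfDegree 3) (hF : IsTwoFactor G F)
    {a b c d e f x y z : V} (h : IsCyc6 G a b c d e f)
    (hx : x ∈ [a, b, c, d, e, f]) (hy : y ∈ [a, b, c, d, e, f]) (hz : z ∈ [a, b, c, d, e, f])
    (hxy : ¬ F.Reachable x y) (hxz : ¬ F.Reachable x z) (hyz : ¬ F.Reachable y z) :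
    (F.Reachable a b ∧ F.Reachable c d ∧ F.Reachable e f ∧
      ¬ F.Reachable a c ∧ ¬ F.Reachable c e ∧ ¬ F.Reachable e a) ∨
    (F.Reachable b c ∧ F.Reachable d e ∧ F.Reachable f a ∧
      ¬ F.Reachable b d ∧ ¬ F.Reachable d f ∧ ¬ F.Reachable f b) := by
  obtain ⟨hn, h1, h2, h3, h4, h5, h6⟩ := h
  simp only [List.nodup_cons, List.mem_cons, List.not_mem_nil, not_or, or_false] at hn
  have adj : ∀ v p n, G.Adj v p → G.Adj v n → p ≠ n →
      F.connectedComponentMk v = F.connectedComponentMk p ∨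
      F.connectedComponentMk v = F.connectedComponentMk n := fun v p n hp hn hpn => by
    rw [ConnectedComponent.eq, ConnectedComponent.eq]
    exact (hF.adj_cycle hG hp hn hpn).imp Adj.reachable Adj.reachable
  simp only [← ConnectedComponent.eq] at *
  refine three_classes_hexagon (x := F.connectedComponentMk x) (y := F.connectedComponentMk y)
    (z := F.connectedComponentMk z) (List.mem_map_of_mem hx) (List.mem_map_of_mem hy)
    (List.mem_map_of_mem hz) hxy hxz hyz (adj _ _ _ h1 h6.symm ?_) (adj _ _ _ h1.symm h2 ?_)
    (adj _ _ _ h2.symm h3 ?_) (adj _ _ _ h3.symm h4 ?_) (adj _ _ _ h4.symm h5 ?_)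
    (adj _ _ _ h5.symm h6 ?_) <;> grind

lemma IsTwoFactor.square_classes (hG : G.IsRegularOfDegree 3) (hF : IsTwoFactor G F)
    {a b c d x y : V} (h : IsCyc4 G a b c d)
    (hx : x ∈ [a, b, c, d]) (hy : y ∈ [a, b, c, d]) (hxy : ¬ F.Reachable x y) :
    (F.Reachable a b ∧ F.Reachable c d ∧ ¬ F.Reachable a c) ∨
    (F.Reachable b c ∧ F.Reachable d a ∧ ¬ F.Reachable b d) := by
  obtain ⟨hn, h1, h2, h3, h4⟩ := h
  simp only [List.nodup_cons, List.mem_cons, List.not_mem_nil, not_or, or_false] at hn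
  have adj : ∀ v p n, G.Adj v p → G.Adj v n → p ≠ n →
      F.connectedComponentMk v = F.connectedComponentMk p ∨
      F.connectedComponentMk v = F.connectedComponentMk n := fun v p n hp hn hpn => by
    rw [ConnectedComponent.eq, ConnectedComponent.eq]
    exact (hF.adj_cycle hG hp hn hpn).imp Adj.reachable Adj.reachable
  simp only [← ConnectedComponent.eq] at *
  refine two_classes_square (x := F.connectedComponentMk x) (y := F.connectedComponentMk y)
    (List.mem_map_of_mem hx) (List.mem_map_of_mem hy) hxy (adj _ _ _ h1 h4.symm ?_)
    (adj _ _ _ h1.symm h2 ?_) (adj _ _ _ h2.symm h3 ?_) (adj _ _ _ h3.symm h4 ?_) <;> grind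

lemma StepU1.isTwoFactor (hG : G.IsRegularOfDegree 3) (hF : IsTwoFactor G F)
    (h : StepU1 G F F') : IsTwoFactor G F' ∧ ∀ x y, F.Reachable x y → F'.Reachable x y := by
  obtain ⟨u, C, c₁, c₂, c₃, hC, hl, h12, h13, h23, ⟨x, hx, hxC⟩, ⟨y, hy, hyC⟩, ⟨z, hz, hzC⟩, hF'⟩ :=
    h
  obtain ⟨b, c, d, e, f, h6, hs, he⟩ := exists_isCyc6 hC hl
  have hmem : ∀ w, w ∈ walkVerts C → w ∈ [u, b, c, d, e, f] := by
    intro w hw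
    simp only [walkVerts, hs, Set.mem_ofPred_eq] at hw
    grind
  rw [ConnectedComponent.mem_supp_iff] at hx hy hz
  have hE : ∀ x, x ∈ walkEdges C ↔ x = s(u, b) ∨ x = s(b, c) ∨ x = s(c, d) ∨ x = s(d, e) ∨
      x = s(e, f) ∨ x = s(f, u) := by simp [walkEdges, he]
  rcases hF.hexagon_classes hG h6 (hmem x hxC) (hmem y hyC) (hmem z hzC)
    (by rw [← ConnectedComponent.eq, hx, hy]; exact h12)
    (by rw [← ConnectedComponent.eq, hx, hz]; exact h13)
    (by rw [← ConnectedComponent.eq, hy, hz]; exact h23) with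
    ⟨k1, k2, k3, k4, k5, k6⟩ | ⟨k1, k2, k3, k4, k5, k6⟩
  · exact hF.switch_cyc6 hG h6 hE hF' k1 k2 k3 k4 k5 k6
  · exact hF.switch_cyc6 hG h6.rotate (fun x => by rw [hE]; tauto) hF' k1 k2 k3 k4 k5 k6

lemma StepU2.isTwoFactor (hG : G.IsRegularOfDegree 3) (hF : IsTwoFactor G F)
    (h : StepU2 G F F') : IsTwoFactor G F' ∧ ∀ x y, F.Reachable x y → F'.Reachable x y := by
  obtain ⟨u, C, c₁, c₂, hC, hl, h12, ⟨x, hx, hxC⟩, ⟨y, hy, hyC⟩, hF'⟩ := h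
  obtain ⟨b, c, d, h4, hs, he⟩ := exists_isCyc4 hC hl
  have hmem : ∀ w, w ∈ walkVerts C → w ∈ [u, b, c, d] := by
    intro w hw
    simp only [walkVerts, hs, Set.mem_ofPred_eq] at hw
    grind
  rw [ConnectedComponent.mem_supp_iff] at hx hy
  have hE : ∀ x, x ∈ walkEdges C ↔ x = s(u, b) ∨ x = s(b, c) ∨ x = s(c, d) ∨ x = s(d, u) := by
    simp [walkEdges, he]
  rcases hF.square_classes hG h4 (hmem x hxC) (hmem y hyC)
    (by rw [← ConnectedComponent.eq, hx, hy]; exact h12) with ⟨k1, k2, k3⟩ | ⟨k1, k2, k3⟩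
  · exact hF.switch_cyc4 hG h4 hE hF' k1 k2 k3
  · exact hF.switch_cyc4 hG h4.rotate (fun x => by rw [hE]; tauto) hF' k1 k2 k3

end SimpleSteps

/-! ### What exhaustive application of (U1) and (U2) forces. -/

section Exhaustive

variable {V : Type*} {G F F' : SimpleGraph V}

lemma exists_edgeSet_eq_symmDiff (F : SimpleGraph V) {u w : V} (C : G.Walk u w) :
    ∃ F' : SimpleGraph V, F'.edgeSet = symmDiff F.edgeSet (walkEdges C) := by
  refine ⟨fromEdgeSet (symmDiff F.edgeSet (walkEdges C)), ?_⟩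
  rw [edgeSet_fromEdgeSet, sdiff_eq_left]
  rw [Set.disjoint_left]
  rintro e (⟨he, -⟩ | ⟨he, -⟩) hd
  · exact F.not_isDiag_of_mem_edgeSet he hd
  · exact G.not_isDiag_of_mem_edgeSet (C.edges_subset_edgeSet he) hd

lemma reachable_of_not_stepU1 (hstep : ∀ F', ¬ StepU1 G F F') {a b c d e f : V}
    (h : IsCyc6 G a b c d e f) {x y z : V} (hx : x ∈ [a, b, c, d, e, f])
    (hy : y ∈ [a, b, c, d, e, f]) (hz : z ∈ [a, b, c, d, e, f]) :
    F.Reachable x y ∨ F.Reachable x z ∨ F.Reachable y z := by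
  by_contra! hcon
  obtain ⟨p, hp, hl, hs, he⟩ := h.exists_walk
  obtain ⟨F', hF'⟩ := exists_edgeSet_eq_symmDiff F p
  have hmem : ∀ w, w ∈ [a, b, c, d, e, f] → w ∈ walkVerts p := by
    intro w hw
    simp only [walkVerts, hs, Set.mem_ofPred_eq]
    grind
  refine hstep F' ⟨a, p, F.connectedComponentMk x, F.connectedComponentMk y,
    F.connectedComponentMk z, hp, hl, ?_, ?_, ?_, ⟨x, rfl, hmem x hx⟩, ⟨y, rfl, hmem y hy⟩,
    ⟨z, rfl, hmem z hz⟩, hF'⟩ <;> rw [Ne, ConnectedComponent.eq] <;> tauto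

lemma reachable_of_not_stepU2 (hstep : ∀ F', ¬ StepU2 G F F') {a b c d : V}
    (h : IsCyc4 G a b c d) {x y : V} (hx : x ∈ [a, b, c, d]) (hy : y ∈ [a, b, c, d]) :
    F.Reachable x y := by
  by_contra! hcon
  obtain ⟨p, hp, hl, hs, he⟩ := h.exists_walk
  obtain ⟨F', hF'⟩ := exists_edgeSet_eq_symmDiff F p
  have hmem : ∀ w, w ∈ [a, b, c, d] → w ∈ walkVerts p := by
    intro w hw
    simp only [walkVerts, hs, Set.mem_ofPred_eq]
    grind
  refine hstep F' ⟨a, p, F.connectedComponentMk x, F.connectedComponentMk y, hp, hl, ?_,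
    ⟨x, rfl, hmem x hx⟩, ⟨y, rfl, hmem y hy⟩, hF'⟩
  rw [Ne, ConnectedComponent.eq]; exact hcon

end Exhaustive

section Iterate

variable {V : Type*} {G F F' : SimpleGraph V}

lemma isTwoFactor_of_reflTransGen {step : SimpleGraph V → SimpleGraph V → Prop}
    (hstep : ∀ F F', IsTwoFactor G F → step F F' →
      IsTwoFactor G F' ∧ ∀ x y, F.Reachable x y → F'.Reachable x y)
    (hF : IsTwoFactor G F) (h : Relation.ReflTransGen step F F') :
    IsTwoFactor G F' ∧ ∀ x y, F.Reachable x y → F'.Reachable x y := by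
  induction h with
  | refl => exact ⟨hF, fun _ _ h => h⟩
  | tail _ h ih =>
    have := hstep _ _ ih.1 h
    exact ⟨this.1, fun x y hxy => this.2 x y (ih.2 x y hxy)⟩

end Iterate

end CubicTour

namespace CubicTour
open SimpleGraph

/-! ### Eulerian multigraphs and merging -/

section Multigraphs

variable {V : Type*}

lemma support_adj {m : Sym2 V → ℕ} {x y : V} : (support m).Adj x y ↔ m s(x, y) ≠ 0 ∧ x ≠ y := by
  simp [support, Nat.pos_iff_ne_zero]

/-- All edges of `m` are proper edges with both ends in `W`. -/
def IsCarried (W : Set V) (m : Sym2 V → ℕ) : Prop :=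
  ∀ x y, m s(x, y) ≠ 0 → x ∈ W ∧ y ∈ W ∧ x ≠ y

lemma IsCarried.mono {W W' : Set V} {m : Sym2 V → ℕ} (h : IsCarried W m) (hW : W ⊆ W') :
    IsCarried W' m := fun x y hxy => ⟨hW (h x y hxy).1, hW (h x y hxy).2.1, (h x y hxy).2.2⟩

lemma induce_connected {H : SimpleGraph V} {W : Set V} (hW : W.Nonempty)
    (hcl : ∀ x y, x ∈ W → H.Adj x y → y ∈ W) (hr : ∀ x ∈ W, ∀ y ∈ W, H.Reachable x y) :
    (H.induce W).Connected := by
  have key : ∀ {x y : V} (w : H.Walk x y) (hx : x ∈ W), ∃ hy : y ∈ W,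
      (H.induce W).Reachable ⟨x, hx⟩ ⟨y, hy⟩ := by
    intro x y w
    induction w with
    | nil => exact fun hx => ⟨hx, .refl _⟩
    | @cons x z y h _ ih =>
      intro hx
      have hz := hcl x z hx h
      obtain ⟨hy, hzy⟩ := ih hz
      have : (H.induce W).Adj ⟨x, hx⟩ ⟨z, hz⟩ := h
      exact ⟨hy, this.reachable.trans hzy⟩
  obtain ⟨x₀, hx₀⟩ := hW
  rw [connected_iff]
  refine ⟨fun x y => ?_, ⟨⟨x₀, hx₀⟩⟩⟩
  obtain ⟨w⟩ := hr x x.2 y y.2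
  exact (key w x.2).2

lemma reachable_of_induce_connected {H : SimpleGraph V} {W : Set V} (h : (H.induce W).Connected)
    {x y : V} (hx : x ∈ W) (hy : y ∈ W) : H.Reachable x y :=
  (h.preconnected ⟨x, hx⟩ ⟨y, hy⟩).map (Embedding.induce W).toHom

lemma reachable_of_forall_adj {H H' : SimpleGraph V} (h : ∀ x y, H.Adj x y → H'.Reachable x y)
    {x y : V} (hxy : H.Reachable x y) : H'.Reachable x y := by
  obtain ⟨w⟩ := hxy
  induction w with
  | nil => rfl
  | cons h1 _ ih => exact (h _ _ h1).trans ih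

variable [Fintype V] [DecidableEq V]

lemma mdegree_add (m n : Sym2 V → ℕ) (v : V) : mdegree (m + n) v = mdegree m v + mdegree n v := by
  simp only [mdegree, ← Finset.sum_add_distrib]
  refine Finset.sum_congr rfl fun e _ => ?_
  split_ifs <;> simp

lemma mdegree_single (e : Sym2 V) (v : V) :
    mdegree (Pi.single e 1) v = if v ∈ e then 1 else 0 := by
  rw [mdegree, Finset.sum_eq_single e]
  · simp
  · intro f _ hf; simp [hf]
  · simp

/-- In an even multigraph an edge of multiplicity one is not a bridge. -/
lemma reachable_of_mdegree_even {m : Sym2 V → ℕ} (hl : ∀ x, m s(x, x) = 0)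
    (hm : ∀ v, Even (mdegree m v)) {a b : V} (hab : m s(a, b) = 1) :
    (fromEdgeSet {e | 0 < m e ∧ e ≠ s(a, b)}).Reachable a b := by
  classical
  by_contra hcon
  set H := fromEdgeSet {e | 0 < m e ∧ e ≠ s(a, b)} with hH
  -- Parity of the degree sum over the side of `a`: if `ab` were a bridge, it would be counted once
  -- and every other edge an even number of times, whereas all degrees are even.
  set A : Finset V := Finset.univ.filter (fun x => H.Reachable a x) with hA
  have hne : a ≠ b := by rintro rfl; exact hcon (.refl _)
  have hsum : ∑ v ∈ A, mdegree m v = ∑ e : Sym2 V, ∑ v ∈ A, if v ∈ e then m e else 0 := by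
    simp only [mdegree]; rw [Finset.sum_comm]
  have heven : Even (∑ v ∈ A, mdegree m v) := Finset.even_sum _ fun v _ => hm v
  rw [hsum, ← Finset.add_sum_erase _ _ (Finset.mem_univ s(a, b))] at heven
  have h1 : (∑ v ∈ A, if v ∈ s(a, b) then m s(a, b) else 0) = 1 := by
    rw [Finset.sum_eq_single a]
    · simp [hab]
    · intro x hx hxa
      rw [if_neg]
      rw [Sym2.mem_iff]
      rintro (rfl | rfl)
      · exact hxa rfl
      · rw [hA, Finset.mem_filter] at hx; exact hcon hx.2
    · intro h; exact absurd (by simp [hA]) h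
  have h2 : Even (∑ e ∈ Finset.univ.erase s(a, b), ∑ v ∈ A, if v ∈ e then m e else 0) := by
    refine Finset.even_sum _ fun e he => ?_
    have hne' := Finset.ne_of_mem_erase he
    induction e with | _ x y =>
    by_cases hz : m s(x, y) = 0
    · simp [hz]
    have hxy : x ≠ y := by rintro rfl; exact hz (hl x)
    have hadj : H.Adj x y := by
      rw [hH, fromEdgeSet_adj]; exact ⟨⟨Nat.pos_of_ne_zero hz, hne'⟩, hxy⟩
    have hmem : x ∈ A ↔ y ∈ A := by
      simp only [hA, Finset.mem_filter, Finset.mem_univ, true_and]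
      exact ⟨fun h => h.trans hadj.reachable, fun h => h.trans hadj.symm.reachable⟩
    have : (∑ v ∈ A, if v ∈ s(x, y) then m s(x, y) else 0)
        = ∑ v ∈ A, ((if v = x then m s(x, y) else 0) + if v = y then m s(x, y) else 0) := by
      refine Finset.sum_congr rfl fun v _ => ?_
      by_cases h1 : v = x
      · subst h1; simp [hxy]
      · simp [h1]
    rw [this, Finset.sum_add_distrib, Finset.sum_ite_eq', Finset.sum_ite_eq']
    by_cases hx : x ∈ A
    · rw [if_pos hx, if_pos (hmem.1 hx)]; exact ⟨_, rfl⟩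
    · rw [if_neg hx, if_neg (fun h => hx (hmem.2 h))]; exact ⟨0, rfl⟩
  rw [h1] at heven
  have := h2.one_add
  exact (Nat.not_even_iff_odd.2 this) heven

lemma IsEulerianOn.reachable {W : Set V} {m : Sym2 V → ℕ} (h : IsEulerianOn W m) {x y : V}
    (hx : x ∈ W) (hy : y ∈ W) : (support m).Reachable x y :=
  reachable_of_induce_connected h.1 hx hy

/-- Removing two copies of the same edge keeps all degrees even, so only connectedness (`hconn`) has
to be checked. All merges below remove such a pair. -/
lemma exists_remove_pair {W₁ W₂ : Set V} {m₁ m₂ : Sym2 V → ℕ} (hc₁ : IsCarried W₁ m₁)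
    (hc₂ : IsCarried W₂ m₂) (he₁ : IsEulerianOn W₁ m₁) (he₂ : IsEulerianOn W₂ m₂)
    {e : Sym2 V} (he : 2 ≤ m₁ e + m₂ e) {b : V} (hb : b ∈ W₁ ∪ W₂)
    (hconn : ∀ m' : Sym2 V → ℕ, m' e + 2 = m₁ e + m₂ e → (∀ x ≠ e, m' x = m₁ x + m₂ x) →
      ∀ x ∈ W₁ ∪ W₂, (support m').Reachable b x) :
    ∃ m' : Sym2 V → ℕ, m' + Pi.single e 1 + Pi.single e 1 = m₁ + m₂ ∧
      IsEulerianOn (W₁ ∪ W₂) m' := by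
  set m' : Sym2 V → ℕ := fun x => if x = e then m₁ e + m₂ e - 2 else m₁ x + m₂ x with hm'
  have h1 : m' e + 2 = m₁ e + m₂ e := by simp only [hm', if_true]; omega
  have h2 : ∀ x ≠ e, m' x = m₁ x + m₂ x := fun x hx => by simp [hm', hx]
  have heq : m' + Pi.single e 1 + Pi.single e 1 = m₁ + m₂ := by
    funext x
    by_cases hx : x = e
    · subst hx; simp only [Pi.add_apply, Pi.single_eq_same]; omega
    · simp [h2 x hx, hx]
  refine ⟨m', heq, induce_connected ⟨b, hb⟩ ?_ ?_, fun v => ?_⟩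
  · intro x y _ hxy
    rw [support_adj] at hxy
    have hle : m' s(x, y) ≤ m₁ s(x, y) + m₂ s(x, y) := by
      by_cases hx : s(x, y) = e
      · rw [hx]; omega
      · rw [h2 _ hx]
    by_cases h : m₁ s(x, y) = 0
    · exact .inr (hc₂ x y (by omega)).2.1
    · exact .inl (hc₁ x y h).2.1
  · intro x hx y hy
    exact (hconn m' h1 h2 x hx).symm.trans (hconn m' h1 h2 y hy)
  · have h3 := congrArg (fun f => mdegree f v) heq
    simp only [mdegree_add, mdegree_single] at h3
    have := he₁.2 v
    have := he₂.2 v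
    have h4 : Even (mdegree m' v + ((if v ∈ e then 1 else 0) + if v ∈ e then 1 else 0)) := by
      rw [← add_assoc, h3]; exact Even.add ‹_› ‹_›
    exact (Nat.even_add.1 h4).2 ⟨_, rfl⟩

/-- Two connected even multigraphs that share an edge can be merged. -/
lemma exists_remove_common {W₁ W₂ : Set V} {m₁ m₂ : Sym2 V → ℕ} (hc₁ : IsCarried W₁ m₁)
    (hc₂ : IsCarried W₂ m₂) (he₁ : IsEulerianOn W₁ m₁) (he₂ : IsEulerianOn W₂ m₂)
    {a b : V} (h₁ : m₁ s(b, a) ≠ 0) (h₂ : m₂ s(b, a) ≠ 0) :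
    ∃ m' : Sym2 V → ℕ, m' + Pi.single s(b, a) 1 + Pi.single s(b, a) 1 = m₁ + m₂ ∧
      IsEulerianOn (W₁ ∪ W₂) m' := by
  have hb₁ := (hc₁ b a h₁).1
  have hb₂ := (hc₂ b a h₂).1
  have hba := (hc₁ b a h₁).2.2
  refine exists_remove_pair hc₁ hc₂ he₁ he₂ (by omega) (.inl hb₁) ?_
  intro m' h1 h2
  -- If `m` uses `ba` once, evenness gives a detour inside `m`. If `m` uses it at least twice, the
  -- sum uses it at least three times and a copy survives the removal.
  have side : ∀ (W : Set V) (m : Sym2 V → ℕ), IsCarried W m → IsEulerianOn W m → b ∈ W →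
      (∀ x, m x ≤ m₁ x + m₂ x) → m s(b, a) ≠ 0 → (m s(b, a) ≠ 1 → m' s(b, a) ≠ 0) →
      ∀ x ∈ W, (support m').Reachable b x := by
    intro W m hc he hb hle hm hm1 x hx
    have hba' : (support m').Reachable b a := by
      by_cases h : m s(b, a) = 1
      · refine reachable_of_forall_adj ?_
          (reachable_of_mdegree_even (fun x => ?_) he.2 h)
        · intro u v huv
          rw [fromEdgeSet_adj] at huv
          refine Adj.reachable (support_adj.2 ⟨?_, huv.2⟩)
          rw [h2 _ huv.1.2]
          have := hle s(u, v)
          have := huv.1.1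
          omega
        · by_contra h; exact (hc x x h).2.2 rfl
      · exact Adj.reachable (support_adj.2 ⟨hm1 h, hba⟩)
    refine reachable_of_forall_adj ?_ (he.reachable hb hx)
    intro u v huv
    rw [support_adj] at huv
    by_cases h : s(u, v) = s(b, a)
    · rcases Sym2.eq_iff.1 h with ⟨rfl, rfl⟩ | ⟨rfl, rfl⟩
      · exact hba'
      · exact hba'.symm
    · refine Adj.reachable (support_adj.2 ⟨?_, huv.2⟩)
      rw [h2 _ h]
      have := hle s(u, v)
      omega
  rintro x (hx | hx)
  · exact side W₁ m₁ hc₁ he₁ hb₁ (fun _ => by omega) h₁ (fun _ => by omega) x hx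
  · exact side W₂ m₂ hc₂ he₂ hb₂ (fun _ => by omega) h₂ (fun _ => by omega) x hx

lemma mdegree_eq_of_leaf {m : Sym2 V → ℕ} {b o : V} (h : ∀ x, m s(b, x) ≠ 0 → x = o) :
    mdegree m b = m s(b, o) := by
  rw [mdegree, Finset.sum_eq_single s(b, o)]
  · simp
  · intro e _ he
    by_cases hb : b ∈ e
    · obtain ⟨x, rfl⟩ := hb
      rw [if_pos (by simp)]
      by_contra hne
      exact he (by rw [h x hne])
    · rw [if_neg hb]
  · simp

/-- Two connected even multigraphs can be merged if the first one has a pendant double edge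
at a vertex of the second one. -/
lemma exists_remove_pendant {W₁ W₂ : Set V} {m₁ m₂ : Sym2 V → ℕ} (hc₁ : IsCarried W₁ m₁)
    (hc₂ : IsCarried W₂ m₂) (he₁ : IsEulerianOn W₁ m₁) (he₂ : IsEulerianOn W₂ m₂)
    {a b o : V} (ha₁ : a ∈ W₁) (ha₂ : a ∈ W₂) (hb₁ : b ∈ W₁) (hb₂ : b ∈ W₂) (hab : a ≠ b)
    (hleaf : ∀ x, m₁ s(b, x) ≠ 0 → x = o) :
    m₁ s(b, o) ≠ 0 ∧
    ∃ m' : Sym2 V → ℕ, m' + Pi.single s(b, o) 1 + Pi.single s(b, o) 1 = m₁ + m₂ ∧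
      IsEulerianOn (W₁ ∪ W₂) m' := by
  have hne : m₁ s(b, o) ≠ 0 := by
    obtain ⟨w⟩ := he₁.reachable hb₁ ha₁
    cases w with
    | nil => exact absurd rfl hab
    | cons h _ =>
      rw [support_adj] at h
      have := hleaf _ h.1
      subst this
      exact h.1
  -- All edges at `b` are copies of `bo` and the degree of `b` is even, so there are two copies to
  -- remove.
  have h2 : 2 ≤ m₁ s(b, o) := by
    have := he₁.2 b
    rw [mdegree_eq_of_leaf hleaf] at this
    obtain ⟨k, hk⟩ := this
    omega
  have hbo := (hc₁ b o hne).2.2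
  refine ⟨hne, exists_remove_pair hc₁ hc₂ he₁ he₂ (by omega) (.inl hb₁) ?_⟩
  intro m' h3 h4
  have hle : ∀ x, m₂ x ≤ m' x := fun x => by
    by_cases hx : x = s(b, o)
    · subst hx; omega
    · rw [h4 x hx]; omega
  have side₂ : ∀ x ∈ W₂, (support m').Reachable b x := by
    intro x hx
    refine reachable_of_forall_adj ?_ (he₂.reachable hb₂ hx)
    intro u v huv
    rw [support_adj] at huv
    refine Adj.reachable (support_adj.2 ⟨?_, huv.2⟩)
    have := hle s(u, v)
    omega
  rintro x (hx | hx)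
  · by_cases hxb : x = b
    · rw [hxb]
    -- Contract the pendant vertex `b` into `o`: walks of `m₁` then avoid the edge `bo`. The vertex
    -- `b` itself stays attached through the second multigraph, which also contains `a`.
    have key : ∀ {u v : V} (w : (support m₁).Walk u v),
        (support m').Reachable (if u = b then o else u) (if v = b then o else v) := by
      intro u v w
      induction w with
      | nil => rfl
      | @cons u z v h _ ih =>
        refine Reachable.trans ?_ ih
        rw [support_adj] at h
        by_cases hub : u = b
        · subst hub
          have := hleaf z h.1
          subst this
          rw [if_pos rfl, if_neg (Ne.symm hbo)]
        · by_cases hzb : z = b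
          · subst hzb
            have := hleaf u (by rw [Sym2.eq_swap]; exact h.1)
            subst this
            rw [if_pos rfl, if_neg hub]
          · rw [if_neg hub, if_neg hzb]
            refine Adj.reachable (support_adj.2 ⟨?_, h.2⟩)
            rw [h4]
            · have := h.1; omega
            · intro h5; rcases Sym2.eq_iff.1 h5 with ⟨h, -⟩ | ⟨-, h⟩ <;> contradiction
    obtain ⟨w⟩ := he₁.reachable ha₁ hx
    have := key w
    rw [if_neg hab, if_neg hxb] at this
    exact (side₂ a ha₂).trans this
  · exact side₂ x hx

/-- Two connected even multigraphs can be merged at a vertex `b` if the second one contains two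
edges at `b` such that the first one has at most one more neighbour of `b`. -/
lemma exists_merge {W₁ W₂ : Set V} {m₁ m₂ : Sym2 V → ℕ} (hc₁ : IsCarried W₁ m₁)
    (hc₂ : IsCarried W₂ m₂) (he₁ : IsEulerianOn W₁ m₁) (he₂ : IsEulerianOn W₂ m₂)
    {a b c o : V} (hb₁ : b ∈ W₁) (ha₁ : a ∈ W₁) (hba : m₂ s(b, a) ≠ 0) (hbc : m₂ s(b, c) ≠ 0)
    (hnb : ∀ x, m₁ s(b, x) ≠ 0 → x = a ∨ x = c ∨ x = o) :
    ∃ e : Sym2 V, m₁ e ≠ 0 ∧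
    ∃ m' : Sym2 V → ℕ, m' + Pi.single e 1 + Pi.single e 1 = m₁ + m₂ ∧
      IsEulerianOn (W₁ ∪ W₂) m' := by
  by_cases h1 : m₁ s(b, a) = 0
  · by_cases h2 : m₁ s(b, c) = 0
    · have hleaf : ∀ x, m₁ s(b, x) ≠ 0 → x = o := by
        intro x hx
        rcases hnb x hx with rfl | rfl | rfl
        · contradiction
        · contradiction
        · rfl
      have := exists_remove_pendant hc₁ hc₂ he₁ he₂ ha₁ (hc₂ b a hba).2.1 hb₁ (hc₂ b a hba).1
        (hc₂ b a hba).2.2.symm hleaf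
      exact ⟨_, this.1, this.2⟩
    · exact ⟨_, h2, exists_remove_common hc₁ hc₂ he₁ he₂ h2 hbc⟩
  · exact ⟨_, h1, exists_remove_common hc₁ hc₂ he₁ he₂ h1 hba⟩

end Multigraphs
end CubicTour

namespace CubicTour
open SimpleGraph

/-! ### Operation (U3) -/

section CoverBasics

variable {V : Type*}

lemma restrict_mk (m : Sym2 V → ℕ) (W : Set V) (x y : V) [Decidable (x ∈ W ∧ y ∈ W)] :
    restrict m W s(x, y) = if x ∈ W ∧ y ∈ W then m s(x, y) else 0 := by
  simp [restrict]

lemma restrict_eq_of_mem {m : Sym2 V → ℕ} {W : Set V} {x y : V} (hx : x ∈ W) (hy : y ∈ W) :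
    restrict m W s(x, y) = m s(x, y) := by
  classical
  rw [restrict_mk, if_pos ⟨hx, hy⟩]

lemma mem_of_restrict_ne_zero {m : Sym2 V → ℕ} {W : Set V} {x y : V}
    (h : restrict m W s(x, y) ≠ 0) : x ∈ W ∧ y ∈ W ∧ m s(x, y) ≠ 0 := by
  classical
  rw [restrict_mk] at h
  split_ifs at h with h1
  · exact ⟨h1.1, h1.2, h⟩
  · exact absurd rfl h

lemma mem_compVerts {m : Sym2 V → ℕ} {v w : V} :
    w ∈ compVerts m v ↔ (support m).Reachable v w := by
  rw [compVerts, ConnectedComponent.mem_supp_iff, ConnectedComponent.eq]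
  exact ⟨fun h => h.symm, fun h => h.symm⟩

lemma compVerts_eq {m : Sym2 V → ℕ} {v w : V} (h : (support m).Reachable v w) :
    compVerts m v = compVerts m w := by
  rw [compVerts, compVerts, ConnectedComponent.eq.2 h]

lemma mem_of_reachable {H : SimpleGraph V} {W : Set V} (hcl : ∀ x y, x ∈ W → H.Adj x y → y ∈ W)
    {x y : V} (hx : x ∈ W) (h : H.Reachable x y) : y ∈ W := by
  obtain ⟨w⟩ := h
  induction w with
  | nil => exact hx
  | cons h1 _ ih => exact ih (hcl _ _ hx h1)

lemma ofSet_cyc5 [DecidableEq V] {a b c d e : V} (hn : [a, b, c, d, e].Nodup) {E : Set (Sym2 V)}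
    (hE : ∀ x, x ∈ E ↔ x = s(a, b) ∨ x = s(b, c) ∨ x = s(c, d) ∨ x = s(d, e) ∨ x = s(e, a)) :
    ofSet E = Pi.single s(a, b) 1 + Pi.single s(b, c) 1 + Pi.single s(c, d) 1 +
      Pi.single s(d, e) 1 + Pi.single s(e, a) 1 := by
  simp only [List.nodup_cons, List.mem_cons, List.not_mem_nil, not_or, or_false] at hn
  funext x
  simp only [ofSet, hE, Pi.add_apply, Pi.single_apply]
  have n01 : s(a, b) ≠ s(b, c) := by rw [Ne, Sym2.eq_iff]; grind
  have n02 : s(a, b) ≠ s(c, d) := by rw [Ne, Sym2.eq_iff]; grind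
  have n03 : s(a, b) ≠ s(d, e) := by rw [Ne, Sym2.eq_iff]; grind
  have n04 : s(a, b) ≠ s(e, a) := by rw [Ne, Sym2.eq_iff]; grind
  have n12 : s(b, c) ≠ s(c, d) := by rw [Ne, Sym2.eq_iff]; grind
  have n13 : s(b, c) ≠ s(d, e) := by rw [Ne, Sym2.eq_iff]; grind
  have n14 : s(b, c) ≠ s(e, a) := by rw [Ne, Sym2.eq_iff]; grind
  have n23 : s(c, d) ≠ s(d, e) := by rw [Ne, Sym2.eq_iff]; grind
  have n24 : s(c, d) ≠ s(e, a) := by rw [Ne, Sym2.eq_iff]; grind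
  have n34 : s(d, e) ≠ s(e, a) := by rw [Ne, Sym2.eq_iff]; grind
  by_cases h0 : x = s(a, b)
  · subst h0; simp [n01, n02, n03, n04]
  by_cases h1 : x = s(b, c)
  · subst h1; simp [n01.symm, n12, n13, n14]
  by_cases h2 : x = s(c, d)
  · subst h2; simp [n02.symm, n12.symm, n23, n24]
  by_cases h3 : x = s(d, e)
  · subst h3; simp [n03.symm, n13.symm, n23.symm, n34]
  by_cases h4 : x = s(e, a)
  · subst h4; simp [n04.symm, n14.symm, n24.symm, n34.symm]
  simp [h0, h1, h2, h3, h4]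

variable [Fintype V] [DecidableEq V]

lemma mdegree_eq_sum (m : Sym2 V → ℕ) (v : V) : mdegree m v = ∑ x, m s(v, x) := by
  have hinj : Function.Injective (fun x : V => s(v, x)) := fun x y h => Sym2.congr_right.1 h
  rw [mdegree, ← Finset.sum_filter, ← Finset.sum_image (f := m) (g := fun x => s(v, x))
    (fun x _ y _ h => hinj h)]
  refine Finset.sum_congr ?_ fun _ _ => rfl
  ext e
  simp only [Finset.mem_filter, Finset.mem_univ, true_and, Finset.mem_image, Sym2.mem_iff_exists]
  exact ⟨fun ⟨y, h⟩ => ⟨y, h.symm⟩, fun ⟨y, h⟩ => ⟨y, h.symm⟩⟩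

lemma numEdges_add (m n : Sym2 V → ℕ) : numEdges (m + n) = numEdges m + numEdges n := by
  simp [numEdges, Finset.sum_add_distrib]

lemma numEdges_single (e : Sym2 V) : numEdges (Pi.single e 1) = 1 := by
  rw [numEdges, Finset.sum_eq_single e] <;> simp +contextual

lemma numEdges_mono {m n : Sym2 V → ℕ} (h : ∀ e, m e ≤ n e) : numEdges m ≤ numEdges n :=
  Finset.sum_le_sum fun e _ => h e

lemma sum_mdegree {m : Sym2 V → ℕ} (hl : ∀ x, m s(x, x) = 0) :
    ∑ v, mdegree m v = 2 * numEdges m := by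
  simp only [mdegree, numEdges]
  rw [Finset.sum_comm, Finset.mul_sum]
  refine Finset.sum_congr rfl fun e _ => ?_
  induction e with | _ x y =>
  by_cases hxy : x = y
  · subst hxy; simp [hl]
  · have : (∑ v, if v ∈ s(x, y) then m s(x, y) else 0)
        = ∑ v, ((if v = x then m s(x, y) else 0) + if v = y then m s(x, y) else 0) := by
      refine Finset.sum_congr rfl fun v _ => ?_
      by_cases h1 : v = x
      · subst h1; simp [hxy]
      · simp [h1]
    rw [this, Finset.sum_add_distrib]
    simp; ring

lemma even_mdegree_cyc5 {a b c d e : V} (hn : [a, b, c, d, e].Nodup) {E : Set (Sym2 V)}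
    (hE : ∀ x, x ∈ E ↔ x = s(a, b) ∨ x = s(b, c) ∨ x = s(c, d) ∨ x = s(d, e) ∨ x = s(e, a))
    (v : V) : Even (mdegree (ofSet E) v) := by
  rw [ofSet_cyc5 hn hE]
  simp only [mdegree_add, mdegree_single, Sym2.mem_iff]
  simp only [List.nodup_cons, List.mem_cons, List.not_mem_nil, not_or, or_false] at hn
  by_cases h1 : v = a
  · subst h1; simp [hn]
  by_cases h2 : v = b
  · subst h2; simp [hn, h1]
  by_cases h3 : v = c
  · subst h3; simp [hn, h1, h2]
  by_cases h4 : v = d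
  · subst h4; simp [hn, h1, h2, h3]
  by_cases h5 : v = e
  · subst h5; simp [h1, h2, h3, h4]
  · simp [h1, h2, h3, h4, h5]

lemma numEdges_cyc5 {a b c d e : V} (hn : [a, b, c, d, e].Nodup) {E : Set (Sym2 V)}
    (hE : ∀ x, x ∈ E ↔ x = s(a, b) ∨ x = s(b, c) ∨ x = s(c, d) ∨ x = s(d, e) ∨ x = s(e, a)) :
    numEdges (ofSet E) = 5 := by
  rw [ofSet_cyc5 hn hE]
  simp only [numEdges_add, numEdges_single]

end CoverBasics

section Pentagons

/-- Blocks of equal labels have length at least two, so two labels on a 5-cycle split it as 2 + 3;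
the five alternatives are the rotations. -/
lemma two_classes_pentagon {Q : Type*} {a b c d e x y : Q}
    (hx : x ∈ [a, b, c, d, e]) (hy : y ∈ [a, b, c, d, e]) (hxy : x ≠ y)
    (ha : a = b ∨ a = e) (hb : b = a ∨ b = c) (hc : c = b ∨ c = d) (hd : d = c ∨ d = e)
    (he : e = d ∨ e = a) :
    (a = b ∧ c = d ∧ d = e ∧ a ≠ c) ∨ (b = c ∧ d = e ∧ e = a ∧ b ≠ d) ∨
    (c = d ∧ e = a ∧ a = b ∧ c ≠ e) ∨ (d = e ∧ a = b ∧ b = c ∧ d ≠ a) ∨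
    (e = a ∧ b = c ∧ c = d ∧ e ≠ b) := by
  have key : ¬ (a = b ∧ b = c ∧ c = d ∧ d = e) := by
    rintro ⟨rfl, rfl, rfl, rfl⟩
    simp only [List.mem_cons, List.not_mem_nil, or_false, or_self] at hx hy
    exact hxy (hx.trans hy.symm)
  clear hx hy hxy
  grind (splits := 40)

lemma mem_two_classes_pentagon {Q : Type*} {a b c d e x y z : Q}
    (hx : x ∈ [a, b, c, d, e]) (hy : y ∈ [a, b, c, d, e]) (hz : z ∈ [a, b, c, d, e]) (hxy : x ≠ y)
    (ha : a = b ∨ a = e) (hb : b = a ∨ b = c) (hc : c = b ∨ c = d) (hd : d = c ∨ d = e)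
    (he : e = d ∨ e = a) : z = x ∨ z = y := by
  rcases two_classes_pentagon hx hy hxy ha hb hc hd he with
    ⟨rfl, rfl, rfl, -⟩ | ⟨rfl, rfl, rfl, -⟩ | ⟨rfl, rfl, rfl, -⟩ | ⟨rfl, rfl, rfl, -⟩ |
    ⟨rfl, rfl, rfl, -⟩ <;>
  · simp only [List.mem_cons, List.not_mem_nil, or_false] at hx hy hz
    grind

end Pentagons

end CubicTour

/-! ### The invariants of Eulerian subgraph covers under (U3). -/

namespace CubicTour
open SimpleGraph

section Covers

variable {V : Type*}

/-- The vertex set of the component of `F` containing `v`. -/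
def componentSet (F : SimpleGraph V) (v : V) : Set V := (F.connectedComponentMk v).supp

lemma mem_componentSet {F : SimpleGraph V} {v w : V} :
    w ∈ componentSet F v ↔ F.Reachable v w := by
  rw [componentSet, ConnectedComponent.mem_supp_iff, ConnectedComponent.eq]
  exact ⟨fun h => h.symm, fun h => h.symm⟩

lemma componentSet_eq {F : SimpleGraph V} {v w : V} (h : F.Reachable v w) :
    componentSet F v = componentSet F w := by
  rw [componentSet, componentSet, ConnectedComponent.eq.2 h]

lemma support_ofSet_edgeSet (F : SimpleGraph V) : support (ofSet F.edgeSet) = F := by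
  ext x y
  simp only [support_adj, ofSet, mem_edgeSet]
  constructor
  · rintro ⟨h, -⟩; by_contra hn; simp [hn] at h
  · intro h; simp [h, h.ne]

lemma trim_le (m : Sym2 V → ℕ) (e : Sym2 V) : trim m e ≤ m e := by
  unfold trim; split_ifs <;> omega

lemma trim_ne_zero {m : Sym2 V → ℕ} {e : Sym2 V} : trim m e ≠ 0 ↔ m e ≠ 0 := by
  unfold trim; split_ifs <;> omega

variable [Fintype V] [DecidableEq V]

/-- The properties, preserved by (U3), of an Eulerian subgraph cover `m` of `G` that arises from
the cycle cover `F`. -/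
structure IsCoverFrom (G F : SimpleGraph V) (m : Sym2 V → ℕ) : Prop where
  adj : ∀ x y, m s(x, y) ≠ 0 → G.Adj x y
  even : ∀ v, Even (mdegree m v)
  coarse : ∀ x y, F.Reachable x y → (support m).Reachable x y
  -- A component merged from c cycles has at most h + c - 1 edges, and each of the c - 1 cycles
  -- other than that of `w` has at least five vertices. This form of the estimate is the one that
  -- passes through a merge.
  bound : ∀ v w, w ∈ compVerts m v → 5 * numEdges (restrict m (compVerts m v)) +
    (componentSet F w).ncard ≤ 6 * (compVerts m v).ncard
  unmerged_or_merged : ∀ v, (compVerts m v = componentSet F v ∧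
      ∀ x y, x ∈ compVerts m v → y ∈ compVerts m v → m s(x, y) = ofSet F.edgeSet s(x, y)) ∨
    (10 ≤ (compVerts m v).ncard ∧ ∀ w ∈ compVerts m v, 5 ≤ (componentSet F w).ncard)

lemma IsTwoFactor.mdegree_restrict {G F : SimpleGraph V} (hF : IsTwoFactor G F) {W : Set V}
    (hW : ∀ x y, x ∈ W → F.Adj x y → y ∈ W) (v : V) [Decidable (v ∈ W)] :
    mdegree (restrict (ofSet F.edgeSet) W) v = if v ∈ W then 2 else 0 := by
  classical
  rw [mdegree_eq_sum]
  split_ifs with hv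
  · obtain ⟨a, b, hab, h⟩ := hF.exists_nbrs v
    have : ∀ x, restrict (ofSet F.edgeSet) W s(v, x) =
        (if x = a then 1 else 0) + if x = b then 1 else 0 := by
      intro x
      rw [restrict_mk]
      have hx : F.Adj v x → x ∈ W := hW v x hv
      simp only [ofSet, mem_edgeSet]
      rw [h] at hx ⊢
      by_cases h1 : x = a
      · subst h1; simp [hv, hx (.inl rfl), hab]
      · by_cases h2 : x = b
        · subst h2; simp [hv, hx (.inr rfl), h1]
        · simp [h1, h2]
    simp [this, Finset.sum_add_distrib]
  · refine Finset.sum_eq_zero fun x _ => ?_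
    rw [restrict_mk, if_neg (fun h => hv h.1)]

lemma IsTwoFactor.numEdges_restrict {G F : SimpleGraph V} (hF : IsTwoFactor G F) {W : Set V}
    (hW : ∀ x y, x ∈ W → F.Adj x y → y ∈ W) :
    numEdges (restrict (ofSet F.edgeSet) W) = W.ncard := by
  classical
  have h := sum_mdegree (m := restrict (ofSet F.edgeSet) W) (fun x => by
    rw [restrict_mk]; simp [ofSet])
  simp only [hF.mdegree_restrict hW, Finset.sum_ite, Finset.sum_const_zero, Finset.sum_const,
    smul_eq_mul] at h
  have h2 : W.ncard = (Finset.univ.filter (· ∈ W)).card := by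
    rw [← Set.ncard_coe_finset]; congr 1; ext; simp
  omega

lemma IsTwoFactor.isCoverFrom {G F : SimpleGraph V} (hF : IsTwoFactor G F) :
    IsCoverFrom G F (ofSet F.edgeSet) := by
  have hcomp : ∀ v, compVerts (ofSet F.edgeSet) v = componentSet F v := fun v => by
    ext; rw [mem_compVerts, mem_componentSet, support_ofSet_edgeSet]
  have hcl : ∀ v x y, x ∈ componentSet F v → F.Adj x y → y ∈ componentSet F v := by
    intro v x y hx hxy
    rw [mem_componentSet] at *
    exact hx.trans hxy.reachable
  refine ⟨fun x y h => ?_, fun v => ?_, fun x y h => ?_, fun v w hw => ?_, fun v => .inl ?_⟩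
  · refine hF.1 ?_
    by_contra hn
    exact h (by simp [ofSet, hn])
  · have := hF.mdegree_restrict (W := Set.univ) (fun _ _ _ _ => trivial) v
    rw [if_pos (Set.mem_univ v)] at this
    have h2 : restrict (ofSet F.edgeSet) Set.univ = ofSet F.edgeSet := by
      funext e; simp [restrict]
    rw [← h2, this]; exact ⟨1, rfl⟩
  · rw [support_ofSet_edgeSet]; exact h
  · rw [hcomp] at *
    -- A single cycle has as many edges as vertices, and the bound is an equality.
    rw [hF.numEdges_restrict (hcl v), ← componentSet_eq (mem_componentSet.1 hw)]
    omega
  · exact ⟨hcomp v, fun _ _ _ _ => rfl⟩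

lemma even_trim {m : Sym2 V → ℕ} {v : V} (h : Even (mdegree m v)) : Even (mdegree (trim m) v) := by
  have : mdegree m v = mdegree (trim m) v + ∑ e, if v ∈ e then (if 3 ≤ m e then 2 else 0) else 0 := by
    simp only [mdegree, ← Finset.sum_add_distrib]
    refine Finset.sum_congr rfl fun e _ => ?_
    unfold trim
    split_ifs <;> omega
  rw [this, Nat.even_add] at h
  refine h.2 (Finset.even_sum _ fun e _ => ?_)
  split_ifs <;> decide

section Step

variable {G F : SimpleGraph V} {m m' : Sym2 V → ℕ}

/-- Replacing two components of a cover by a connected one on the same vertices. -/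
lemma IsCoverFrom.merge (hm : IsCoverFrom G F m) {x y : V} (hxy : ¬ (support m).Reachable x y)
    (hx : 5 ≤ (compVerts m x).ncard) (hy : 5 ≤ (compVerts m y).ncard) {h' : Sym2 V → ℕ}
    (hadj : ∀ p q, h' s(p, q) ≠ 0 → G.Adj p q)
    (hcarr : IsCarried (compVerts m x ∪ compVerts m y) h')
    (heul : IsEulerianOn (compVerts m x ∪ compVerts m y) h')
    (hnum : numEdges h' ≤ numEdges (restrict m (compVerts m x)) +
      numEdges (restrict m (compVerts m y)) + 1)
    (hm' : ∀ p q, (p ∈ compVerts m x ∪ compVerts m y → q ∈ compVerts m x ∪ compVerts m y →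
        m' s(p, q) = trim h' s(p, q)) ∧
      (¬ (p ∈ compVerts m x ∪ compVerts m y ∧ q ∈ compVerts m x ∪ compVerts m y) →
        m' s(p, q) = m s(p, q))) :
    IsCoverFrom G F m' := by
  classical
  set W := compVerts m x ∪ compVerts m y with hW
  have hclW : ∀ p q, p ∈ W → m s(p, q) ≠ 0 → q ∈ W := by
    intro p q hp hpq
    have hr : (support m).Reachable p q := Adj.reachable (support_adj.2 ⟨hpq, (hm.adj _ _ hpq).ne⟩)
    rcases hp with hp | hp
    · exact .inl (mem_compVerts.2 ((mem_compVerts.1 hp).trans hr))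
    · exact .inr (mem_compVerts.2 ((mem_compVerts.1 hp).trans hr))
  have hrW : ∀ p q, p ∈ W → (support m).Reachable p q → q ∈ W := fun p q hp hpq =>
    mem_of_reachable (fun a b ha hab => hclW a b ha (support_adj.1 hab).1) hp hpq
  have hout : ∀ p q, p ∉ W → m' s(p, q) = m s(p, q) := fun p q hp => (hm' p q).2 fun h => hp h.1
  have hcross : ∀ p q, p ∈ W → q ∉ W → m' s(p, q) = 0 := by
    intro p q hp hq
    rw [(hm' p q).2 fun h => hq h.2]
    by_contra h
    exact hq (hclW p q hp h)
  have hclW' : ∀ p q, p ∈ W → (support m').Adj p q → q ∈ W := by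
    intro p q hp hpq
    by_contra hq
    exact (support_adj.1 hpq).1 (hcross p q hp hq)
  have hin : ∀ p q, p ∈ W → q ∈ W → (support m').Reachable p q := by
    intro p q hp hq
    refine reachable_of_forall_adj ?_ (heul.reachable hp hq)
    intro a b hab
    rw [support_adj] at hab
    have hc := hcarr a b hab.1
    refine Adj.reachable (support_adj.2 ⟨?_, hab.2⟩)
    rw [(hm' a b).1 hc.1 hc.2.1]
    exact trim_ne_zero.2 hab.1
  have hcompW : ∀ v ∈ W, compVerts m' v = W := by
    intro v hv
    ext w
    rw [mem_compVerts]
    exact ⟨mem_of_reachable hclW' hv, hin v w hv⟩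
  have hcompout : ∀ v ∉ W, compVerts m' v = compVerts m v := by
    intro v hv
    have hadj' : ∀ a b, a ∉ W → ((support m').Adj a b ↔ (support m).Adj a b) := fun a b ha => by
      rw [support_adj, support_adj, hout a b ha]
    have hcl : ∀ a b, a ∈ Wᶜ → (support m).Adj a b → b ∈ Wᶜ := by
      intro a b ha hab hb
      refine ha (hclW b a hb ?_)
      rw [Sym2.eq_swap]; exact (support_adj.1 hab).1
    have key : ∀ {a b : V}, (support m).Walk a b → a ∉ W → (support m').Reachable a b := by
      intro a b w
      induction w with
      | nil => exact fun _ => .refl _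
      | cons h _ ih =>
        exact fun ha => ((hadj' _ _ ha).2 h).reachable.trans (ih (hcl _ _ ha h))
    have key' : ∀ {a b : V}, (support m').Walk a b → a ∉ W → (support m).Reachable a b := by
      intro a b w
      induction w with
      | nil => exact fun _ => .refl _
      | cons h _ ih =>
        exact fun ha => ((hadj' _ _ ha).1 h).reachable.trans (ih (hcl _ _ ha ((hadj' _ _ ha).1 h)))
    ext w
    rw [mem_compVerts, mem_compVerts]
    exact ⟨fun ⟨p⟩ => key' p hv, fun ⟨p⟩ => key p hv⟩
  have hresout : ∀ v ∉ W, ∀ p q, p ∈ compVerts m v → m' s(p, q) = m s(p, q) := by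
    intro v hv p q hp
    exact hout p q fun hpW => hv (hrW p v hpW (mem_compVerts.1 hp).symm)
  have hcard : W.ncard = (compVerts m x).ncard + (compVerts m y).ncard := by
    refine Set.ncard_union_eq ?_ (Set.toFinite _) (Set.toFinite _)
    rw [Set.disjoint_left]
    intro a ha hb
    exact hxy ((mem_compVerts.1 ha).trans (mem_compVerts.1 hb).symm)
  -- Either the component was still a single cycle, then with at least five vertices by assumption,
  -- or it was merged earlier from cycles of that size.
  have h5 : ∀ w ∈ W, 5 ≤ (componentSet F w).ncard := by
    intro w hw
    have hw5 : 5 ≤ (compVerts m w).ncard := by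
      rcases hw with hw | hw
      · rw [← compVerts_eq (mem_compVerts.1 hw)]; exact hx
      · rw [← compVerts_eq (mem_compVerts.1 hw)]; exact hy
    rcases hm.unmerged_or_merged w with h | h
    · rw [← h.1]; exact hw5
    · exact h.2 w (mem_compVerts.2 (.refl _))
  have hnumW : numEdges (restrict m' W) ≤ numEdges h' := by
    refine numEdges_mono fun e => ?_
    induction e with | _ p q =>
    rw [restrict_mk]
    split_ifs with h
    · rw [(hm' p q).1 h.1 h.2]; exact trim_le _ _
    · exact Nat.zero_le _
  refine ⟨fun p q hpq => ?_, fun v => ?_, fun p q hpq => ?_, fun v w hw => ?_, fun v => ?_⟩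
  · by_cases h : p ∈ W ∧ q ∈ W
    · rw [(hm' p q).1 h.1 h.2] at hpq
      exact hadj _ _ (trim_ne_zero.1 hpq)
    · rw [(hm' p q).2 h] at hpq
      exact hm.adj _ _ hpq
  · by_cases hv : v ∈ W
    · have : mdegree m' v = mdegree (trim h') v := by
        rw [mdegree_eq_sum, mdegree_eq_sum]
        refine Finset.sum_congr rfl fun q _ => ?_
        by_cases hq : q ∈ W
        · exact (hm' v q).1 hv hq
        · rw [hcross v q hv hq]
          by_contra h
          exact hq (hcarr v q (trim_ne_zero.1 (Ne.symm h))).2.1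
      rw [this]
      exact even_trim (heul.2 v)
    · have : mdegree m' v = mdegree m v := by
        rw [mdegree_eq_sum, mdegree_eq_sum]
        exact Finset.sum_congr rfl fun q _ => hout v q hv
      rw [this]
      exact hm.even v
  · have h1 := hm.coarse p q hpq
    by_cases hp : p ∈ W
    · exact hin p q hp (hrW p q hp h1)
    · have := mem_compVerts.2 h1
      rw [← hcompout p hp, mem_compVerts] at this
      exact this
  · by_cases hv : v ∈ W
    · rw [hcompW v hv] at *
      have bx := fun w hw => hm.bound x w hw
      have by' := fun w hw => hm.bound y w hw
      -- Add the bound at the cycle of `w` in its own component to the bound at any cycle of the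
      -- other component. That other cycle has at least five vertices, which pays for the one
      -- additional edge, counted five times.
      rcases hw with hw | hw
      · have h1 := bx w hw
        have h2 := by' y (mem_compVerts.2 (.refl _))
        have h3 := h5 y (.inr (mem_compVerts.2 (.refl _)))
        omega
      · have h1 := by' w hw
        have h2 := bx x (mem_compVerts.2 (.refl _))
        have h3 := h5 x (.inl (mem_compVerts.2 (.refl _)))
        omega
    · have hres : restrict m' (compVerts m v) = restrict m (compVerts m v) := by
        funext e
        induction e with | _ p q =>
        rw [restrict_mk, restrict_mk]
        split_ifs with h
        · exact hresout v hv p q h.1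
        · rfl
      rw [hcompout v hv] at *
      rw [hres]
      exact hm.bound v w hw
  · by_cases hv : v ∈ W
    · right
      rw [hcompW v hv]
      exact ⟨by omega, h5⟩
    · rw [hcompout v hv]
      rcases hm.unmerged_or_merged v with h | h
      · refine .inl ⟨h.1, fun p q hp hq => ?_⟩
        rw [hresout v hv p q hp]
        exact h.2 p q hp hq
      · exact .inr h

variable [DecidableRel G.Adj]

lemma IsCoverFrom.adj_cycle (hG : G.IsRegularOfDegree 3) (hF : IsTwoFactor G F)
    (hm : IsCoverFrom G F m) {v p n : V} (hp : G.Adj v p) (hn : G.Adj v n) (hpn : p ≠ n) :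
    (support m).Reachable v p ∨ (support m).Reachable v n :=
  (hF.adj_cycle hG hp hn hpn).imp (fun h => hm.coarse _ _ h.reachable)
    fun h => hm.coarse _ _ h.reachable

/-- A vertex of the pentagon shares its component with a neighbour on the pentagon. Five vertices
leave room for at most two components. -/
lemma IsCoverFrom.mem_comp_of_cyc5 (hG : G.IsRegularOfDegree 3) (hF : IsTwoFactor G F)
    (hm : IsCoverFrom G F m) {a b c d e x y z : V} (h : IsCyc5 G a b c d e)
    (hx : x ∈ [a, b, c, d, e]) (hy : y ∈ [a, b, c, d, e]) (hz : z ∈ [a, b, c, d, e])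
    (hxy : ¬ (support m).Reachable x y) :
    (support m).Reachable z x ∨ (support m).Reachable z y := by
  obtain ⟨hn, h1, h2, h3, h4, h5⟩ := h
  simp only [List.nodup_cons, List.mem_cons, List.not_mem_nil, not_or, or_false] at hn
  have adj : ∀ v p n, G.Adj v p → G.Adj v n → p ≠ n →
      (support m).connectedComponentMk v = (support m).connectedComponentMk p ∨
      (support m).connectedComponentMk v = (support m).connectedComponentMk n :=
    fun v p n hp hn hpn => by
      rw [ConnectedComponent.eq, ConnectedComponent.eq]
      exact hm.adj_cycle hG hF hp hn hpn
  simp only [← ConnectedComponent.eq] at *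
  refine mem_two_classes_pentagon (x := (support m).connectedComponentMk x)
    (y := (support m).connectedComponentMk y)
    (z := (support m).connectedComponentMk z) (List.mem_map_of_mem hx) (List.mem_map_of_mem hy)
    (List.mem_map_of_mem hz) hxy (adj _ _ _ h1 h5.symm ?_) (adj _ _ _ h1.symm h2 ?_)
    (adj _ _ _ h2.symm h3 ?_) (adj _ _ _ h3.symm h4 ?_) (adj _ _ _ h4.symm h5 ?_) <;> grind

lemma IsCoverFrom.stepU3 (hG : G.IsRegularOfDegree 3) (hF : IsTwoFactor G F)
    (hm : IsCoverFrom G F m) (h : StepU3 G m m') : IsCoverFrom G F m' := by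
  classical
  obtain ⟨a, C, γ₁, γ₂, h, h', hC, hl, h12, h51, h52, hC1, ⟨y, hy, hyC⟩, ⟨⟨e₁, e₂, hh⟩, -⟩,
    ⟨⟨e₃, e₄, hh'⟩, heul⟩, hm'⟩ := h
  obtain ⟨b, c, d, e, h5, hs, he⟩ := exists_isCyc5 hC hl
  obtain ⟨x, hxx⟩ : (γ₁.supp ∩ walkVerts C).Nonempty := by
    refine Set.nonempty_of_ncard_ne_zero (by omega)
  obtain ⟨hx, hxC⟩ := hxx
  rw [ConnectedComponent.mem_supp_iff] at hx hy
  subst hx hy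
  change 5 ≤ (compVerts m x).ncard at h51
  change 5 ≤ (compVerts m y).ncard at h52
  change h + _ + _ = restrict m (compVerts m x) + _ at hh
  change h' + _ + _ = h + restrict m (compVerts m y) at hh'
  change IsEulerianOn (compVerts m x ∪ walkVerts C ∪ compVerts m y) h' at heul
  have hxy : ¬ (support m).Reachable x y := by rw [← ConnectedComponent.eq]; exact h12
  have hmem : ∀ w, w ∈ walkVerts C → w ∈ [a, b, c, d, e] := by
    intro w hw
    simp only [walkVerts, hs, Set.mem_ofPred_eq] at hw
    grind
  -- The two components already cover the 5-cycle, so the merge involves no further component and no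
  -- new vertices.
  have hCW : walkVerts C ⊆ compVerts m x ∪ compVerts m y := by
    intro z hz
    rcases hm.mem_comp_of_cyc5 hG hF h5 (hmem x hxC) (hmem y hyC) (hmem z hz) hxy with h | h
    · exact .inl (mem_compVerts.2 h.symm)
    · exact .inr (mem_compVerts.2 h.symm)
  have hWeq : compVerts m x ∪ walkVerts C ∪ compVerts m y = compVerts m x ∪ compVerts m y := by
    ext z
    have := @hCW z
    simp only [Set.mem_union] at *
    tauto
  rw [hWeq] at heul
  have hE : ∀ x, x ∈ walkEdges C ↔ x = s(a, b) ∨ x = s(b, c) ∨ x = s(c, d) ∨ x = s(d, e) ∨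
      x = s(e, a) := by simp [walkEdges, he]
  have hle : ∀ s, h' s ≤ restrict m (compVerts m x) s + ofSet (walkEdges C) s +
      restrict m (compVerts m y) s := by
    intro s
    have h1 := congrFun hh s
    have h2 := congrFun hh' s
    simp only [Pi.add_apply] at h1 h2
    omega
  have hne : ∀ p q, h' s(p, q) ≠ 0 → restrict m (compVerts m x) s(p, q) ≠ 0 ∨
      s(p, q) ∈ walkEdges C ∨ restrict m (compVerts m y) s(p, q) ≠ 0 := by
    intro p q hpq
    have := hle s(p, q)
    by_cases hE : s(p, q) ∈ walkEdges C
    · exact .inr (.inl hE)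
    · have h0 : ofSet (walkEdges C) s(p, q) = 0 := by simp [ofSet, hE]
      omega
  have hadj : ∀ p q, h' s(p, q) ≠ 0 → G.Adj p q := by
    intro p q hpq
    rcases hne p q hpq with h | h | h
    · exact hm.adj _ _ (mem_of_restrict_ne_zero h).2.2
    · exact C.edges_subset_edgeSet h
    · exact hm.adj _ _ (mem_of_restrict_ne_zero h).2.2
  refine hm.merge hxy h51 h52 hadj ?_ heul ?_ ?_
  · intro p q hpq
    refine (and_assoc.1 ⟨?_, (hadj p q hpq).ne⟩)
    rcases hne p q hpq with h | h | h
    · have := mem_of_restrict_ne_zero h; exact ⟨.inl this.1, .inl this.2.1⟩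
    · exact ⟨hCW (C.fst_mem_support_of_mem_edges h), hCW (C.snd_mem_support_of_mem_edges h)⟩
    · have := mem_of_restrict_ne_zero h; exact ⟨.inr this.1, .inr this.2.1⟩
  -- The edge count is ℓ₁ + 5 - 2 + ℓ₂ - 2 = ℓ₁ + ℓ₂ + 1.
  · have h1 := congrArg numEdges hh
    have h2 := congrArg numEdges hh'
    simp only [numEdges_add, numEdges_single, numEdges_cyc5 h5.1 hE] at h1 h2
    omega
  · intro p q
    subst hm'
    constructor
    · intro hp hq
      simp only [Sym2.mem_iff, forall_eq_or_imp, forall_eq]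
      exact if_pos ⟨hp, hq⟩
    · intro hpq
      simp only [Sym2.mem_iff, forall_eq_or_imp, forall_eq]
      exact if_neg hpq

lemma IsCoverFrom.reflTransGen (hG : G.IsRegularOfDegree 3) (hF : IsTwoFactor G F)
    (hm : IsCoverFrom G F m) (h : Relation.ReflTransGen (StepU3 G) m m') : IsCoverFrom G F m' := by
  induction h with
  | refl => exact hm
  | tail _ h ih => exact ih.stepU3 hG hF h

end Step

end Covers
end CubicTour

namespace CubicTour
open SimpleGraph

/-! ### (U3) is applicable whenever two large components meet a 5-cycle. -/

section Applicability

variable {V : Type*} [Fintype V] [DecidableEq V] {G F : SimpleGraph V} {m : Sym2 V → ℕ}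

lemma isCarried_restrict (hm : IsCoverFrom G F m) (W : Set V) : IsCarried W (restrict m W) := by
  intro x y h
  have h := mem_of_restrict_ne_zero h
  exact ⟨h.1, h.2.1, (hm.adj x y h.2.2).ne⟩

lemma IsCoverFrom.mem_compVerts_of_ne_zero (hm : IsCoverFrom G F m) {v x y : V}
    (hx : x ∈ compVerts m v) (hxy : m s(x, y) ≠ 0) : y ∈ compVerts m v := by
  rw [mem_compVerts] at *
  exact hx.trans (Adj.reachable (support_adj.2 ⟨hxy, (hm.adj x y hxy).ne⟩))

lemma IsCoverFrom.isEulerianOn_restrict (hm : IsCoverFrom G F m) (v : V) :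
    IsEulerianOn (compVerts m v) (restrict m (compVerts m v)) := by
  have hv : v ∈ compVerts m v := mem_compVerts.2 (.refl _)
  have key : ∀ {x y : V}, (support m).Walk x y → x ∈ compVerts m v →
      (support (restrict m (compVerts m v))).Reachable x y := by
    intro x y w
    induction w with
    | nil => exact fun _ => .refl _
    | @cons x z y h _ ih =>
      intro hx
      rw [support_adj] at h
      have hz := hm.mem_compVerts_of_ne_zero hx h.1
      refine Reachable.trans (Adj.reachable (support_adj.2 ⟨?_, h.2⟩)) (ih hz)
      rw [restrict_eq_of_mem hx hz]; exact h.1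
  refine ⟨induce_connected ⟨v, hv⟩ ?_ ?_, fun x => ?_⟩
  · intro x y _ hxy
    exact (mem_of_restrict_ne_zero (support_adj.1 hxy).1).2.1
  · intro x hx y hy
    obtain ⟨w⟩ := (mem_compVerts.1 hx).symm.trans (mem_compVerts.1 hy)
    exact key w hx
  · classical
    rw [mdegree_eq_sum]
    by_cases hx : x ∈ compVerts m v
    · have : ∑ y, restrict m (compVerts m v) s(x, y) = mdegree m x := by
        rw [mdegree_eq_sum]
        refine Finset.sum_congr rfl fun y _ => ?_
        by_cases hy : y ∈ compVerts m v
        · exact restrict_eq_of_mem hx hy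
        · rw [restrict_mk, if_neg fun h => hy h.2]
          by_contra h
          exact hy (hm.mem_compVerts_of_ne_zero hx (Ne.symm h))
      rw [this]; exact hm.even x
    · rw [Finset.sum_eq_zero]
      · exact ⟨0, rfl⟩
      · intro y _
        rw [restrict_mk, if_neg fun h => hx h.1]

omit [Fintype V] [DecidableEq V] in
lemma ofSet_ne_zero {E : Set (Sym2 V)} {e : Sym2 V} : ofSet E e ≠ 0 ↔ e ∈ E := by
  simp [ofSet]

/-- Since `G` is cubic, besides its two neighbours on the 5-cycle each of its vertices has only one
further neighbour, which is the situation of `exists_merge`. It is used at `a` to merge the first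
component with the 5-cycle, and at `d`, whose two 5-cycle edges are both still present, to merge in
the second. -/
lemma exists_stepU3 [DecidableRel G.Adj] (hG : G.IsRegularOfDegree 3)
    (hm : IsCoverFrom G F m) {a b c d e : V} (h : IsCyc5 G a b c d e)
    (hab : (support m).Reachable a b) (hcd : (support m).Reachable c d)
    (hde : (support m).Reachable d e) (hac : ¬ (support m).Reachable a c)
    (h5a : 5 ≤ (compVerts m a).ncard) (h5c : 5 ≤ (compVerts m c).ncard) :
    ∃ m', StepU3 G m m' := by
  classical
  obtain ⟨p, hp, hl, hs, he⟩ := h.exists_walk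
  have hE : ∀ x, x ∈ walkEdges p ↔ x = s(a, b) ∨ x = s(b, c) ∨ x = s(c, d) ∨ x = s(d, e) ∨
      x = s(e, a) := by simp [walkEdges, he]
  have hV : ∀ x, x ∈ walkVerts p ↔ x ∈ [a, b, c, d, e] := by
    intro x; simp only [walkVerts, hs, Set.mem_ofPred_eq]; grind
  have h' := h
  obtain ⟨hn, h1, h2, h3, h4, h5⟩ := h
  have hn' := hn
  simp only [List.nodup_cons, List.mem_cons, List.not_mem_nil, not_or, or_false] at hn
  set E := walkEdges p with hEdef
  have had : ¬ (support m).Reachable a d := fun h => hac (h.trans hcd.symm)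
  have hae : ¬ (support m).Reachable a e := fun h => had (h.trans hde.symm)
  -- the multigraph of the 5-cycle
  have hCcarr : IsCarried (walkVerts p) (ofSet E) := by
    intro x y hxy
    rw [ofSet_ne_zero] at hxy
    exact ⟨p.fst_mem_support_of_mem_edges hxy, p.snd_mem_support_of_mem_edges hxy,
      Adj.ne (p.edges_subset_edgeSet hxy)⟩
  have hsupp : ∀ x y, s(x, y) ∈ E → (support (ofSet E)).Reachable x y := fun x y hxy =>
    Adj.reachable (support_adj.2 ⟨ofSet_ne_zero.2 hxy, (hCcarr x y (ofSet_ne_zero.2 hxy)).2.2⟩)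
  have hCeul : IsEulerianOn (walkVerts p) (ofSet E) := by
    refine ⟨induce_connected ⟨a, (hV a).2 (by simp)⟩ ?_ ?_, even_mdegree_cyc5 hn' hE⟩
    · intro x y _ hxy
      exact (hCcarr x y (support_adj.1 hxy).1).2.1
    · have r1 := hsupp a b ((hE _).2 (by simp))
      have r2 := r1.trans (hsupp b c ((hE _).2 (by simp)))
      have r3 := r2.trans (hsupp c d ((hE _).2 (by simp)))
      have r4 := r3.trans (hsupp d e ((hE _).2 (by simp)))
      have r : ∀ x ∈ walkVerts p, (support (ofSet E)).Reachable a x := by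
        intro x hx
        rw [hV] at hx
        simp only [List.mem_cons, List.not_mem_nil, or_false] at hx
        rcases hx with rfl | rfl | rfl | rfl | rfl <;> first | assumption | rfl
      exact fun x hx y hy => (r x hx).symm.trans (r y hy)
  -- first merge, at `a`
  have hA : ∀ {x}, x ∈ compVerts m a ↔ (support m).Reachable a x := mem_compVerts
  have hC : ∀ {x}, x ∈ compVerts m c ↔ (support m).Reachable c x := mem_compVerts
  obtain ⟨o, ho⟩ := exists_isNbrs hG h1 h5.symm (by grind : b ≠ e)
  obtain ⟨e₁, he₁, g, hg, hgeul⟩ := exists_merge (a := b) (b := a) (c := e) (o := o)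
    (isCarried_restrict hm (compVerts m a)) hCcarr (hm.isEulerianOn_restrict a) hCeul
    (hA.2 (.refl _)) (hA.2 hab) (ofSet_ne_zero.2 ((hE _).2 (by simp)))
    (ofSet_ne_zero.2 ((hE _).2 (by simp)))
    (fun x hx => (ho.2.2.2 x).1 (hm.adj _ _ (mem_of_restrict_ne_zero hx).2.2))
  have hgcarr : IsCarried (compVerts m a ∪ walkVerts p) g := by
    intro x y hxy
    have := congrFun hg s(x, y)
    simp only [Pi.add_apply] at this
    by_cases hx : restrict m (compVerts m a) s(x, y) = 0
    · exact (hCcarr.mono Set.subset_union_right) x y (by omega)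
    · exact ((isCarried_restrict hm _).mono Set.subset_union_left) x y hx
  -- second merge, at `d`
  have hgd : ∀ z, s(d, z) ∈ E → g s(d, z) ≠ 0 := by
    intro z hz
    -- The pair removed in the first merge is an edge used by the component of `a`, and `d` is not
    -- in that component.
    have hne : s(d, z) ≠ e₁ := by
      rintro rfl
      exact had (hA.1 (mem_of_restrict_ne_zero he₁).1)
    have := congrFun hg s(d, z)
    simp only [Pi.add_apply, Pi.single_eq_of_ne hne] at this
    have h0 := ofSet_ne_zero.2 hz
    omega
  obtain ⟨o', ho'⟩ := exists_isNbrs hG h3.symm h4 (by grind : c ≠ e)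
  obtain ⟨e₂, he₂, g', hg', hgeul'⟩ := exists_merge (a := c) (b := d) (c := e) (o := o')
    (isCarried_restrict hm (compVerts m c)) hgcarr (hm.isEulerianOn_restrict c) hgeul
    (hC.2 hcd) (hC.2 (.refl _)) (hgd c ((hE _).2 (by simp [Sym2.eq_swap])))
    (hgd e ((hE _).2 (by simp)))
    (fun x hx => (ho'.2.2.2 x).1 (hm.adj _ _ (mem_of_restrict_ne_zero hx).2.2))
  refine ⟨_, a, p, (support m).connectedComponentMk a, (support m).connectedComponentMk c, g, g',
    hp, hl, ?_, h5a, h5c, ?_, ?_, ⟨⟨e₁, e₁, hg⟩, hgeul⟩, ⟨⟨e₂, e₂, ?_⟩, ?_⟩, rfl⟩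
  · rw [Ne, ConnectedComponent.eq]; exact hac
  · change (compVerts m a ∩ walkVerts p).ncard = 2
    have : compVerts m a ∩ walkVerts p = {a, b} := by
      ext x
      rw [Set.mem_inter_iff, hA, hV]
      simp only [List.mem_cons, List.not_mem_nil, or_false, Set.mem_insert_iff,
        Set.mem_singleton_iff]
      constructor
      · rintro ⟨hx, rfl | rfl | rfl | rfl | rfl⟩ <;> tauto
      · rintro (rfl | rfl)
        · exact ⟨.refl _, .inl rfl⟩
        · exact ⟨hab, .inr (.inl rfl)⟩
    rw [this, Set.ncard_pair (by grind)]
  · exact ⟨c, hC.2 (.refl _), (hV c).2 (by simp)⟩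
  · change g' + _ + _ = g + restrict m (compVerts m c)
    rw [hg', add_comm]
  · change IsEulerianOn (compVerts m a ∪ walkVerts p ∪ compVerts m c) g'
    rw [Set.union_comm]; exact hgeul'

/-- Two different components split the 5-cycle as 2 + 3; rotating it puts the component with exactly
two vertices at `a, b`, where (U3) requires it. -/
lemma IsCoverFrom.reachable_of_not_stepU3 [DecidableRel G.Adj] (hG : G.IsRegularOfDegree 3)
    (hF : IsTwoFactor G F) (hm : IsCoverFrom G F m) (hstep : ∀ m', ¬ StepU3 G m m')
    {a b c d e x y : V} (h : IsCyc5 G a b c d e)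
    (hx : x ∈ [a, b, c, d, e]) (hy : y ∈ [a, b, c, d, e])
    (h5x : 5 ≤ (compVerts m x).ncard) (h5y : 5 ≤ (compVerts m y).ncard) :
    (support m).Reachable x y := by
  by_contra hxy
  have h5 : ∀ z ∈ [a, b, c, d, e], 5 ≤ (compVerts m z).ncard := by
    intro z hz
    rcases hm.mem_comp_of_cyc5 hG hF h hx hy hz hxy with h | h
    · rw [compVerts_eq h]; exact h5x
    · rw [compVerts_eq h]; exact h5y
  have hh := h
  obtain ⟨hn, h1, h2, h3, h4, h5'⟩ := h
  simp only [List.nodup_cons, List.mem_cons, List.not_mem_nil, not_or, or_false] at hn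
  have adj : ∀ v p n, G.Adj v p → G.Adj v n → p ≠ n →
      (support m).connectedComponentMk v = (support m).connectedComponentMk p ∨
      (support m).connectedComponentMk v = (support m).connectedComponentMk n :=
    fun v p n hp hn hpn => by
      rw [ConnectedComponent.eq, ConnectedComponent.eq]
      exact hm.adj_cycle hG hF hp hn hpn
  have hcases := two_classes_pentagon (x := (support m).connectedComponentMk x)
    (y := (support m).connectedComponentMk y)
    (List.mem_map_of_mem hx) (List.mem_map_of_mem hy)
    (by rw [Ne, ConnectedComponent.eq]; exact hxy)
    (adj _ _ _ h1 h5'.symm (by grind)) (adj _ _ _ h1.symm h2 (by grind))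
    (adj _ _ _ h2.symm h3 (by grind)) (adj _ _ _ h3.symm h4 (by grind))
    (adj _ _ _ h4.symm h5' (by grind))
  simp only [Ne, ConnectedComponent.eq] at hcases
  have fin : ∀ a b c d e, IsCyc5 G a b c d e → 5 ≤ (compVerts m a).ncard →
      5 ≤ (compVerts m c).ncard → (support m).Reachable a b → (support m).Reachable c d →
      (support m).Reachable d e → ¬ (support m).Reachable a c → False :=
    fun a b c d e h ha hc k1 k2 k3 k4 => by
      obtain ⟨m', hm'⟩ := exists_stepU3 hG hm h k1 k2 k3 k4 ha hc
      exact hstep m' hm'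
  have ra := h5 a (by simp); have rb := h5 b (by simp); have rc := h5 c (by simp)
  have rd := h5 d (by simp); have re := h5 e (by simp)
  rcases hcases with ⟨k1, k2, k3, k4⟩ | ⟨k1, k2, k3, k4⟩ | ⟨k1, k2, k3, k4⟩ | ⟨k1, k2, k3, k4⟩ |
    ⟨k1, k2, k3, k4⟩
  · exact fin _ _ _ _ _ hh ra rc k1 k2 k3 k4
  · exact fin _ _ _ _ _ hh.rotate rb rd k1 k2 k3 k4
  · exact fin _ _ _ _ _ hh.rotate.rotate rc re k1 k2 k3 k4
  · exact fin _ _ _ _ _ hh.rotate.rotate.rotate rd ra k1 k2 k3 k4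
  · exact fin _ _ _ _ _ hh.rotate.rotate.rotate.rotate re rb k1 k2 k3 k4

end Applicability
end CubicTour

namespace CubicTour
open SimpleGraph

/-! ### The local properties of the final covers -/

section Mates

variable {V : Type*} {G : SimpleGraph V}

/-- `μ` maps every vertex to its partner in the perfect matching `M`. -/
def IsMate (M : G.Subgraph) (μ : V → V) : Prop := ∀ u v, M.Adj u v ↔ μ u = v

lemma exists_isMate {M : G.Subgraph} (hM : M.IsPerfectMatching) : ∃ μ, IsMate M μ := by
  have h : ∀ v, ∃! w, M.Adj v w := fun v => hM.1 (hM.2 v)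
  choose μ hμ hu using h
  exact ⟨μ, fun u v => ⟨fun h => (hu u v h).symm, fun h => h ▸ hμ u⟩⟩

variable {M : G.Subgraph} {μ : V → V}

lemma IsMate.adj (h : IsMate M μ) (v : V) : G.Adj v (μ v) := ((h v (μ v)).2 rfl).adj_sub

lemma IsMate.mate_mate (h : IsMate M μ) (v : V) : μ (μ v) = v :=
  (h (μ v) v).1 ((h v (μ v)).2 rfl).symm

lemma IsMate.mem_edgeSet (h : IsMate M μ) {u v : V} : s(u, v) ∈ M.edgeSet ↔ μ u = v := by
  rw [Subgraph.mem_edgeSet, h]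

lemma IsMate.even_card_inside [DecidableEq V] (h : IsMate M μ) (W : Finset V) :
    Even (W.filter (fun x => μ x ∈ W)).card := by
  have : ((W.filter (fun x => μ x ∈ W)).card : ZMod 2) = 0 := by
    rw [Finset.card_eq_sum_ones, Nat.cast_sum]
    refine Finset.sum_involution (fun x _ => μ x) (fun x _ => by decide)
      (fun x _ _ => (h.adj x).ne') (fun x hx => ?_) (fun x _ => h.mate_mate x)
    rw [Finset.mem_filter] at *
    rw [h.mate_mate]
    exact ⟨hx.2, hx.1⟩
  exact (ZMod.natCast_eq_zero_iff_even).1 this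

lemma IsMate.odd_card_exits [DecidableEq V] (h : IsMate M μ) {W : Finset V} (hW : Odd W.card) :
    Odd (W.filter (fun x => μ x ∉ W)).card := by
  have h1 := h.even_card_inside W
  have h2 := Finset.card_filter_add_card_filter_not (s := W) (fun x => μ x ∈ W)
  rw [← h2] at hW
  exact (Nat.odd_add'.1 hW).2 h1

/-- An odd set of vertices that is closed under the edges outside `M i` is left by at least four
edges of `M i`. -/
lemma four_le_exits [Fintype V] [DecidableEq V] {k : ℕ} {M : Fin k → G.Subgraph}
    {lam : Fin k → ℝ} (hM : ∀ i, IsThreeCutPerfect (M i)) (hsum : ∑ i, lam i = 1)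
    (hconv : ∀ e ∈ G.edgeSet, ∑ i, lam i * (M i).edgeSet.indicator (fun _ => (1 : ℝ)) e = 1 / 3)
    {μ : Fin k → V → V} (hμ : ∀ i, IsMate (M i) (μ i)) (i : Fin k) {W : Finset V}
    (hW : Odd W.card) (hcl : ∀ x ∈ W, ∀ y, G.Adj x y → μ i x ≠ y → y ∈ W) :
    4 ≤ (W.filter (fun x => μ i x ∉ W)).card := by
  set X := W.filter (fun x => μ i x ∉ W) with hX
  have hodd : Odd X.card := (hμ i).odd_card_exits hW
  have hmemX : ∀ x, x ∈ X ↔ x ∈ W ∧ μ i x ∉ W := fun x => by rw [hX, Finset.mem_filter]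
  -- As `W` is closed under non-matching edges, its cut consists of matching edges only.
  have hcut : cut G (W : Set V) = (fun x => s(x, μ i x)) '' (X : Set V) := by
    ext e
    constructor
    · rintro ⟨he, x, hx, y, hy, rfl⟩
      have : μ i x = y := by
        by_contra hne
        exact hy (hcl x hx y he hne)
      subst this
      exact ⟨x, (hmemX x).2 ⟨hx, hy⟩, rfl⟩
    · rintro ⟨x, hx, rfl⟩
      have := (hmemX x).1 hx
      exact ⟨(hμ i).adj x, x, this.1, μ i x, this.2, rfl⟩
  have hinj : Set.InjOn (fun x => s(x, μ i x)) (X : Set V) := by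
    intro x hx y hy hxy
    have hx' := (hmemX x).1 hx
    have hy' := (hmemX y).1 hy
    rcases Sym2.eq_iff.1 hxy with ⟨h, -⟩ | ⟨-, h⟩
    · exact h
    · exact absurd hy'.1 (h ▸ hx'.2)
  have hncard : (cut G (W : Set V)).ncard = X.card := by
    rw [hcut, hinj.ncard_image, Set.ncard_coe_finset]
  have hsub : cut G (W : Set V) ⊆ (M i).edgeSet := by
    rw [hcut]
    rintro e ⟨x, -, rfl⟩
    exact (hμ i).mem_edgeSet.2 rfl
  -- The number of leaving edges is odd, so only one and three have to be excluded.
  by_contra hlt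
  have h13 : X.card = 1 ∨ X.card = 3 := by
    obtain ⟨r, hr⟩ := hodd
    omega
  rcases h13 with h1 | h3
  · rw [h1, Set.ncard_eq_one] at hncard
    obtain ⟨e, he⟩ := hncard
    have heG : e ∈ G.edgeSet := by
      have : e ∈ cut G (W : Set V) := he ▸ rfl
      exact this.1
    -- Every perfect matching meets the cut of an odd set. If the cut is the single edge `e`, all
    -- matchings contain `e`, and its weight would be 1 instead of 1/3.
    have hall : ∀ j, e ∈ (M j).edgeSet := by
      intro j
      have hodd := (hμ j).odd_card_exits hW
      obtain ⟨x, hx⟩ := Finset.card_pos.1 hodd.pos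
      rw [Finset.mem_filter] at hx
      have : s(x, μ j x) ∈ cut G (W : Set V) :=
        ⟨(hμ j).adj x, x, hx.1, μ j x, hx.2, rfl⟩
      rw [he, Set.mem_singleton_iff] at this
      rw [← this]
      exact (hμ j).mem_edgeSet.2 rfl
    have := hconv e heG
    simp only [Set.indicator_of_mem (hall _), mul_one, hsum] at this
    norm_num at this
  -- A 3-cut contained in `M i` meets it in three edges instead of one.
  · have := (hM i).2 (W : Set V) (by rw [hncard, h3])
    rw [Set.inter_eq_self_of_subset_right hsub, hncard, h3] at this
    omega

end Mates

/-! ### Components of a two-factor as cycles of `G`. -/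

section ComponentCycles

variable {V : Type*} [Fintype V] [DecidableEq V] {G F : SimpleGraph V}

/-- The component of a two-factor at `v` is a cycle. -/
lemma IsTwoFactor.exists_cycle (hF : IsTwoFactor G F) (v : V) :
    ∃ q : G.Walk v v, q.IsCycle ∧ q.length = (componentSet F v).ncard ∧
      walkVerts q = componentSet F v ∧
      ∀ x y, x ∈ componentSet F v → (s(x, y) ∈ q.edges ↔ F.Adj x y) := by
  obtain ⟨a, b, -, hab⟩ := hF.exists_nbrs v
  obtain ⟨p, hp, hpv⟩ := hF.isCycles.exists_cycle_toSubgraph_verts_eq_connectedComponentSupp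
    (c := F.connectedComponentMk v) (v := v) rfl ⟨a, (hab a).2 (.inl rfl)⟩
  have hverts : ∀ x, x ∈ p.support ↔ x ∈ componentSet F v := fun x => by
    rw [← Walk.mem_verts_toSubgraph, hpv]; rfl
  refine ⟨p.mapLe hF.1, hp.mapLe hF.1, ?_, ?_, ?_⟩
  · have h1 : componentSet F v = (p.support.tail.toFinset : Set V) := by
      ext x
      rw [← hverts, List.coe_toFinset, Set.mem_ofPred_eq, ← List.cons_head_tail p.support_ne_nil,
        List.mem_cons]
      simp only [List.tail_cons]
      constructor
      · rintro (h | h)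
        · rw [h, Walk.head_support]; exact Walk.end_mem_tail_support hp.not_nil
        · exact h
      · exact Or.inr
    rw [h1, Set.ncard_coe_finset, List.toFinset_card_of_nodup hp.support_nodup, List.length_tail,
      Walk.length_support, Walk.length_map]
    rfl
  · ext x
    rw [← hverts]
    simp [walkVerts]
  · intro x y hx
    have h1 : p.toSubgraph.neighborSet x = F.neighborSet x := by
      refine Set.eq_of_subset_of_ncard_le (p.toSubgraph.neighborSet_subset x) ?_ (Set.toFinite _)
      rw [hF.2 x, hp.ncard_neighborSet_toSubgraph_eq_two ((hverts x).2 hx)]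
    have h2 := Set.ext_iff.1 h1 y
    rw [Subgraph.mem_neighborSet, mem_neighborSet] at h2
    rw [← h2, ← Subgraph.mem_edgeSet, Walk.mem_edges_toSubgraph]
    simp

end ComponentCycles
end CubicTour

namespace CubicTour
open SimpleGraph

/-! ### The local axioms satisfied by a final cover. -/

section LocalCovers

variable {V : Type*} [Fintype V] [DecidableEq V]

open Classical in
/-- The class of `v` as a finite set. -/
noncomputable def cls (s : Setoid V) (v : V) : Finset V := Finset.univ.filter (fun w => s v w)

omit [DecidableEq V] in
@[simp] lemma mem_cls {s : Setoid V} {v w : V} : w ∈ cls s v ↔ s v w := by simp [cls]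

/-- The local properties of a final cover `m` that is obtained from the perfect matching with
partner function `μ`. The classes of `s₁`, `s₂` and `s` are the components after exhaustive
application of (U1), (U2) and (U3), respectively. -/
structure LocalCover (G : SimpleGraph V) (m : Sym2 V → ℕ) (μ : V → V) (s₁ s₂ s : Setoid V) :
    Prop where
  adj_mate : ∀ v, G.Adj v (μ v)
  mate_mate : ∀ v, μ (μ v) = v
  rel₁ : ∀ x y, G.Adj x y → μ x ≠ y → s₁ x y
  le₁₂ : ∀ x y, s₁ x y → s₂ x y
  le₂ : ∀ x y, s₂ x y → s x y
  mem_compVerts : ∀ v w, w ∈ compVerts m v ↔ s v w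
  exits : ∀ W : Finset V, Odd W.card → (∀ x ∈ W, ∀ y, G.Adj x y → μ x ≠ y → y ∈ W) →
    4 ≤ (W.filter (fun x => μ x ∉ W)).card
  hexagon : ∀ a b c d e f, IsCyc6 G a b c d e f → ∀ x ∈ [a, b, c, d, e, f],
    ∀ y ∈ [a, b, c, d, e, f], ∀ z ∈ [a, b, c, d, e, f], s₁ x y ∨ s₁ x z ∨ s₁ y z
  square : ∀ a b c d, IsCyc4 G a b c d → ∀ x ∈ [a, b, c, d], ∀ y ∈ [a, b, c, d], s₂ x y
  pentagon : ∀ a b c d e, IsCyc5 G a b c d e → ∀ x ∈ [a, b, c, d, e], ∀ y ∈ [a, b, c, d, e],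
    5 ≤ (cls s x).card → 5 ≤ (cls s y).card → s x y
  -- This is `IsCoverFrom.bound` with the number of edges eliminated through ℓ + 2 = h · z.
  bound : ∀ v w, s v w → 5 * (cls s v).card * contribution m v ≤
    6 * (cls s v).card + 10 - (cls s₂ w).card
  unmerged_or_merged : ∀ v, cls s v = cls s₂ v ∨
    (10 ≤ (cls s v).card ∧ ∀ w, s v w → 5 ≤ (cls s₂ w).card)
  induced : ∀ v n, (cls s v).card = n → n = 4 ∨ n = 5 ∨ n = 6 →
    (∀ D, IsChordedFourCycle G D → v ∉ D) →
    ∃ (u : V) (p : G.Walk u u), IsInducedCycleAt m n v p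

variable {G : SimpleGraph V} {m : Sym2 V → ℕ} {F : SimpleGraph V}

omit [Fintype V] [DecidableEq V] in
lemma isChordless_of_length_four {v : V} {q : G.Walk v v} (hq : q.IsCycle) (hl : q.length = 4)
    (hv : ∀ D, IsChordedFourCycle G D → v ∉ D) : q.IsChordless := by
  by_contra hc
  exact hv _ ⟨v, q, hq, hl, hc, rfl⟩ q.start_mem_support

/-- All neighbours of an end of a chord lie on the cycle, so both ends have their partners on it. At
most three matching edges then leave the five vertices, one too few for `hex`. -/
lemma isChordless_of_length_five [DecidableRel G.Adj] (hG : G.IsRegularOfDegree 3) {μ : V → V}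
    (hμ : ∀ v, G.Adj v (μ v)) {v : V} {q : G.Walk v v} (hq : q.IsCycle) (hl : q.length = 5)
    (hex : ∀ W : Finset V, Odd W.card → (∀ x, x ∈ W ↔ x ∈ walkVerts q) →
      4 ≤ (W.filter (fun x => μ x ∉ W)).card) : q.IsChordless := by
  obtain ⟨b, c, d, e, ⟨hn, h1, h2, h3, h4, h5⟩, hs, he⟩ := exists_isCyc5 hq hl
  rw [Walk.isChordless_iff_forall_mem_edges]
  intro x y hx hy hxy
  by_contra hxye
  have hWcard : ([v, b, c, d, e].toFinset).card = 5 := List.toFinset_card_of_nodup hn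
  simp only [List.nodup_cons, List.mem_cons, List.not_mem_nil, not_or, or_false] at hn
  have hmem : ∀ x, x ∈ [v, b, c, d, e].toFinset ↔ x ∈ walkVerts q := by
    intro x
    change _ ↔ x ∈ q.support
    simp only [hs, List.mem_toFinset, List.mem_cons, List.not_mem_nil, or_false]
    constructor
    · rintro (h | h | h | h | h) <;> simp [h]
    · rintro (h | h | h | h | h | h) <;> simp [h]
  have hv : v ∈ [v, b, c, d, e].toFinset := by simp
  have hb : b ∈ [v, b, c, d, e].toFinset := by simp
  have hc : c ∈ [v, b, c, d, e].toFinset := by simp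
  have hd : d ∈ [v, b, c, d, e].toFinset := by simp
  have he' : e ∈ [v, b, c, d, e].toFinset := by simp
  have hW' : ∀ x, x ∈ [v, b, c, d, e].toFinset ↔ x = v ∨ x = b ∨ x = c ∨ x = d ∨ x = e := by simp
  generalize [v, b, c, d, e].toFinset = W at hWcard hmem hv hb hc hd he' hW'
  have h := hex W (by rw [hWcard]; decide) hmem
  have noexit : ∀ x y, G.Adj x y → x ∈ q.support → y ∈ q.support → s(x, y) ∉ q.edges →
      μ x ∈ W := by
    intro x y hxy hx hy hne
    have hyv := (hmem y).2 hy
    have fin : ∀ p n, G.Adj x p → G.Adj x n → p ≠ n → y ≠ p → y ≠ n →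
        p ∈ W → n ∈ W →
        μ x ∈ W := by
      intro p n hp hn hpn hyp hyn hpm hnm
      obtain ⟨o, ho⟩ := exists_isNbrs hG hp hn hpn
      have hyo := (ho.2.2.2 y).1 hxy
      have hyo : y = o := (hyo.resolve_left hyp).resolve_left hyn
      subst hyo
      rcases (ho.2.2.2 _).1 (hμ x) with h | h | h <;> rw [h] <;> assumption
    simp only [he, List.mem_cons, List.not_mem_nil, or_false, not_or, Sym2.eq_iff] at hne
    rcases (hW' x).1 ((hmem x).2 hx) with rfl | rfl | rfl | rfl | rfl
    · exact fin b e h1 h5.symm (by grind) (by intro h; subst h; simp at hne) (by intro h; subst h; simp at hne)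
        hb he'
    · exact fin v c h1.symm h2 (by grind) (by intro h; subst h; simp at hne) (by intro h; subst h; simp at hne)
        hv hc
    · exact fin b d h2.symm h3 (by grind) (by intro h; subst h; simp at hne) (by intro h; subst h; simp at hne)
        hb hd
    · exact fin c e h3.symm h4 (by grind) (by intro h; subst h; simp at hne) (by intro h; subst h; simp at hne)
        hc he'
    · exact fin d v h4.symm h5 (by grind) (by intro h; subst h; simp at hne) (by intro h; subst h; simp at hne)
        hd hv
  have hx' := noexit x y hxy hx hy hxye
  have hy' := noexit y x hxy.symm hy hx (by rwa [Sym2.eq_swap])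
  have hsub : W.filter (fun x => μ x ∉ W) ⊆
      W \ {x, y} := by
    intro z hz
    rw [Finset.mem_filter] at hz
    rw [Finset.mem_sdiff, Finset.mem_insert, Finset.mem_singleton]
    refine ⟨hz.1, ?_⟩
    rintro (rfl | rfl)
    · exact hz.2 hx'
    · exact hz.2 hy'
  have h6 := Finset.card_le_card hsub
  rw [Finset.card_sdiff_of_subset, hWcard, Finset.card_pair hxy.ne] at h6
  · omega
  · intro z hz
    rw [Finset.mem_insert, Finset.mem_singleton] at hz
    rcases hz with rfl | rfl
    · exact (hmem _).2 hx
    · exact (hmem _).2 hy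

omit [DecidableEq V] in
lemma card_cls_reachableSetoid (F : SimpleGraph V) (v : V) :
    (cls F.reachableSetoid v).card = (componentSet F v).ncard := by
  rw [← Set.ncard_coe_finset]
  congr 1
  ext w
  rw [Finset.mem_coe, mem_cls, mem_componentSet]
  rfl

/-- The passage from the operations to the combinatorial axioms; the case analysis afterwards no
longer refers to the operations. -/
lemma IsFinalCover.localCover [DecidableRel G.Adj] (hG : G.IsRegularOfDegree 3)
    (hred : IsReduced G) {k : ℕ} {M : Fin k → G.Subgraph} {lam : Fin k → ℝ}
    (hM : ∀ i, IsThreeCutPerfect (M i)) (hsum : ∑ i, lam i = 1)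
    (hconv : ∀ e ∈ G.edgeSet, ∑ i, lam i * (M i).edgeSet.indicator (fun _ => (1 : ℝ)) e = 1 / 3)
    {μ : Fin k → V → V} (hμ : ∀ i, IsMate (M i) (μ i)) {i : Fin k}
    (hΓ : IsFinalCover G (M i) m) : ∃ s₁ s₂ s : Setoid V, LocalCover G m (μ i) s₁ s₂ s := by
  obtain ⟨F₁, F₂, ⟨hU1, hU1'⟩, ⟨hU2, hU2'⟩, hU3, hU3'⟩ := hΓ
  have hF₀adj : ∀ x y, (G.deleteEdges (M i).edgeSet).Adj x y ↔ G.Adj x y ∧ μ i x ≠ y := by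
    intro x y
    rw [deleteEdges_adj, (hμ i).mem_edgeSet]
  have hF₀ : IsTwoFactor G (G.deleteEdges (M i).edgeSet) := by
    refine isTwoFactor_of_nbrs (deleteEdges_le _) fun v => ?_
    obtain ⟨a, b, c, hv⟩ := exists_isNbrs_self hG v
    have h := (hv.2.2.2 _).1 ((hμ i).adj v)
    simp only [hF₀adj, hv.2.2.2]
    have := hv.1; have := hv.2.1; have := hv.2.2.1
    rcases h with h | h | h
    · exact ⟨b, c, by assumption, fun x => by grind⟩
    · exact ⟨a, c, by assumption, fun x => by grind⟩
    · exact ⟨a, b, by assumption, fun x => by grind⟩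
  obtain ⟨hF₁, h01⟩ := isTwoFactor_of_reflTransGen
    (fun F F' hF h => StepU1.isTwoFactor hG hF h) hF₀ hU1
  obtain ⟨hF₂, h12⟩ := isTwoFactor_of_reflTransGen
    (fun F F' hF h => StepU2.isTwoFactor hG hF h) hF₁ hU2
  have hm : IsCoverFrom G F₂ m := hF₂.isCoverFrom.reflTransGen hG hF₂ hU3
  have hcomp : ∀ v, (cls (support m).reachableSetoid v).card = (compVerts m v).ncard := fun v => by
    rw [card_cls_reachableSetoid]; rfl
  have hrel : ∀ x y, G.Adj x y → μ i x ≠ y → F₁.Reachable x y := fun x y hxy hne =>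
    h01 x y ((hF₀adj x y).2 ⟨hxy, hne⟩).reachable
  have hexits := fun W hW hcl => four_le_exits hM hsum hconv hμ i (W := W) hW hcl
  refine ⟨F₁.reachableSetoid, F₂.reachableSetoid, (support m).reachableSetoid,
    (hμ i).adj, (hμ i).mate_mate, hrel, h12, hm.coarse, fun v w => mem_compVerts, hexits,
    ?_, ?_, ?_, ?_, ?_, ?_⟩
  · intro a b c d e f h x hx y hy z hz
    exact reachable_of_not_stepU1 hU1' h hx hy hz
  · intro a b c d h x hx y hy
    exact reachable_of_not_stepU2 hU2' h hx hy
  · intro a b c d e h x hx y hy h5x h5y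
    rw [hcomp] at h5x h5y
    exact hm.reachable_of_not_stepU3 hG hF₂ hU3' h hx hy h5x h5y
  · intro v w hvw
    have hb := hm.bound v w (mem_compVerts.2 hvw)
    rw [hcomp, card_cls_reachableSetoid]
    have hpos : (0 : ℝ) < (compVerts m v).ncard := by
      have : 0 < (compVerts m v).ncard :=
        (Set.ncard_pos (Set.toFinite _)).2 ⟨v, mem_compVerts.2 (.refl _)⟩
      exact_mod_cast this
    rw [contribution, mul_assoc, mul_div_cancel₀ _ hpos.ne']
    have : (5 * numEdges (restrict m (compVerts m v)) + (componentSet F₂ w).ncard : ℝ) ≤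
      6 * (compVerts m v).ncard := by exact_mod_cast hb
    linarith
  · intro v
    rcases hm.unmerged_or_merged v with h | h
    · left
      ext w
      rw [mem_cls, mem_cls]
      have := Set.ext_iff.1 h.1 w
      rw [mem_compVerts, mem_componentSet] at this
      exact this
    · right
      rw [hcomp]
      refine ⟨h.1, fun w hw => ?_⟩
      rw [card_cls_reachableSetoid]
      exact h.2 w (mem_compVerts.2 hw)
  · intro v n hn hn456 hv
    rw [hcomp] at hn
    -- A merged component has at least ten vertices, so one with at most six is a cycle of `F₂`.
    rcases hm.unmerged_or_merged v with h | h
    swap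
    · omega
    obtain ⟨q, hq, hql, hqv, hqe⟩ := hF₂.exists_cycle v
    rw [h.1] at hn
    rw [hn] at hql
    refine ⟨v, q, hq, hql, ?_, by rw [h.1, hqv], ?_⟩
    · rcases hn456 with rfl | rfl | rfl
      · exact isChordless_of_length_four hq hql hv
      · refine isChordless_of_length_five hG (hμ i).adj hq hql fun W hW hWv => hexits W hW ?_
        intro x hx y hxy hne
        rw [hWv, hqv, mem_componentSet] at *
        exact hx.trans (h12 _ _ (hrel x y hxy hne))
      · exact hred v q hq hql
    · funext e
      induction e with | _ x y =>
      by_cases hxy : x ∈ compVerts m v ∧ y ∈ compVerts m v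
      · rw [restrict_eq_of_mem hxy.1 hxy.2, h.2 x y hxy.1 hxy.2]
        have hx := hxy.1
        rw [h.1] at hx
        have := hqe x y hx
        have h2 : s(x, y) ∈ walkEdges q ↔ s(x, y) ∈ F₂.edgeSet := this
        unfold ofSet
        by_cases h3 : s(x, y) ∈ F₂.edgeSet
        · rw [if_pos h3, if_pos (h2.2 h3)]
        · rw [if_neg h3, if_neg (h2.not.2 h3)]
      · classical
        rw [restrict_mk, if_neg hxy]
        have : s(x, y) ∉ walkEdges q := by
          intro hmem
          rw [h.1, ← hqv] at hxy
          exact hxy ⟨q.fst_mem_support_of_mem_edges hmem, q.snd_mem_support_of_mem_edges hmem⟩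
        simp [ofSet, this]

end LocalCovers
end CubicTour

namespace CubicTour
open SimpleGraph

/-! ### First consequences of the local properties -/

section Consequences

variable {V : Type*} [Fintype V] [DecidableEq V] {G : SimpleGraph V} {m : Sym2 V → ℕ} {μ : V → V}
  {s₁ s₂ s : Setoid V}

lemma length_le_card_cls {r : Setoid V} {v : V} {l : List V} (hl : l.Nodup)
    (h : ∀ x ∈ l, r v x) : l.length ≤ (cls r v).card := by
  rw [← List.toFinset_card_of_nodup hl]
  refine Finset.card_le_card fun x hx => ?_
  rw [mem_cls]
  exact h x (List.mem_toFinset.1 hx)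

omit [DecidableEq V] in
lemma cls_congr {r : Setoid V} {v w : V} (h : r v w) : cls r v = cls r w := by
  ext x
  rw [mem_cls, mem_cls]
  exact ⟨fun hx => r.trans (r.symm h) hx, fun hx => r.trans h hx⟩

omit [DecidableEq V] in
lemma cls_eq_iff {r : Setoid V} {v w : V} : cls r v = cls r w ↔ r v w :=
  ⟨fun h => by rw [← mem_cls, h, mem_cls], cls_congr⟩

lemma mem_of_card_cls_le {r : Setoid V} {v : V} {l : List V} (hl : l.Nodup)
    (h : ∀ x ∈ l, r v x) (hc : (cls r v).card ≤ l.length) {x : V} (hx : r v x) : x ∈ l := by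
  have h1 : l.toFinset = cls r v := by
    refine Finset.eq_of_subset_of_card_le (fun x hx => ?_) ?_
    · rw [mem_cls]; exact h x (List.mem_toFinset.1 hx)
    · rw [List.toFinset_card_of_nodup hl]; exact hc
  rw [← List.mem_toFinset, h1, mem_cls]
  exact hx

namespace LocalCover

lemma cls_subset (L : LocalCover G m μ s₁ s₂ s) (v : V) : cls s₂ v ⊆ cls s v := fun x hx => by
  rw [mem_cls] at *; exact L.le₂ _ _ hx

lemma mate_eq (L : LocalCover G m μ s₁ s₂ s) {x y : V} (h : μ x = y) : μ y = x := by
  rw [← h, L.mate_mate]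

/-- The three possibilities for the partner of a vertex. -/
lemma cases_nbrs (L : LocalCover G m μ s₁ s₂ s) {x p q r : V} (h : IsNbrs G x p q r) :
    (μ x = p ∧ μ p = x ∧ s₁ x q ∧ s₁ x r) ∨ (μ x = q ∧ μ q = x ∧ s₁ x p ∧ s₁ x r) ∨
      (μ x = r ∧ μ r = x ∧ s₁ x p ∧ s₁ x q) := by
  obtain ⟨hpq, hpr, hqr, hx⟩ := h
  have hp := (hx p).2 (by simp); have hq := (hx q).2 (by simp); have hr := (hx r).2 (by simp)
  rcases (hx _).1 (L.adj_mate x) with h | h | h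
  · exact .inl ⟨h, L.mate_eq h, L.rel₁ _ _ hq (h ▸ hpq), L.rel₁ _ _ hr (h ▸ hpr)⟩
  · exact .inr (.inl ⟨h, L.mate_eq h, L.rel₁ _ _ hp (h ▸ hpq.symm), L.rel₁ _ _ hr (h ▸ hqr)⟩)
  · exact .inr (.inr ⟨h, L.mate_eq h, L.rel₁ _ _ hp (h ▸ hpr.symm), L.rel₁ _ _ hq (h ▸ hqr.symm)⟩)

/-- Contrapositive of `exits`: the vertices of `l'` have their partners in `l`, so only the fewer
than four remaining vertices could be left along the matching. -/
lemma closed_false (L : LocalCover G m μ s₁ s₂ s) {l l' : List V} (hl : l.Nodup) (hl' : l'.Nodup)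
    (hsub : ∀ x ∈ l', x ∈ l ∧ μ x ∈ l) (hodd : Odd l.length) (hlen : l.length < l'.length + 4)
    (hcl : ∀ x ∈ l, ∀ y, G.Adj x y → μ x ≠ y → y ∈ l) : False := by
  have h := L.exits l.toFinset (by rwa [List.toFinset_card_of_nodup hl]) (by simpa using hcl)
  have hs : l.toFinset.filter (fun x => μ x ∉ l.toFinset) ⊆ l.toFinset \ l'.toFinset := by
    intro x hx
    simp only [Finset.mem_filter, List.mem_toFinset, Finset.mem_sdiff] at *
    exact ⟨hx.1, fun h => hx.2 (hsub x h).2⟩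
  have h2 := Finset.card_le_card hs
  rw [Finset.card_sdiff_of_subset, List.toFinset_card_of_nodup hl,
    List.toFinset_card_of_nodup hl'] at h2
  · omega
  · intro x hx
    rw [List.mem_toFinset] at *
    exact (hsub x hx).1

/-- A class of `s₂` is closed under non-matching edges. If it is odd, at least four of its vertices
have partners outside, and none of these is in `l`. -/
lemma length_add_four_le (L : LocalCover G m μ s₁ s₂ s) {v : V} {l : List V} (hl : l.Nodup)
    (h : ∀ x ∈ l, s₂ v x ∧ s₂ v (μ x)) (hodd : Odd (cls s₂ v).card) :
    l.length + 4 ≤ (cls s₂ v).card := by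
  by_contra! hlt
  refine L.closed_false (l := (cls s₂ v).toList) (l' := l) (Finset.nodup_toList _) hl ?_ ?_ ?_ ?_
  · simpa using h
  · rwa [Finset.length_toList]
  · rwa [Finset.length_toList]
  · simp only [Finset.mem_toList, mem_cls]
    intro x hx y hxy hne
    exact s₂.trans hx (L.le₁₂ _ _ (L.rel₁ _ _ hxy hne))

/-- The class contains `v` and its two neighbours along non-matching edges, and a class of three
vertices would be odd with fewer than four exits. -/
lemma four_le_card [DecidableRel G.Adj] (hG : G.IsRegularOfDegree 3)
    (L : LocalCover G m μ s₁ s₂ s) (v : V) : 4 ≤ (cls s₂ v).card := by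
  obtain ⟨a, b, c, hv⟩ := exists_isNbrs_self hG v
  have hva := ((hv.2.2.2 a).2 (by simp)).ne
  have hvb := ((hv.2.2.2 b).2 (by simp)).ne
  have hvc := ((hv.2.2.2 c).2 (by simp)).ne
  have h3 : 3 ≤ (cls s₂ v).card := by
    rcases L.cases_nbrs hv with ⟨-, -, h1, h2⟩ | ⟨-, -, h1, h2⟩ | ⟨-, -, h1, h2⟩
    · refine length_le_card_cls (l := [v, b, c]) ?_ ?_
      · simp [hvb, hvc, hv.2.2.1]
      · simp [L.le₁₂ _ _ h1, L.le₁₂ _ _ h2]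
    · refine length_le_card_cls (l := [v, a, c]) ?_ ?_
      · simp [hva, hvc, hv.2.1]
      · simp [L.le₁₂ _ _ h1, L.le₁₂ _ _ h2]
    · refine length_le_card_cls (l := [v, a, b]) ?_ ?_
      · simp [hva, hvb, hv.1]
      · simp [L.le₁₂ _ _ h1, L.le₁₂ _ _ h2]
  by_contra! hlt
  have h3' : (cls s₂ v).card = 3 := by omega
  have := L.length_add_four_le (v := v) (l := []) (by simp) (by simp) (by rw [h3']; decide)
  simp at this
  omega

/-- The general bound is (6h + 10 - t)/(5h). For t ≤ 10 it is non-increasing in h, and at the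
smallest value h = t it equals 1 + 2/t. -/
lemma contribution_le (L : LocalCover G m μ s₁ s₂ s) {v : V} {t : ℕ} (ht : 0 < t) (ht' : t ≤ 10)
    (hc : t ≤ (cls s₂ v).card) : contribution m v ≤ 1 + 2 / t := by
  have hb := L.bound v v (s.refl v)
  have hh := Finset.card_le_card (L.cls_subset v)
  have h1 : (t : ℝ) ≤ (cls s₂ v).card := by exact_mod_cast hc
  have h2 : ((cls s₂ v).card : ℝ) ≤ (cls s v).card := by exact_mod_cast hh
  have h3 : (0 : ℝ) < t := by exact_mod_cast ht
  have h4 : (t : ℝ) ≤ 10 := by exact_mod_cast ht'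
  have h5 : (0 : ℝ) < (cls s v).card := by linarith
  have h6 : contribution m v ≤ (6 * (cls s v).card + 10 - t) / (5 * (cls s v).card) := by
    rw [le_div_iff₀ (by positivity)]; nlinarith
  refine h6.trans ?_
  rw [div_le_iff₀ (by positivity)]
  have h7 : 1 + 2 / (t : ℝ) = (t + 2) / t := by field_simp
  rw [h7, div_mul_eq_mul_div, le_div_iff₀ h3]
  nlinarith [mul_nonneg (sub_nonneg.2 (h1.trans h2)) (sub_nonneg.2 h4)]

lemma contribution_le_of_rel (L : LocalCover G m μ s₁ s₂ s) {v w : V} (hvw : s v w) {h t : ℕ}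
    (hh : h ≤ (cls s v).card) (ht : t ≤ (cls s₂ w).card) (ht10 : t ≤ 10) (hpos : 0 < h) :
    contribution m v ≤ 6 / 5 + (10 - t) / (5 * h) := by
  have hb := L.bound v w hvw
  have h1 : (t : ℝ) ≤ (cls s₂ w).card := by exact_mod_cast ht
  have h2 : (h : ℝ) ≤ (cls s v).card := by exact_mod_cast hh
  have h3 : (0 : ℝ) < h := by exact_mod_cast hpos
  have h4 : (t : ℝ) ≤ 10 := by exact_mod_cast ht10
  have h5 : (0 : ℝ) < (cls s v).card := by linarith
  have h6 : contribution m v ≤ 6 / 5 + (10 - t) / (5 * (cls s v).card) := by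
    rw [← sub_le_iff_le_add', le_div_iff₀ (by positivity)]; nlinarith
  refine h6.trans ?_
  have : (10 - t : ℝ) / (5 * (cls s v).card) ≤ (10 - t) / (5 * h) := by
    apply div_le_div_of_nonneg_left <;> nlinarith
  linarith

/-- Merging leaves h ≥ 10 vertices and cycles with t ≥ 5 vertices: 6/5 + (10 - 5)/(5 · 10) = 13/10.
-/
lemma contribution_le_of_merged (L : LocalCover G m μ s₁ s₂ s) {v : V}
    (h : cls s v ≠ cls s₂ v) : contribution m v ≤ 13 / 10 := by
  have h' := (L.unmerged_or_merged v).resolve_left h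
  have := L.contribution_le_of_rel (s.refl v) h'.1 (h'.2 v (s.refl v)) (by norm_num) (by norm_num)
  norm_num at this
  linarith

end LocalCover

end Consequences
end CubicTour

namespace CubicTour
open SimpleGraph

/-! ### Averages -/

section Average

variable {V : Type*} [Fintype V] [DecidableEq V] {G : SimpleGraph V}

omit [Fintype V] [DecidableEq V] in
lemma IsNbrs.ne {v a b c : V} (h : IsNbrs G v a b c) : v ≠ a ∧ v ≠ b ∧ v ≠ c :=
  ⟨((h.2.2.2 a).2 (by simp)).ne, ((h.2.2.2 b).2 (by simp)).ne, ((h.2.2.2 c).2 (by simp)).ne⟩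

omit [DecidableEq V] in
lemma exists_isNbrs_of_adj [DecidableRel G.Adj] (hG : G.IsRegularOfDegree 3) {v a : V}
    (h : G.Adj v a) : ∃ b c, IsNbrs G v a b c := by
  obtain ⟨x, y, z, hv⟩ := exists_isNbrs_self hG v
  have := (hv.2.2.2 a).1 h
  simp only [IsNbrs] at *
  rcases this with rfl | rfl | rfl
  · exact ⟨_, _, hv⟩
  · exact ⟨x, z, by grind⟩
  · exact ⟨x, y, by grind⟩

omit [Fintype V] in
-- The averaging principle: each indicator of a matching edge has mean 1/3. An entry of `l` is a
-- coefficient together with the two ends of an edge.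
lemma sum_mul_le_of_forall_le {k : ℕ} {lam : Fin k → ℝ} {μ : Fin k → V → V}
    (hpos : ∀ i, 0 < lam i) (hsum : ∑ i, lam i = 1)
    (hprob : ∀ u w, G.Adj u w → ∑ i, lam i * (if μ i u = w then (1 : ℝ) else 0) = 1 / 3)
    (l : List (ℝ × V × V)) (hl : ∀ t ∈ l, G.Adj t.2.1 t.2.2) {α : ℝ} {g : Fin k → ℝ}
    (hg : ∀ i, g i ≤ α + (l.map fun t => t.1 * (if μ i t.2.1 = t.2.2 then (1 : ℝ) else 0)).sum) :
    ∑ i, lam i * g i ≤ α + (l.map fun t => t.1).sum / 3 := by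
  have h1 : ∑ i, lam i * g i ≤ ∑ i, lam i * (α +
      (l.map fun t => t.1 * (if μ i t.2.1 = t.2.2 then (1 : ℝ) else 0)).sum) :=
    Finset.sum_le_sum fun i _ => mul_le_mul_of_nonneg_left (hg i) (hpos i).le
  refine h1.trans (le_of_eq ?_)
  clear h1 hg
  simp only [mul_add, Finset.sum_add_distrib, ← Finset.sum_mul, hsum, one_mul]
  congr 1
  induction l with
  | nil => simp
  | cons t l ih =>
    simp only [List.map_cons, List.sum_cons, mul_add, Finset.sum_add_distrib]
    rw [ih fun t ht => hl t (List.mem_cons_of_mem _ ht)]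
    have h2 := hprob _ _ (hl t List.mem_cons_self)
    have h3 : ∑ i, lam i * (t.1 * (if μ i t.2.1 = t.2.2 then (1 : ℝ) else 0)) = t.1 * (1 / 3) := by
      rw [← h2, Finset.mul_sum]
      exact Finset.sum_congr rfl fun i _ => by ring
    rw [h3]; ring

omit [DecidableEq V] in
lemma exists_adj_not_mem (hG : G.Connected) {l : List V} {a : V} (ha : a ∈ l)
    (hl : l.length < Fintype.card V) : ∃ x ∈ l, ∃ y, y ∉ l ∧ G.Adj x y := by
  classical
  by_contra! hcl
  have hall : ∀ y, y ∈ l := by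
    intro y
    obtain ⟨p⟩ := hG.preconnected a y
    induction p with
    | nil => exact ha
    | cons h p ih => exact ih (by by_contra hn; exact hcl _ ha _ hn h)
  have : Fintype.card V ≤ l.length := by
    rw [← Finset.card_univ]
    calc _ ≤ l.toFinset.card := Finset.card_le_card fun x _ => List.mem_toFinset.2 (hall x)
      _ ≤ _ := l.toFinset_card_le
  omega

end Average

/-! ### Chorded 4-cycles -/

section Chorded

variable {V : Type*} [Fintype V] [DecidableEq V] {G : SimpleGraph V}

/-- A 4-cycle `a b c d` with chord `b d`, together with the remaining neighbours of `a`, `c`. -/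
def IsKite (G : SimpleGraph V) (a b c d a' c' : V) : Prop :=
  IsNbrs G a b d a' ∧ IsNbrs G b a c d ∧ IsNbrs G c b d c' ∧ IsNbrs G d a b c ∧ a ≠ c

omit [DecidableEq V] in
lemma IsChordedFourCycle.exists_isKite [DecidableRel G.Adj] (hG : G.IsRegularOfDegree 3)
    {D : Set V} (hD : IsChordedFourCycle G D) :
    ∃ a b c d a' c', IsKite G a b c d a' c' ∧ D = {a, b, c, d} := by
  obtain ⟨a, b, c, d, ⟨hn, hab, hbc, hcd, hda⟩, hbd, rfl⟩ := hD.exists_isCyc4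
  simp only [List.nodup_cons, List.mem_cons, List.not_mem_nil, not_or, or_false] at hn
  obtain ⟨⟨nab, nac, nad⟩, ⟨nbc, nbd⟩, ncd, -⟩ := hn
  obtain ⟨a', ha⟩ := exists_isNbrs hG hab hda.symm nbd
  obtain ⟨c', hc⟩ := exists_isNbrs hG hbc.symm hcd nbd
  obtain ⟨x, hb⟩ := exists_isNbrs hG hab.symm hbc nac
  obtain ⟨y, hd⟩ := exists_isNbrs hG hda hbd.symm nab
  have h1 : x = d := by have := (hb.2.2.2 d).1 hbd; grind
  have h2 : y = c := by have := (hd.2.2.2 c).1 hcd.symm; grind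
  subst h1 h2
  exact ⟨_, _, _, _, a', c', ⟨ha, hb, hc, hd, nac⟩, rfl⟩

variable {a b c d a' c' : V}

omit [Fintype V] [DecidableEq V] in
lemma IsKite.reflect (h : IsKite G a b c d a' c') : IsKite G c b a d c' a' := by
  obtain ⟨h1, h2, h3, h4, h5⟩ := h
  refine ⟨h3, ?_, h1, ?_, h5.symm⟩ <;> (simp only [IsNbrs] at *; grind)

omit [Fintype V] [DecidableEq V] in
lemma IsKite.isCyc4 (h : IsKite G a b c d a' c') : IsCyc4 G a b c d := by
  obtain ⟨h1, h2, h3, h4, h5⟩ := h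
  simp only [IsNbrs, IsCyc4] at *
  have := fun x y => G.adj_comm x y
  have := fun x => G.loopless.irrefl x
  simp
  grind

omit [DecidableEq V] in
-- Otherwise the four vertices form a K₄, which is a whole component of a cubic graph.
lemma IsKite.not_adj (h : IsKite G a b c d a' c') (hG : G.Connected) (h10 : 10 ≤ Fintype.card V) :
    ¬ G.Adj a c := by
  intro hac
  obtain ⟨x, hx, y, hy, hxy⟩ := exists_adj_not_mem hG (l := [a, b, c, d]) (a := a) (by simp)
    (by simp; omega)
  obtain ⟨h1, h2, h3, h4, h5⟩ := h
  simp only [IsNbrs, List.mem_cons, List.not_mem_nil, or_false, not_or] at *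
  have := G.adj_comm a c
  grind

end Chorded
end CubicTour

namespace CubicTour
open SimpleGraph

/-! ### Local bounds at chorded 4-cycles -/

section ChordedBounds

variable {V : Type*} [Fintype V] [DecidableEq V] {G : SimpleGraph V} {m : Sym2 V → ℕ} {μ : V → V}
  {s₁ s₂ s : Setoid V} {a b c d a' c' : V}

/-- If `a` is matched inside the kite, to `b` or `d`, the other one of these can only be matched to
`c`. So the class leaves the kite at both ends, and by (U2) the kite is in one class. -/
lemma LocalCover.kite (L : LocalCover G m μ s₁ s₂ s) (h : IsKite G a b c d a' c')
    (hμ : μ a ≠ a') :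
    μ c ≠ c' ∧ s₂ a a' ∧ s₂ a c' ∧ (∀ x ∈ [a, b, c, d], s₂ a x ∧ μ x ∈ [a, b, c, d]) := by
  have hsq := L.square _ _ _ _ h.isCyc4 a (by simp)
  obtain ⟨h1, h2, h3, h4, h5⟩ := h
  have ea := L.cases_nbrs h1
  have eb := L.cases_nbrs h2
  have ec := L.cases_nbrs h3
  have ed := L.cases_nbrs h4
  simp only [IsNbrs] at h1 h2 h3 h4
  have ha' : s₁ a a' := by grind
  have hc : μ c ≠ c' ∧ s₁ c c' := by grind
  refine ⟨hc.1, L.le₁₂ _ _ ha', s₂.trans (hsq c (by simp)) (L.le₁₂ _ _ hc.2), fun x hx => ⟨hsq x hx, ?_⟩⟩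
  simp only [List.mem_cons, List.not_mem_nil, or_false] at hx ⊢
  grind

/-- Otherwise the kite together with `a'` is a closed set of five vertices, four of which are
matched inside it. -/
lemma LocalCover.kite_ne [DecidableRel G.Adj] (hG3 : G.IsRegularOfDegree 3)
    (L : LocalCover G m μ s₁ s₂ s) (h : IsKite G a b c d a' c')
    (hG : G.Connected) (h10 : 10 ≤ Fintype.card V) (hμ : μ a ≠ a') : a' ≠ c' := by
  rintro rfl
  obtain ⟨h1, h2, h3, h4⟩ := L.kite h hμ
  have hac := h.not_adj hG h10
  obtain ⟨n1, n2, n3, n4, n5⟩ := h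
  have hn : [a, b, c, d, a'].Nodup := by
    have := n1.ne
    have := n2.ne
    have := n3.ne
    have := n4.ne
    simp only [IsNbrs] at n1 n2 n3 n4
    simp only [List.nodup_cons, List.mem_cons, List.not_mem_nil, not_or, or_false]
    grind
  have hn' := hn
  simp only [List.nodup_cons, List.mem_cons, List.not_mem_nil, not_or, or_false] at hn'
  refine L.closed_false (l := [a, b, c, d, a']) (l' := [a, b, c, d]) hn (by simp; grind) ?_
    (by simp; decide) (by simp) ?_
  · intro x hx
    have := (h4 x hx).2
    simp at hx this ⊢
    grind
  · obtain ⟨x, hx⟩ := exists_isNbrs hG3 ((n1.2.2.2 a').2 (by simp)).symm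
      ((n3.2.2.2 a').2 (by simp)).symm n5
    have h5 := L.cases_nbrs hx
    have h6 := fun x hx => (h4 x hx).2
    simp only [IsNbrs, List.mem_cons, List.not_mem_nil, or_false] at n1 n2 n3 n4 hx h6 ⊢
    grind

/-- The class contains the kite, `a'`, `c'` and a further neighbour of `a'`, since an edge `a'c'`
would close a 6-cycle with chord `ad`. Exactly seven vertices are impossible: an odd class in which
four vertices are matched inside has at least eight. -/
lemma LocalCover.eight_le_of_kite [DecidableRel G.Adj] (hG3 : G.IsRegularOfDegree 3)
    (hred : IsReduced G) (L : LocalCover G m μ s₁ s₂ s) (h : IsKite G a b c d a' c')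
    (hG : G.Connected) (h10 : 10 ≤ Fintype.card V) (hμ : μ a ≠ a') : 8 ≤ (cls s₂ a).card := by
  have hne := L.kite_ne hG3 h hG h10 hμ
  obtain ⟨h1, h2, h3, h4⟩ := L.kite h hμ
  have hac := h.not_adj hG h10
  obtain ⟨n1, n2, n3, n4, n5⟩ := h
  have e1 := n1.ne
  have e2 := n2.ne
  have e3 := n3.ne
  have e4 := n4.ne
  have e5 : a' ≠ c := fun h => hac (h ▸ (n1.2.2.2 a').2 (by simp))
  have e6 : c' ≠ a := fun h => hac (h ▸ (n3.2.2.2 c').2 (by simp)).symm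
  have hn : [a', a, b, d, c, c'].Nodup := by
    simp only [IsNbrs] at n1 n2 n3 n4
    simp only [List.nodup_cons, List.mem_cons, List.not_mem_nil, not_or, or_false]
    grind
  have hnadj : ¬ G.Adj a' c' := by
    intro hadj
    refine (hred.not_adj (a := a) (b := b) (c := d) (d := c) (e := c') (f := a') ?_).1
      ((n1.2.2.2 d).2 (by simp))
    refine ⟨by simp at hn ⊢; grind, (n1.2.2.2 b).2 (by simp), (n2.2.2.2 d).2 (by simp),
      (n4.2.2.2 c).2 (by simp), (n3.2.2.2 c').2 (by simp), hadj.symm,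
      ((n1.2.2.2 a').2 (by simp)).symm⟩
  obtain ⟨p, q, hp⟩ := exists_isNbrs_of_adj hG3 ((n1.2.2.2 a').2 (by simp)).symm
  obtain ⟨x, hx, hxn⟩ : ∃ x, s₂ a x ∧ x ∉ [a', a, b, d, c, c'] := by
    have ep := hp.ne
    have hc := L.cases_nbrs hp
    have key : ∀ x, G.Adj a' x → x ∉ [a', a, b, d, c, c'] ∨ x = a := by
      intro x hx
      have := G.adj_comm a' x
      simp only [IsNbrs] at n1 n2 n3 n4
      simp only [List.mem_cons, List.not_mem_nil, not_or, or_false]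
      by_contra hcon
      have := hx.ne
      grind
    have kp := key p ((hp.2.2.2 p).2 (by simp))
    have kq := key q ((hp.2.2.2 q).2 (by simp))
    rcases hc with ⟨-, h, -⟩ | ⟨-, -, -, h⟩ | ⟨-, -, -, h⟩
    · exact absurd h hμ
    · exact ⟨q, s₂.trans h2 (L.le₁₂ _ _ h), kq.resolve_right hp.2.1.symm⟩
    · exact ⟨p, s₂.trans h2 (L.le₁₂ _ _ h), kp.resolve_right hp.1.symm⟩
  have h7 := length_le_card_cls (r := s₂) (v := a) (l := x :: [a', a, b, d, c, c'])
    (List.nodup_cons.2 ⟨hxn, hn⟩) (by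
      simp [hx, h2, h3, (h4 b (by simp)).1, (h4 c (by simp)).1, (h4 d (by simp)).1])
  have h8 := L.length_add_four_le (v := a) (l := [a, b, c, d])
    (by simp at hn ⊢; grind) (fun y hy => ⟨(h4 y hy).1, (h4 _ (h4 y hy).2).1⟩)
  simp at h7 h8
  grind

omit [Fintype V] [DecidableEq V] in
lemma IsKite.adj (h : IsKite G a b c d a' c') :
    (G.Adj a b ∧ G.Adj a d ∧ G.Adj a a' ∧ G.Adj b a ∧ G.Adj d a ∧ G.Adj a' a) ∧
    (G.Adj b c ∧ G.Adj b d ∧ G.Adj c b ∧ G.Adj d b) ∧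
    G.Adj c d ∧ G.Adj c c' ∧ G.Adj d c ∧ G.Adj c' c := by
  obtain ⟨n1, n2, n3, n4, n5⟩ := h
  have := G.adj_comm a a'
  have := G.adj_comm c c'
  simp only [IsNbrs] at n1 n2 n3 n4
  grind

omit [DecidableEq V] in
lemma IsKite.nodup_of_kites {p q r t r' : V} (h : IsKite G a b c d p c')
    (h' : IsKite G p q r t a r') (hG : G.Connected) (h10 : 10 ≤ Fintype.card V) :
    [a, b, c, d, p, q, r, t].Nodup ∧ c' ∉ [a, b, c, d, p, q, r, t] ∧
      r' ∉ [a, b, c, d, p, q, r, t] := by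
  have hac := h.not_adj hG h10
  have hpr := h'.not_adj hG h10
  have ad := h.adj
  have ad' := h'.adj
  obtain ⟨n1, n2, n3, n4, n5⟩ := h
  obtain ⟨n1', n2', n3', n4', n5'⟩ := h'
  have e1 := n1.ne
  have e2 := n2.ne
  have e3 := n3.ne
  have e4 := n4.ne
  have e1' := n1'.ne
  have e2' := n2'.ne
  have e3' := n3'.ne
  have e4' := n4'.ne
  simp only [IsNbrs] at n1 n2 n3 n4 n1' n2' n3' n4'
  have hpc : p ≠ c := by grind
  have har : a ≠ r := by grind
  have hq : q ≠ b ∧ q ≠ c ∧ q ≠ d := by grind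
  have ht : t ≠ b ∧ t ≠ c ∧ t ≠ d := by grind
  have hr : r ≠ b ∧ r ≠ c ∧ r ≠ d := by grind
  have hn : [a, b, c, d, p, q, r, t].Nodup := by
    simp only [List.nodup_cons, List.mem_cons, List.not_mem_nil, not_or, or_false]
    grind
  -- If `c` and `r` were adjacent, the two kites would form a component with eight vertices.
  have hcr' : c' ≠ r := by
    intro hc
    obtain ⟨x, hx, y, hy, hxy⟩ := exists_adj_not_mem hG (l := [a, b, c, d, p, q, r, t]) (a := a)
      (by simp) (by simp; omega)
    simp only [List.mem_cons, List.not_mem_nil, or_false, not_or] at hx hy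
    grind
  simp only [List.mem_cons, List.not_mem_nil, not_or, or_false]
  exact ⟨hn, by grind, by grind⟩

/-- If an exit edge of a kite leads to another kite, then a class leaving the first kite along
that edge contains both kites. -/
lemma LocalCover.ten_le_of_kites [DecidableRel G.Adj] (hG3 : G.IsRegularOfDegree 3)
    (L : LocalCover G m μ s₁ s₂ s) {p q r t r' : V} (h : IsKite G a b c d p c')
    (h' : IsKite G p q r t a r')
    (hG : G.Connected) (h10 : 10 ≤ Fintype.card V) (hμ : μ a ≠ p) : 10 ≤ (cls s₂ a).card := by
  obtain ⟨hn, hc', hr'⟩ := h.nodup_of_kites h' hG h10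
  have hμ' : μ p ≠ a := fun h => hμ (L.mate_eq h)
  obtain ⟨h1, h2, h3, h4⟩ := L.kite h hμ
  obtain ⟨h1', h2', h3', h4'⟩ := L.kite h' hμ'
  have hall : ∀ x ∈ [a, b, c, d, p, q, r, t], s₂ a x ∧ μ x ∈ [a, b, c, d, p, q, r, t] := by
    intro x hx
    change x ∈ [a, b, c, d] ++ [p, q, r, t] at hx
    change _ ∧ μ x ∈ [a, b, c, d] ++ [p, q, r, t]
    rcases List.mem_append.1 hx with hx | hx
    · exact ⟨(h4 x hx).1, List.mem_append_left _ (h4 x hx).2⟩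
    · exact ⟨s₂.trans h2 (h4' x hx).1, List.mem_append_right _ (h4' x hx).2⟩
  -- Otherwise the two kites and `c'` form a closed set of nine vertices, eight of which are matched
  -- inside it.
  have hne : c' ≠ r' := by
    rintro rfl
    obtain ⟨n1, n2, n3, n4, -⟩ := h
    obtain ⟨n1', n2', n3', n4', -⟩ := h'
    have hcr : c ≠ r := by simp at hn; grind
    obtain ⟨x, hx⟩ := exists_isNbrs hG3 ((n3.2.2.2 c').2 (by simp)).symm
      ((n3'.2.2.2 c').2 (by simp)).symm hcr
    have h5 : ∀ y, G.Adj c' y → μ c' ≠ y → y = c ∨ y = r := by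
      have := (hx.2.2.2 _).1 (L.adj_mate c')
      have hc1 : μ c' ≠ c := fun h => h1 (L.mate_eq h)
      have hc2 : μ c' ≠ r := fun h => h1' (L.mate_eq h)
      intro y hy
      have := (hx.2.2.2 _).1 hy
      grind
    refine L.closed_false (l := c' :: [a, b, c, d, p, q, r, t]) (l' := [a, b, c, d, p, q, r, t])
      (List.nodup_cons.2 ⟨hc', hn⟩) hn ?_ (by simp; decide) (by simp) ?_
    · exact fun x hx => ⟨List.mem_cons_of_mem _ hx, List.mem_cons_of_mem _ (hall x hx).2⟩
    · clear hall h4 h4' hc' hr' hn h1 h1' h2 h2' h3 h3'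
      intro x hx y hxy hy
      simp only [List.mem_cons, List.not_mem_nil, or_false] at hx ⊢
      simp only [IsNbrs] at n1 n2 n3 n4 n1' n2' n3' n4'
      grind
  refine length_le_card_cls (l := r' :: c' :: [a, b, c, d, p, q, r, t])
    (List.nodup_cons.2 ⟨?_, List.nodup_cons.2 ⟨hc', hn⟩⟩) ?_
  · simpa [hne.symm] using hr'
  · intro x hx
    rcases List.mem_cons.1 hx with rfl | hx
    · exact s₂.trans h2 h3'
    rcases List.mem_cons.1 hx with rfl | hx
    · exact h3
    exact (hall x hx).1

end ChordedBounds
end CubicTour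

namespace CubicTour
open SimpleGraph

/-! ### Vertices of chorded 4-cycles -/

section ChordedAverages

variable {V : Type*} {G : SimpleGraph V}

/-- Each vertex has at least two of its three edges inside a kite containing it. So kites with a
common vertex share an edge there, and this spreads to all four vertices. -/
lemma IsKite.subset {a b c d a' c' p q r t p' r' : V} (h : IsKite G a b c d a' c')
    (h' : IsKite G p q r t p' r') {x : V} (hx : x ∈ ({a, b, c, d} : Set V))
    (hx' : x ∈ ({p, q, r, t} : Set V)) : ({a, b, c, d} : Set V) ⊆ {p, q, r, t} := by
  have ad := h.adj
  have ad' := h'.adj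
  obtain ⟨n1, n2, n3, n4, n5⟩ := h
  obtain ⟨n1', n2', n3', n4', n5'⟩ := h'
  simp only [Set.mem_insert_iff, Set.mem_singleton_iff, Set.insert_subset_iff,
    Set.singleton_subset_iff] at *
  have e1' := n1'.ne
  have e2' := n2'.ne
  have e3' := n3'.ne
  have e4' := n4'.ne
  simp only [IsNbrs] at n1 n2 n3 n4 n1' n2' n3' n4'
  have h1 : (b = p ∨ b = q ∨ b = r ∨ b = t) ∨ (d = p ∨ d = q ∨ d = r ∨ d = t) := by grind
  have h2 : (d = p ∨ d = q ∨ d = r ∨ d = t) := by grind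
  have h3 : (b = p ∨ b = q ∨ b = r ∨ b = t) := by grind
  have h4 : (a = p ∨ a = q ∨ a = r ∨ a = t) := by grind
  have h5 : (c = p ∨ c = q ∨ c = r ∨ c = t) := by grind
  exact ⟨h4, h3, h5, h2⟩

lemma IsKite.exists_of_exit {a b c d a' c' u x : V} (h : IsKite G a b c d a' c')
    (hu : u ∈ ({a, b, c, d} : Set V)) (hx : x ∉ ({a, b, c, d} : Set V)) (hux : G.Adj u x) :
    ∃ b' c' d' e, IsKite G u b' c' d' x e ∧ ({a, b, c, d} : Set V) = {u, b', c', d'} := by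
  have h' := h
  obtain ⟨n1, n2, n3, n4, n5⟩ := h'
  simp only [Set.mem_insert_iff, Set.mem_singleton_iff, not_or] at hu hx
  simp only [IsNbrs] at n1 n2 n3 n4
  have h1 : u = a ∧ x = a' ∨ u = c ∧ x = c' := by grind
  rcases h1 with ⟨rfl, rfl⟩ | ⟨rfl, rfl⟩
  · exact ⟨_, _, _, _, h, rfl⟩
  · refine ⟨_, _, _, _, h.reflect, ?_⟩
    ext y; simp only [Set.mem_insert_iff, Set.mem_singleton_iff]; tauto

/-- A non-isolated chorded 4-cycle is joined by an edge to another one. -/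
lemma exists_isKite_pair [Fintype V] [DecidableRel G.Adj] (hG : G.IsRegularOfDegree 3) {D : Set V}
    (hD : IsChordedFourCycle G D) (hi : ¬ IsIsolated G D) :
    ∃ a b c d p c' q r t r', IsKite G a b c d p c' ∧ IsKite G p q r t a r' ∧ D = {a, b, c, d} := by
  obtain ⟨a, b, c, d, a', c', h, rfl⟩ := hD.exists_isKite hG
  unfold IsIsolated at hi
  push Not at hi
  obtain ⟨e, ⟨he, u, hu, w, hw, rfl⟩, D', hD', hne, x, hxe, hx⟩ := hi
  obtain ⟨p, q, r, t, p', r', h', rfl⟩ := hD'.exists_isKite hG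
  have hxD : x ∉ ({a, b, c, d} : Set V) := fun hc =>
    hne (subset_antisymm (h'.subset h hx hc) (h.subset h' hc hx))
  have hxw : x = w := (Sym2.mem_iff.1 hxe).resolve_left fun h => hxD (h ▸ hu)
  subst hxw
  have huD : u ∉ ({p, q, r, t} : Set V) := fun hc =>
    hne (subset_antisymm (h'.subset h hc hu) (h.subset h' hu hc))
  have hux : G.Adj u x := he
  obtain ⟨_, _, _, _, k, hk⟩ := h.exists_of_exit hu hw hux
  obtain ⟨_, _, _, _, k', -⟩ := h'.exists_of_exit hx huD hux.symm
  exact ⟨_, _, _, _, _, _, _, _, _, _, k, k', hk⟩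

end ChordedAverages

/-! ### Averages over the cover family, and vertices of chorded 4-cycles. -/

section Family

variable {V : Type*} [Fintype V] [DecidableEq V] {G : SimpleGraph V} [DecidableRel G.Adj]
  {k : ℕ} {lam : Fin k → ℝ} {Γ : Fin k → Sym2 V → ℕ} {μ : Fin k → V → V}

/-- A convex combination of covers with the local properties, together with the standing
assumptions on the graph. -/
structure CoverFamily (G : SimpleGraph V) [DecidableRel G.Adj] (lam : Fin k → ℝ)
    (Γ : Fin k → Sym2 V → ℕ) (μ : Fin k → V → V) : Prop where
  cubic : G.IsRegularOfDegree 3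
  conn : G.Connected
  reduced : IsReduced G
  card : 10 ≤ Fintype.card V
  pos : ∀ i, 0 < lam i
  sum : ∑ i, lam i = 1
  prob : ∀ u w, G.Adj u w → ∑ i, lam i * (if μ i u = w then (1 : ℝ) else 0) = 1 / 3
  localCover : ∀ i, ∃ s₁ s₂ s, LocalCover G (Γ i) (μ i) s₁ s₂ s

namespace CoverFamily

lemma avg_le (H : CoverFamily G lam Γ μ) {v : V} (l : List (ℝ × V × V))
    (hl : ∀ t ∈ l, G.Adj t.2.1 t.2.2) {α : ℝ}
    (h : ∀ i s₁ s₂ s, LocalCover G (Γ i) (μ i) s₁ s₂ s → contribution (Γ i) v ≤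
      α + (l.map fun t => t.1 * (if μ i t.2.1 = t.2.2 then (1 : ℝ) else 0)).sum) :
    avgContribution lam Γ v ≤ α + (l.map fun t => t.1).sum / 3 := by
  refine sum_mul_le_of_forall_le H.pos H.sum H.prob l hl fun i => ?_
  obtain ⟨s₁, s₂, s, L⟩ := H.localCover i
  exact h i s₁ s₂ s L

/-- A matching that contains `aa'` allows 1 + 2/4 = 3/2; every other one gives at most 1 + 2/8 =
5/4. The mean is at most 5/4 + (1/4)/3 = 4/3. -/
lemma avg_le_of_kite (H : CoverFamily G lam Γ μ) {a b c d a' c' v : V}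
    (h : IsKite G a b c d a' c') (hv : v ∈ ({a, b, c, d} : Set V)) :
    avgContribution lam Γ v ≤ 4 / 3 := by
  have := H.avg_le (v := v) (α := 5 / 4) [(1 / 4, a, a')]
    (by simpa using h.adj.1.2.2.1) fun i s₁ s₂ s L => ?_
  · norm_num at this ⊢; linarith
  by_cases hμ : μ i a = a'
  · have := L.contribution_le (by norm_num) (by norm_num) (L.four_le_card H.cubic v)
    norm_num [hμ] at this ⊢; linarith
  · have h8 := L.eight_le_of_kite H.cubic H.reduced h H.conn H.card hμ
    rw [cls_congr (L.square _ _ _ _ h.isCyc4 a (by simp) v (by simpa using hv))] at h8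
    have := L.contribution_le (by norm_num) (by norm_num) h8
    norm_num [hμ] at this ⊢; linarith

/-- As for one kite, with ten instead of eight vertices: 6/5 + (3/10)/3 = 13/10. -/
lemma avg_le_of_kites (H : CoverFamily G lam Γ μ) {a b c d p c' q r t r' v : V}
    (h : IsKite G a b c d p c') (h' : IsKite G p q r t a r') (hv : v ∈ ({a, b, c, d} : Set V)) :
    avgContribution lam Γ v ≤ 13 / 10 := by
  have := H.avg_le (v := v) (α := 6 / 5) [(3 / 10, a, p)]
    (by simpa using h.adj.1.2.2.1) fun i s₁ s₂ s L => ?_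
  · norm_num at this ⊢; linarith
  by_cases hμ : μ i a = p
  · have := L.contribution_le (by norm_num) (by norm_num) (L.four_le_card H.cubic v)
    norm_num [hμ] at this ⊢; linarith
  · have h8 := L.ten_le_of_kites H.cubic h h' H.conn H.card hμ
    rw [cls_congr (L.square _ _ _ _ h.isCyc4 a (by simp) v (by simpa using hv))] at h8
    have := L.contribution_le (by norm_num) (by norm_num) h8
    norm_num [hμ] at this ⊢; linarith

theorem avg_le_of_isChordedFourCycle (H : CoverFamily G lam Γ μ) {D : Set V}
    (hD : IsChordedFourCycle G D) {v : V} (hv : v ∈ D) : avgContribution lam Γ v ≤ 4 / 3 := by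
  obtain ⟨a, b, c, d, a', c', h, rfl⟩ := hD.exists_isKite H.cubic
  exact H.avg_le_of_kite h hv

theorem avg_le_of_not_isIsolated (H : CoverFamily G lam Γ μ) {D : Set V}
    (hD : IsChordedFourCycle G D) (hi : ¬ IsIsolated G D) {v : V} (hv : v ∈ D) :
    avgContribution lam Γ v ≤ 13 / 10 := by
  obtain ⟨a, b, c, d, p, c', q, r, t, r', h, h', rfl⟩ := exists_isKite_pair H.cubic hD hi
  exact H.avg_le_of_kites h h' hv

end CoverFamily

end Family
end CubicTour

namespace CubicTour
open SimpleGraph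

/-! ### Induced 4-cycles -/

section OpenSquare

variable {V : Type*} {G : SimpleGraph V} {a b c d a' b' c' d' : V}

/-- An induced 4-cycle `a b c d` whose vertices have distinct outer neighbours. -/
def IsOpenSquare (G : SimpleGraph V) (a b c d a' b' c' d' : V) : Prop :=
  IsNbrs G a b d a' ∧ IsNbrs G b a c b' ∧ IsNbrs G c b d c' ∧ IsNbrs G d a c d' ∧
    [a, b, c, d, a', b', c', d'].Nodup

lemma IsOpenSquare.rotate (h : IsOpenSquare G a b c d a' b' c' d') :
    IsOpenSquare G b c d a b' c' d' a' := by
  simp only [IsOpenSquare, List.nodup_cons, List.mem_cons, List.not_mem_nil, not_or, or_false] at *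
  simp only [IsNbrs] at *
  grind

lemma IsOpenSquare.adj (h : IsOpenSquare G a b c d a' b' c' d') :
    (G.Adj a b ∧ G.Adj a d ∧ G.Adj a a' ∧ G.Adj b a ∧ G.Adj b c ∧ G.Adj b b') ∧
    G.Adj c b ∧ G.Adj c d ∧ G.Adj c c' ∧ G.Adj d a ∧ G.Adj d c ∧ G.Adj d d' := by
  simp only [IsOpenSquare, IsNbrs] at h
  grind

lemma IsOpenSquare.isCyc4 (h : IsOpenSquare G a b c d a' b' c' d') : IsCyc4 G a b c d := by
  have := h.adj
  have hn := h.2.2.2.2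
  refine ⟨?_, by grind⟩
  simp only [List.nodup_cons, List.mem_cons, List.not_mem_nil, not_or, or_false] at hn ⊢
  grind

/-- The 6-cycle `a a' b' b c d` would have the chord `ab`. -/
lemma IsOpenSquare.not_adj (h : IsOpenSquare G a b c d a' b' c' d') (hred : IsReduced G) :
    ¬ G.Adj a' b' := by
  intro hab
  have ad := h.adj
  refine (hred.not_adj (a := a) (b := a') (c := b') (d := b) (e := c) (f := d) ?_).2 ad.1.1
  refine ⟨?_, ad.1.2.2.1, hab, ad.1.2.2.2.2.2.symm, ad.1.2.2.2.2.1, ad.2.2.1, ad.2.2.2.2.1⟩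
  have hn := h.2.2.2.2
  simp only [List.nodup_cons, List.mem_cons, List.not_mem_nil, not_or, or_false] at hn ⊢
  grind

end OpenSquare

section SquareBounds

variable {V : Type*} [Fintype V] [DecidableEq V] {G : SimpleGraph V} {m : Sym2 V → ℕ} {μ : V → V}
  {s₁ s₂ s : Setoid V} {a b c d a' b' c' d' : V}

/-- In the cover whose component is this 4-cycle, all four outgoing edges belong to the matching,
for a non-matching edge would carry the class further. Hence the outer neighbours are partners of
different vertices and are distinct. -/
lemma LocalCover.exists_isOpenSquare [DecidableRel G.Adj] (hG : G.IsRegularOfDegree 3)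
    (L : LocalCover G m μ s₁ s₂ s) {u v : V} {p : G.Walk u u} (hp : IsInducedCycleAt m 4 v p)
    (hv : ∀ D, IsChordedFourCycle G D → v ∉ D) :
    ∃ a b c d a' b' c' d', IsOpenSquare G a b c d a' b' c' d' ∧ v ∈ [a, b, c, d] := by
  obtain ⟨hcyc, hlen, -, hcomp, -⟩ := hp
  obtain ⟨b, c, d, h, hs, -⟩ := exists_isCyc4 hcyc hlen
  have hcls : ∀ w, s v w ↔ w ∈ [u, b, c, d] := by
    intro w
    rw [← L.mem_compVerts, hcomp]
    change w ∈ p.support ↔ _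
    rw [hs]
    simp only [List.mem_cons, List.not_mem_nil, or_false]
    tauto
  have hvm := (hcls v).1 (s.refl v)
  have hbd : ¬ G.Adj b d := fun hbd => hv _ (isChordedFourCycle_of_adj h hbd) (by simpa using hvm)
  have huc : ¬ G.Adj u c := fun huc => hv _ (isChordedFourCycle_of_adj h.rotate huc.symm)
    (by simp at hvm ⊢; tauto)
  obtain ⟨hn, h1, h2, h3, h4⟩ := h
  simp only [List.nodup_cons, List.mem_cons, List.not_mem_nil, not_or, or_false] at hn
  obtain ⟨a', n1⟩ := exists_isNbrs hG h1 h4.symm hn.2.1.2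
  obtain ⟨b', n2⟩ := exists_isNbrs hG h1.symm h2 hn.1.2.1
  obtain ⟨c', n3⟩ := exists_isNbrs hG h2.symm h3 hn.2.1.2
  obtain ⟨d', n4⟩ := exists_isNbrs hG h4 h3.symm hn.1.2.1
  have hrel : ∀ x y, s v x → G.Adj x y → μ x ≠ y → s v y := fun x y hx hxy hne =>
    s.trans hx (L.le₂ _ _ (L.le₁₂ _ _ (L.rel₁ _ _ hxy hne)))
  have m := L.mate_mate
  have hcls' : ∀ w, s v w ↔ w = u ∨ w = b ∨ w = c ∨ w = d := by simpa using hcls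
  have e1 := n1.ne
  have e2 := n2.ne
  have e3 := n3.ne
  have e4 := n4.ne
  simp only [hcls'] at hrel
  have hcu := G.adj_comm u c
  have hdb := G.adj_comm b d
  refine ⟨u, b, c, d, a', b', c', d', ⟨n1, n2, n3, n4, ?_⟩, hvm⟩
  simp only [IsNbrs] at n1 n2 n3 n4
  have ma : μ u = a' := by
    by_contra hne
    have := hrel u a' (by simp) ((n1.2.2.2 a').2 (by simp)) hne
    grind
  have mb : μ b = b' := by
    by_contra hne
    have := hrel b b' (by simp) ((n2.2.2.2 b').2 (by simp)) hne
    grind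
  have mc : μ c = c' := by
    by_contra hne
    have := hrel c c' (by simp) ((n3.2.2.2 c').2 (by simp)) hne
    grind
  have md : μ d = d' := by
    by_contra hne
    have := hrel d d' (by simp) ((n4.2.2.2 d').2 (by simp)) hne
    grind
  clear hrel hcls hcls' hvm
  simp only [List.nodup_cons, List.mem_cons, List.not_mem_nil, not_or, or_false]
  grind

namespace LocalCover

lemma rel_of_mem_square (L : LocalCover G m μ s₁ s₂ s) (h : IsOpenSquare G a b c d a' b' c' d')
    {v : V} (hv : v ∈ [a, b, c, d]) : s₂ a v :=
  L.square _ _ _ _ h.isCyc4 a (by simp) v hv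

lemma out_of_square (L : LocalCover G m μ s₁ s₂ s) (h : IsOpenSquare G a b c d a' b' c' d') :
    (μ a = a' ∨ s₁ a a') ∧ (μ b = b' ∨ s₁ b b') ∧ (μ c = c' ∨ s₁ c c') ∧ (μ d = d' ∨ s₁ d d') := by
  have ha := L.rel₁ a a' h.adj.1.2.2.1
  have hb := L.rel₁ b b' h.rotate.adj.1.2.2.1
  have hc := L.rel₁ c c' h.rotate.rotate.adj.1.2.2.1
  have hd := L.rel₁ d d' h.rotate.rotate.rotate.adj.1.2.2.1
  tauto

/-- Otherwise the three remaining vertices would be matched among themselves. -/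
lemma square_parity (L : LocalCover G m μ s₁ s₂ s) (h : IsOpenSquare G a b c d a' b' c' d')
    (ha : μ a = a') : μ b = b' ∨ μ c = c' ∨ μ d = d' := by
  obtain ⟨n1, n2, n3, n4, hn⟩ := h
  have h2 := L.cases_nbrs n2
  have h3 := L.cases_nbrs n3
  have h4 := L.cases_nbrs n4
  simp only [List.nodup_cons, List.mem_cons, List.not_mem_nil, not_or, or_false] at hn
  grind

/-- By parity not exactly one outgoing edge is outside the matching. So the class leaves the square
at `a` and at a second vertex. -/
lemma six_le_of_square (L : LocalCover G m μ s₁ s₂ s) (h : IsOpenSquare G a b c d a' b' c' d')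
    (ha : μ a ≠ a') : 6 ≤ (cls s₂ a).card := by
  have hsq := fun v hv => L.rel_of_mem_square h (v := v) hv
  have ho := L.out_of_square h
  have hp : μ b ≠ b' ∨ μ c ≠ c' ∨ μ d ≠ d' := by
    by_contra hc
    push Not at hc
    have h1 := L.cases_nbrs h.1
    have hn := h.2.2.2.2
    simp only [List.nodup_cons, List.mem_cons, List.not_mem_nil, not_or, or_false] at hn
    grind
  have hb := fun h => s₂.trans (hsq b (by simp)) (L.le₁₂ b b' h)
  have hc := fun h => s₂.trans (hsq c (by simp)) (L.le₁₂ c c' h)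
  have hd := fun h => s₂.trans (hsq d (by simp)) (L.le₁₂ d d' h)
  have ha' := L.le₁₂ a a' (by tauto)
  obtain ⟨x, hx, hax⟩ : ∃ x, (x = b' ∨ x = c' ∨ x = d') ∧ s₂ a x := by
    rcases hp with hp | hp | hp
    · exact ⟨b', by simp, hb (by tauto)⟩
    · exact ⟨c', by simp, hc (by tauto)⟩
    · exact ⟨d', by simp, hd (by tauto)⟩
  refine length_le_card_cls (l := [a, b, c, d, a', x]) ?_ ?_
  · have hn := h.2.2.2.2
    simp only [List.nodup_cons, List.mem_cons, List.not_mem_nil, not_or, or_false] at hn ⊢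
    grind
  · simp [hax, ha', hsq b, hsq c, hsq d]

lemma eight_rel_of_square (L : LocalCover G m μ s₁ s₂ s)
    (h : IsOpenSquare G a b c d a' b' c' d')
    (ha : μ a ≠ a') (hb : μ b ≠ b') (hc : μ c ≠ c') (hd : μ d ≠ d') :
    ∀ x ∈ [a, b, c, d, a', b', c', d'], s₂ a x := by
  have hsq := fun v hv => L.rel_of_mem_square h (v := v) hv
  have ho := L.out_of_square h
  have hb := s₂.trans (hsq b (by simp)) (L.le₁₂ b b' (by tauto))
  have hc := s₂.trans (hsq c (by simp)) (L.le₁₂ c c' (by tauto))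
  have hd := s₂.trans (hsq d (by simp)) (L.le₁₂ d d' (by tauto))
  have ha' := L.le₁₂ a a' (by tauto)
  simp [ha', hb, hc, hd, hsq b, hsq c, hsq d]

/-- A class containing an open square and its outer neighbours, in which `a'` has a further
neighbour. -/
lemma nine_le_of_square (L : LocalCover G m μ s₁ s₂ s) (hred : IsReduced G)
    (h : IsOpenSquare G a b c d a' b' c' d')
    (ha : μ a ≠ a') (hb : μ b ≠ b') (hc : μ c ≠ c') (hd : μ d ≠ d') {x : V} (hx : G.Adj a' x)
    (hμ : μ a' ≠ x) (hxa : x ≠ a) (hxc : x ≠ c') : 9 ≤ (cls s₂ a).card := by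
  have h8 := L.eight_rel_of_square h ha hb hc hd
  have nb := h.not_adj hred
  have nd := h.rotate.rotate.rotate.not_adj hred
  have hxx : s₂ a x := s₂.trans (h8 a' (by simp)) (L.le₁₂ _ _ (L.rel₁ _ _ hx hμ))
  refine length_le_card_cls (l := x :: [a, b, c, d, a', b', c', d'])
    (List.nodup_cons.2 ⟨?_, h.2.2.2.2⟩) ?_
  · obtain ⟨n1, n2, n3, n4, hn⟩ := h
    have := hx.symm
    have := hx.ne
    have := G.adj_comm d' a'
    simp only [List.nodup_cons, List.mem_cons, List.not_mem_nil, not_or, or_false] at hn ⊢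
    simp only [IsNbrs] at n1 n2 n3 n4
    grind
  · simpa [hxx] using h8

/-- Nine is odd, but `a, b, c, d, a', c'` are all matched inside the class, which then needs 6 + 4
vertices. -/
lemma ten_le_of_square (L : LocalCover G m μ s₁ s₂ s) (hred : IsReduced G)
    (h : IsOpenSquare G a b c d a' b' c' d')
    (ha : μ a ≠ a') (hb : μ b ≠ b') (hc : μ c ≠ c') (hd : μ d ≠ d') {x : V} (hx : G.Adj a' x)
    (hxa : x ≠ a) (hxc : x ≠ c') (hac : μ a' = c') : 10 ≤ (cls s₂ a).card := by
  have h9 := L.nine_le_of_square hred h ha hb hc hd hx (by rw [hac]; exact hxc.symm) hxa hxc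
  have h8 := L.eight_rel_of_square h ha hb hc hd
  by_contra! hlt
  have h9' : (cls s₂ a).card = 9 := by omega
  have hsub : ∀ y ∈ [a, b, c, d, a', c'], y ∈ [a, b, c, d, a', b', c', d'] ∧
      μ y ∈ [a, b, c, d, a', b', c', d'] := by
    obtain ⟨n1, n2, n3, n4, -⟩ := h
    have h1 := L.cases_nbrs n1
    have h2 := L.cases_nbrs n2
    have h3 := L.cases_nbrs n3
    have h4 := L.cases_nbrs n4
    have hca := L.mate_eq hac
    simp only [List.mem_cons, List.not_mem_nil, or_false, forall_eq_or_imp, forall_eq]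
    clear h8 hlt h9 h9'
    grind
  have := L.length_add_four_le (v := a) (l := [a, b, c, d, a', c'])
    (by
      have hn := h.2.2.2.2
      simp only [List.nodup_cons, List.mem_cons, List.not_mem_nil, not_or, or_false] at hn ⊢
      grind)
    (fun y hy => ⟨h8 _ (hsub y hy).1, h8 _ (hsub y hy).2⟩) (by rw [h9']; decide)
  simp at this
  omega

lemma contribution_le_of_square [DecidableRel G.Adj] (hG : G.IsRegularOfDegree 3)
    (L : LocalCover G m μ s₁ s₂ s) (h : IsOpenSquare G a b c d a' b' c' d') {v : V}
    (hv : v ∈ [a, b, c, d]) : contribution m v ≤ 3 / 2 ∧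
      (¬ (μ a = a' ∧ μ b = b' ∧ μ c = c' ∧ μ d = d') → contribution m v ≤ 4 / 3) := by
  have hcls := cls_congr (L.rel_of_mem_square h hv)
  have c4 := L.contribution_le (by norm_num) (by norm_num) (L.four_le_card hG v)
  have c6 : 6 ≤ (cls s₂ a).card → _ := fun h6 =>
    L.contribution_le (by norm_num) (by norm_num) (hcls ▸ h6)
  have h1 := L.six_le_of_square h
  have h2 := L.six_le_of_square h.rotate
  have h3 := L.six_le_of_square h.rotate.rotate
  have h4 := L.six_le_of_square h.rotate.rotate.rotate
  rw [← cls_congr (L.rel_of_mem_square h (v := b) (by simp))] at h2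
  rw [← cls_congr (L.rel_of_mem_square h (v := c) (by simp))] at h3
  rw [← cls_congr (L.rel_of_mem_square h (v := d) (by simp))] at h4
  norm_num at c4 c6
  exact ⟨c4, fun hno => c6 (by tauto)⟩

end LocalCover

lemma LocalCover.contribution_le_of_square_adj
    (L : LocalCover G m μ s₁ s₂ s) (hred : IsReduced G)
    (h : IsOpenSquare G a b c d a' b' c' d') {v x : V}
    (hv : v ∈ [a, b, c, d]) (hx : IsNbrs G a' a c' x) (ha : μ a ≠ a') (hb : μ b ≠ b')
    (hc : μ c ≠ c') (hd : μ d ≠ d') :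
    contribution m v ≤ 6 / 5 + 1 / 20 * (if μ a' = x then (1 : ℝ) else 0) := by
  have hcls := cls_congr (L.rel_of_mem_square h hv)
  split_ifs with hμx
  · have h8 := length_le_card_cls h.2.2.2.2 (L.eight_rel_of_square h ha hb hc hd)
    have := L.contribution_le (t := 8) (by norm_num) (by norm_num) (hcls ▸ h8)
    norm_num at this ⊢; linarith
  · have hac : μ a' = c' := by
      rcases L.cases_nbrs hx with h | h | h
      · exact absurd h.2.1 ha
      · exact h.1
      · exact absurd h.1 hμx
    have h10 := L.ten_le_of_square hred h ha hb hc hd ((hx.2.2.2 x).2 (by simp))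
      hx.2.1.symm hx.2.2.1.symm hac
    have := L.contribution_le (t := 10) (by norm_num) (by norm_num) (hcls ▸ h10)
    norm_num at this ⊢; linarith

omit [DecidableEq V] in
-- Applied with the partner of `y` as `w`: a non-matching edge at `y` other than `yz`, along which
-- the class of `y` continues.
lemma exists_adj_ne_ne [DecidableRel G.Adj] (hG : G.IsRegularOfDegree 3) {y z : V}
    (h : G.Adj y z) (w : V) : ∃ x, G.Adj y x ∧ w ≠ x ∧ x ≠ z := by
  obtain ⟨p, q, h1, h2, h3, hn⟩ := exists_isNbrs_of_adj hG h
  by_cases hp : w = p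
  · exact ⟨q, (hn q).2 (by simp), fun hq => h3 (hp.symm.trans hq), h2.symm⟩
  · exact ⟨p, (hn p).2 (by simp), hp, h1.symm⟩

end SquareBounds

/-! ### Averages at induced 4-cycles. -/

section SquareAverages

variable {V : Type*} [Fintype V] [DecidableEq V] {G : SimpleGraph V} [DecidableRel G.Adj]
  {k : ℕ} {lam : Fin k → ℝ} {Γ : Fin k → Sym2 V → ℕ} {μ : Fin k → V → V}
  {a b c d a' b' c' d' v : V}

namespace CoverFamily

/-- With 0, 2 or 4 outgoing edges in the matching the contribution is at most 11/9, 4/3 or 3/2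
(classes of 9, 6, 4 vertices). The weight 5/72 is exact for four, and the mean 71/54 is below 79/60.
-/
lemma avg_le_of_square_not_adj (H : CoverFamily G lam Γ μ)
    (h : IsOpenSquare G a b c d a' b' c' d') (hv : v ∈ [a, b, c, d]) (hac : ¬ G.Adj a' c') :
    avgContribution lam Γ v ≤ 4 / 3 - 1 / 60 := by
  have := H.avg_le (v := v) (α := 11 / 9) [(5 / 72, a, a'), (5 / 72, b, b'), (5 / 72, c, c'),
    (5 / 72, d, d')] (by simp [h.adj]) fun i s₁ s₂ s L => ?_
  · norm_num at this ⊢; linarith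
  have hcls := cls_congr (L.rel_of_mem_square h hv)
  obtain ⟨c4, c6⟩ := L.contribution_le_of_square H.cubic h hv
  have p1 := L.square_parity h
  have p2 := L.square_parity h.rotate
  have p3 := L.square_parity h.rotate.rotate
  have p4 := L.square_parity h.rotate.rotate.rotate
  have c9 : μ i a ≠ a' → μ i b ≠ b' → μ i c ≠ c' → μ i d ≠ d' → contribution (Γ i) v ≤ 11 / 9 := by
    intro ha hb hc hd
    obtain ⟨x, hx, hμx, hxa⟩ := exists_adj_ne_ne H.cubic h.adj.1.2.2.1.symm (μ i a')
    have h9 := L.nine_le_of_square H.reduced h ha hb hc hd hx hμx hxa (fun h => hac (h ▸ hx))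
    have := L.contribution_le (by norm_num) (by norm_num) (hcls ▸ h9)
    norm_num at this; linarith
  generalize contribution (Γ i) v = C at *
  clear * - c4 c6 c9 p1 p2 p3 p4
  by_cases ha : μ i a = a' <;> by_cases hb : μ i b = b' <;> by_cases hc : μ i c = c' <;>
    by_cases hd : μ i d = d' <;> simp [ha, hb, hc, hd] at * <;> linarith

/-- If no outgoing edge is in the matching, the bound is 6/5, or 5/4 when `a'` is matched to its
third neighbour `x`. The weights 3/40 are exact for four outgoing edges, and the mean is 6/5 + 7/60
= 4/3 - 1/60. -/
lemma avg_le_of_square_adj (H : CoverFamily G lam Γ μ)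
    (h : IsOpenSquare G a b c d a' b' c' d') (hv : v ∈ [a, b, c, d]) (hac : G.Adj a' c') :
    avgContribution lam Γ v ≤ 4 / 3 - 1 / 60 := by
  have hac' : a ≠ c' := by
    have hn := h.2.2.2.2
    simp only [List.nodup_cons, List.mem_cons, List.not_mem_nil, not_or, or_false] at hn
    grind
  obtain ⟨x, hx⟩ := exists_isNbrs H.cubic h.adj.1.2.2.1.symm hac hac'
  have := H.avg_le (v := v) (α := 6 / 5) [(3 / 40, a, a'), (3 / 40, b, b'), (3 / 40, c, c'),
    (3 / 40, d, d'), (1 / 20, a', x)] (by simp [h.adj, (hx.2.2.2 x).2]) fun i s₁ s₂ s L => ?_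
  · norm_num at this ⊢; linarith
  obtain ⟨c4, c6⟩ := L.contribution_le_of_square H.cubic h hv
  have p1 := L.square_parity h
  have p2 := L.square_parity h.rotate
  have p3 := L.square_parity h.rotate.rotate
  have p4 := L.square_parity h.rotate.rotate.rotate
  have c9 := L.contribution_le_of_square_adj H.reduced h hv hx
  have hnn : (0 : ℝ) ≤ if μ i a' = x then (1 : ℝ) else 0 := by split_ifs <;> norm_num
  simp only [List.map_cons, List.map_nil, List.sum_cons, List.sum_nil]
  generalize (if μ i a' = x then (1 : ℝ) else 0) = X at *
  generalize contribution (Γ i) v = C at *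
  clear * - c4 c6 c9 p1 p2 p3 p4 hnn
  by_cases ha : μ i a = a' <;> by_cases hb : μ i b = b' <;> by_cases hc : μ i c = c' <;>
    by_cases hd : μ i d = d' <;> simp [ha, hb, hc, hd] at * <;> linarith

theorem avg_le_of_hasInducedCycle_four (H : CoverFamily G lam Γ μ)
    (hv : ∀ D, IsChordedFourCycle G D → v ∉ D) (h : HasInducedCycle G Γ 4 v) :
    avgContribution lam Γ v ≤ 4 / 3 - 1 / 60 := by
  obtain ⟨i, u, p, hp⟩ := h
  obtain ⟨s₁, s₂, s, L⟩ := H.localCover i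
  obtain ⟨a, b, c, d, a', b', c', d', h, hvm⟩ := L.exists_isOpenSquare H.cubic hp hv
  by_cases hac : G.Adj a' c'
  · exact H.avg_le_of_square_adj h hvm hac
  · exact H.avg_le_of_square_not_adj h hvm hac

end CoverFamily

end SquareAverages
end CubicTour

namespace CubicTour
open SimpleGraph

/-! ### Induced 5-cycles -/

section OpenPentagon

variable {V : Type*} {G : SimpleGraph V} {a b c d e a' b' c' d' e' : V}

/-- An induced 5-cycle `a b c d e` whose vertices have distinct outer neighbours. -/
def IsOpenPentagon (G : SimpleGraph V) (a b c d e a' b' c' d' e' : V) : Prop :=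
  IsNbrs G a b e a' ∧ IsNbrs G b a c b' ∧ IsNbrs G c b d c' ∧ IsNbrs G d c e d' ∧
    IsNbrs G e d a e' ∧ [a, b, c, d, e, a', b', c', d', e'].Nodup

lemma IsOpenPentagon.rotate (h : IsOpenPentagon G a b c d e a' b' c' d' e') :
    IsOpenPentagon G b c d e a b' c' d' e' a' := by
  simp only [IsOpenPentagon, List.nodup_cons, List.mem_cons, List.not_mem_nil, not_or,
    or_false] at *
  simp only [IsNbrs] at *
  grind

lemma IsOpenPentagon.reflect (h : IsOpenPentagon G a b c d e a' b' c' d' e') :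
    IsOpenPentagon G a e d c b a' e' d' c' b' := by
  simp only [IsOpenPentagon, List.nodup_cons, List.mem_cons, List.not_mem_nil, not_or,
    or_false] at *
  simp only [IsNbrs] at *
  grind

lemma IsOpenPentagon.adj (h : IsOpenPentagon G a b c d e a' b' c' d' e') :
    (G.Adj a b ∧ G.Adj a e ∧ G.Adj a a' ∧ G.Adj b a ∧ G.Adj b c ∧ G.Adj b b') ∧
    (G.Adj c b ∧ G.Adj c d ∧ G.Adj c c' ∧ G.Adj d c ∧ G.Adj d e ∧ G.Adj d d') ∧
    G.Adj e d ∧ G.Adj e a ∧ G.Adj e e' := by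
  simp only [IsOpenPentagon, IsNbrs] at h
  grind

lemma IsOpenPentagon.isCyc5 (h : IsOpenPentagon G a b c d e a' b' c' d' e') :
    IsCyc5 G a b c d e := by
  have := h.adj
  have hn := h.2.2.2.2.2
  refine ⟨?_, by grind⟩
  simp only [List.nodup_cons, List.mem_cons, List.not_mem_nil, not_or, or_false] at hn ⊢
  grind

/-- Two squares on consecutive edges of the pentagon would give a 6-cycle with a chord. -/
lemma IsOpenPentagon.not_adj (h : IsOpenPentagon G a b c d e a' b' c' d' e') (hred : IsReduced G)
    (hcd : G.Adj c' d') : ¬ G.Adj d' e' := by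
  intro hde
  have ad := h.adj
  refine (hred.not_adj (a := d) (b := c) (c := c') (d := d') (e := e') (f := e) ?_).2
    ad.2.1.2.2.2.2.2
  refine ⟨?_, ad.2.1.2.2.2.1, ad.2.1.2.2.1, hcd, hde, ad.2.2.2.2.symm, ad.2.2.1⟩
  have hn := h.2.2.2.2.2
  simp only [List.nodup_cons, List.mem_cons, List.not_mem_nil, not_or, or_false] at hn ⊢
  grind

end OpenPentagon

section PentagonBounds

variable {V : Type*} [Fintype V] [DecidableEq V] {G : SimpleGraph V} {m : Sym2 V → ℕ} {μ : V → V}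
  {s₁ s₂ s : Setoid V} {a b c d e a' b' c' d' e' v : V}

/-- The graph structure around a pentagon that is forced by a 4-cycle `c d d' c'` in a cover whose
matching contains `aa'`, `bc`, `de`. -/
def IsCloseToSquare (G : SimpleGraph V) (a' b' c' d' e' : V) : Prop :=
  G.Adj c' d' ∧ ¬ G.Adj a' b' ∧ ¬ G.Adj a' c' ∧ ¬ G.Adj a' d' ∧ ¬ G.Adj a' e'

namespace LocalCover

lemma exists_isOpenPentagon [DecidableRel G.Adj] (hG : G.IsRegularOfDegree 3)
    (L : LocalCover G m μ s₁ s₂ s) {u : V} {p : G.Walk u u} (hp : IsInducedCycleAt m 5 v p) :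
    ∃ a b c d e a' b' c' d' e', IsOpenPentagon G a b c d e a' b' c' d' e' ∧
      v ∈ [a, b, c, d, e] := by
  obtain ⟨hcyc, hlen, hchord, hcomp, -⟩ := hp
  obtain ⟨b, c, d, e, h, hs, he⟩ := exists_isCyc5 hcyc hlen
  have hcls : ∀ w, s v w ↔ w ∈ [u, b, c, d, e] := by
    intro w
    rw [← L.mem_compVerts, hcomp]
    change w ∈ p.support ↔ _
    rw [hs]
    simp only [List.mem_cons, List.not_mem_nil, or_false]
    tauto
  have hvm := (hcls v).1 (s.refl v)
  rw [Walk.isChordless_iff_forall_mem_edges, hs, he] at hchord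
  obtain ⟨hn, h1, h2, h3, h4, h5⟩ := h
  have hn' := hn
  simp only [List.nodup_cons, List.mem_cons, List.not_mem_nil, not_or, or_false] at hn
  obtain ⟨a', n1⟩ := exists_isNbrs hG h1 h5.symm hn.2.1.2.2
  obtain ⟨b', n2⟩ := exists_isNbrs hG h1.symm h2 hn.1.2.1
  obtain ⟨c', n3⟩ := exists_isNbrs hG h2.symm h3 hn.2.1.2.1
  obtain ⟨d', n4⟩ := exists_isNbrs hG h3.symm h4 hn.2.2.1.2
  obtain ⟨e', n5⟩ := exists_isNbrs hG h4.symm h5 (Ne.symm hn.1.2.2.1)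
  have hch : ∀ x y, x ∈ [u, b, c, d, e] → y ∈ [u, b, c, d, e] → G.Adj x y →
      s(x, y) ∈ [s(u, b), s(b, c), s(c, d), s(d, e), s(e, u)] := by
    intro x y hx hy hxy
    exact hchord (by simp at hx ⊢; tauto) (by simp at hy ⊢; tauto) hxy
  have hout : ∀ x x', x ∈ [u, b, c, d, e] → G.Adj x x' →
      s(x, x') ∉ [s(u, b), s(b, c), s(c, d), s(d, e), s(e, u)] →
      x' ∉ [u, b, c, d, e] ∧ μ x = x' := by
    intro x x' hx hxx hx'
    have hx'm : x' ∉ [u, b, c, d, e] := fun hc => hx' (hch x x' hx hc hxx)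
    refine ⟨hx'm, ?_⟩
    by_contra hne
    exact hx'm ((hcls x').1 (s.trans ((hcls x).2 hx)
      (L.le₂ _ _ (L.le₁₂ _ _ (L.rel₁ _ _ hxx hne)))))
  have m := L.mate_mate
  refine ⟨u, b, c, d, e, a', b', c', d', e', ⟨n1, n2, n3, n4, n5, ?_⟩, hvm⟩
  have oa := hout u a' (by simp) ((n1.2.2.2 a').2 (by simp))
  have ob := hout b b' (by simp) ((n2.2.2.2 b').2 (by simp))
  have oc := hout c c' (by simp) ((n3.2.2.2 c').2 (by simp))
  have od := hout d d' (by simp) ((n4.2.2.2 d').2 (by simp))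
  have oe := hout e e' (by simp) ((n5.2.2.2 e').2 (by simp))
  have e1 := n1.ne
  have e2 := n2.ne
  have e3 := n3.ne
  have e4 := n4.ne
  have e5 := n5.ne
  simp only [List.mem_cons, List.not_mem_nil, or_false, Sym2.eq_iff, not_or] at oa ob oc od oe
  clear hout hch hchord hcls hvm he hs
  simp only [IsNbrs] at n1 n2 n3 n4 n5
  have oa := oa (by grind)
  have ob := ob (by grind)
  have oc := oc (by grind)
  have od := od (by grind)
  have oe := oe (by grind)
  simp only [List.nodup_cons, List.mem_cons, List.not_mem_nil, not_or, or_false]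
  grind

/-- The possible intersections of a perfect matching with a pentagon. -/
lemma pentagon_cases (L : LocalCover G m μ s₁ s₂ s)
    (h : IsOpenPentagon G a b c d e a' b' c' d' e') :
    (μ a = a' ∧ μ b = b' ∧ μ c = c' ∧ μ d = d' ∧ μ e = e') ∨
    ((μ a = a' ∧ μ b = c ∧ μ c = b ∧ μ d = e ∧ μ e = d) ∨
     (μ b = b' ∧ μ c = d ∧ μ d = c ∧ μ e = a ∧ μ a = e) ∨
     (μ c = c' ∧ μ d = e ∧ μ e = d ∧ μ a = b ∧ μ b = a) ∨
     (μ d = d' ∧ μ e = a ∧ μ a = e ∧ μ b = c ∧ μ c = b) ∨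
     (μ e = e' ∧ μ a = b ∧ μ b = a ∧ μ c = d ∧ μ d = c)) ∨
    ((μ a = b ∧ μ b = a ∧ μ c = c' ∧ μ d = d' ∧ μ e = e') ∨
     (μ b = c ∧ μ c = b ∧ μ d = d' ∧ μ e = e' ∧ μ a = a') ∨
     (μ c = d ∧ μ d = c ∧ μ e = e' ∧ μ a = a' ∧ μ b = b') ∨
     (μ d = e ∧ μ e = d ∧ μ a = a' ∧ μ b = b' ∧ μ c = c') ∨
     (μ e = a ∧ μ a = e ∧ μ b = b' ∧ μ c = c' ∧ μ d = d')) := by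
  obtain ⟨n1, n2, n3, n4, n5, hn⟩ := h
  have h1 := L.cases_nbrs n1
  have h2 := L.cases_nbrs n2
  have h3 := L.cases_nbrs n3
  have h4 := L.cases_nbrs n4
  have h5 := L.cases_nbrs n5
  simp only [List.nodup_cons, List.mem_cons, List.not_mem_nil, not_or, or_false] at hn
  obtain ⟨ha, hb, hc, hd, he, ha', hb', hc', hd', -⟩ := hn
  clear n1 n2 n3 n4 n5
  rcases h1 with ⟨h1, i1, -⟩ | ⟨h1, i1, -⟩ | ⟨h1, i1, -⟩ <;>
  rcases h3 with ⟨h3, i3, -⟩ | ⟨h3, i3, -⟩ | ⟨h3, i3, -⟩ <;> grind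

lemma cls_eq_of_adj (L : LocalCover G m μ s₁ s₂ s) {x y : V} (h : G.Adj x y) (hne : μ x ≠ y) :
    cls s₂ x = cls s₂ y := cls_congr (L.le₁₂ _ _ (L.rel₁ _ _ h hne))

/-- The non-matching path `a' a e d c b b'` lies in a single class. -/
lemma seven_le_of_pentagon (L : LocalCover G m μ s₁ s₂ s)
    (h : IsOpenPentagon G a b c d e a' b' c' d' e') (hv : v ∈ [a, b, c, d, e])
    (ha : μ a = b) (hb : μ b = a) (hc : μ c = c') (hd : μ d = d') (he : μ e = e') :
    7 ≤ (cls s₂ v).card := by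
  have ad := h.adj
  have hn := h.2.2.2.2.2
  simp only [List.nodup_cons, List.mem_cons, List.not_mem_nil, not_or, or_false] at hn hv
  have r1 := L.cls_eq_of_adj ad.1.2.1 (by grind)
  have r2 := L.cls_eq_of_adj ad.1.2.2.1 (by grind)
  have r3 := L.cls_eq_of_adj ad.1.2.2.2.2.1 (by grind)
  have r4 := L.cls_eq_of_adj ad.1.2.2.2.2.2 (by grind)
  have r5 := L.cls_eq_of_adj ad.2.1.2.1 (by grind)
  have r6 := L.cls_eq_of_adj ad.2.1.2.2.2.2.1 (by grind)
  refine length_le_card_cls (l := [a, b, c, d, e, a', b']) (by simp; grind) ?_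
  simp only [List.mem_cons, List.not_mem_nil, or_false, forall_eq_or_imp, forall_eq, ← cls_eq_iff]
  have : cls s₂ v = cls s₂ a := by rcases hv with rfl | rfl | rfl | rfl | rfl <;> grind -ext
  and_intros <;> grind -ext


/-- Removing the matching edges `aa'`, `bc`, `de` leaves the two paths `b' b a e e'` and `c' c d
d'`. -/
lemma rel_of_pentagon_one (L : LocalCover G m μ s₁ s₂ s)
    (h : IsOpenPentagon G a b c d e a' b' c' d' e') (ha : μ a = a') (hb : μ b = c) (hd : μ d = e) :
    (∀ x ∈ [a, b, e, b', e'], s₂ a x) ∧ ∀ x ∈ [c, d, c', d'], s₂ c x := by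
  have ad := h.adj
  have hc := L.mate_eq hb
  have he := L.mate_eq hd
  have hn := h.2.2.2.2.2
  simp only [List.nodup_cons, List.mem_cons, List.not_mem_nil, not_or, or_false] at hn
  have r1 := L.cls_eq_of_adj ad.1.1 (by grind)
  have r2 := L.cls_eq_of_adj ad.1.2.1 (by grind)
  have r3 := L.cls_eq_of_adj ad.1.2.2.2.2.2 (by grind)
  have r4 := L.cls_eq_of_adj ad.2.2.2.2 (by grind)
  have r5 := L.cls_eq_of_adj ad.2.1.2.1 (by grind)
  have r6 := L.cls_eq_of_adj ad.2.1.2.2.1 (by grind)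
  have r7 := L.cls_eq_of_adj ad.2.1.2.2.2.2.2 (by grind)
  simp only [List.mem_cons, List.not_mem_nil, or_false, forall_eq_or_imp, forall_eq, ← cls_eq_iff]
  clear hn
  and_intros <;> grind -ext

/-- If the two paths of a pentagon lie in a common class, this class is large. -/
lemma nine_le_of_pentagon (L : LocalCover G m μ s₁ s₂ s)
    (h : IsOpenPentagon G a b c d e a' b' c' d' e') (ha : μ a = a') (hb : μ b = c) (hd : μ d = e)
    (hac : s₂ a c) (hv : v ∈ [a, b, c, d, e]) : contribution m v ≤ 11 / 9 := by
  obtain ⟨h1, h2⟩ := L.rel_of_pentagon_one h ha hb hd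
  have hall : ∀ x ∈ [a, b, e, b', e', c, d, c', d'], s₂ a x := by
    intro x hx
    change x ∈ [a, b, e, b', e'] ++ [c, d, c', d'] at hx
    rcases List.mem_append.1 hx with hx | hx
    · exact h1 x hx
    · exact s₂.trans hac (h2 x hx)
  have hn := h.2.2.2.2.2
  have h9 := length_le_card_cls (l := [a, b, e, b', e', c, d, c', d']) (by
    simp only [List.nodup_cons, List.mem_cons, List.not_mem_nil, not_or, or_false] at hn ⊢
    grind) hall
  rw [cls_congr (hall v (by simp at hv ⊢; tauto))] at h9
  have := L.contribution_le (t := 9) (by norm_num) (by norm_num) h9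
  norm_num at this
  linarith

/-- With `a'e'` present, `a'` is a sixth vertex of the class of `a`. Its other non-matching edge
must end in the class, hence at `b'`, and the 6-cycle `a' b' b a e e'` has the chord `aa'`. -/
lemma isCloseToSquare_aux [DecidableRel G.Adj] (hG : G.IsRegularOfDegree 3) (hred : IsReduced G)
    (L : LocalCover G m μ s₁ s₂ s)
    (h : IsOpenPentagon G a b c d e a' b' c' d' e') (ha : μ a = a') (hb : μ b = c) (hd : μ d = e)
    (h7 : (cls s₂ a).card ≤ 6) : ¬ G.Adj a' e' := by
  intro hadj
  obtain ⟨h1, -⟩ := L.rel_of_pentagon_one h ha hb hd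
  have ha' := L.mate_eq ha
  have hn := h.2.2.2.2.2
  have ad := h.adj
  have hne : μ e' ≠ a' := fun hc => by
    have := L.mate_eq hc
    simp at hn; grind
  have hall : ∀ x ∈ [a', a, b, e, b', e'], s₂ a x := by
    simp only [List.forall_mem_cons (a := a')]
    exact ⟨s₂.trans (h1 e' (by simp)) (L.le₁₂ _ _ (L.rel₁ _ _ hadj.symm hne)), h1⟩
  obtain ⟨y, hy, hμy, hye⟩ := exists_adj_ne_ne hG hadj (μ a')
  have hnl : [a', a, b, e, b', e'].Nodup := by
    simp only [List.nodup_cons, List.mem_cons, List.not_mem_nil, not_or, or_false] at hn ⊢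
    grind
  have hym := mem_of_card_cls_le hnl hall h7
    (s₂.trans (hall a' (by simp)) (L.le₁₂ _ _ (L.rel₁ _ _ hy hμy)))
  have hyb : y = b' := by
    have := hy.symm
    have := hy.ne
    obtain ⟨n1, n2, n3, n4, n5, -⟩ := h
    simp only [List.nodup_cons, List.mem_cons, List.not_mem_nil, not_or, or_false] at hn hym
    simp only [IsNbrs] at n1 n2 n3 n4 n5
    grind
  subst hyb
  refine (hred.not_adj (a := a') (b := y) (c := b) (d := a) (e := e) (f := e') ?_).2
    ad.1.2.2.1.symm
  refine ⟨?_, hy, ad.1.2.2.2.2.2.symm, ad.1.2.2.2.1, ad.1.2.1, ad.2.2.2.2, hadj.symm⟩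
  simp only [List.nodup_cons, List.mem_cons, List.not_mem_nil, not_or, or_false] at hnl ⊢
  grind

/-- A contribution above 13/10 means that the component of `v` was not merged, so the two paths left
by the matching lie in different components. The class of `a` has at least five vertices, so by (U3)
the class of `c` has only the four known ones. This forces the edge `c'd'` and keeps `a'` away from
`c'` and `d'`. The vertex `v` lies in the class of `a`, which has at most six vertices since seven
would give 9/7. -/
lemma isCloseToSquare [DecidableRel G.Adj] (hG : G.IsRegularOfDegree 3) (hred : IsReduced G)
    (L : LocalCover G m μ s₁ s₂ s)
    (h : IsOpenPentagon G a b c d e a' b' c' d' e') (ha : μ a = a') (hb : μ b = c) (hd : μ d = e)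
    (hv : v ∈ [a, b, c, d, e]) (hv5 : 5 ≤ (cls s₂ v).card) (hc : 13 / 10 < contribution m v) :
    IsCloseToSquare G a' b' c' d' e' := by
  obtain ⟨h1, h2⟩ := L.rel_of_pentagon_one h ha hb hd
  have hn := h.2.2.2.2.2
  have ad := h.adj
  have ha' := L.mate_eq ha
  have hn2 : ¬ s₂ a c := fun hac => by
    have := L.nine_le_of_pentagon h ha hb hd hac hv
    linarith
  have hvs : s₂ v a ∨ s₂ v c := by
    simp only [List.mem_cons, List.not_mem_nil, or_false] at hv
    rcases hv with rfl | rfl | rfl | rfl | rfl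
    · exact .inl (s₂.refl _)
    · exact .inl (s₂.symm (h1 _ (by simp)))
    · exact .inr (s₂.refl _)
    · exact .inr (s₂.symm (h2 _ (by simp)))
    · exact .inl (s₂.symm (h1 _ (by simp)))
  have heq : cls s v = cls s₂ v := by
    by_contra hne
    have := L.contribution_le_of_merged hne
    linarith
  have hns : ¬ s a c := fun hac => by
    have key : ∀ x, s v x → s₂ v x := fun x hx => by
      rwa [← mem_cls, ← heq, mem_cls]
    rcases hvs with hva | hvc
    · exact hn2 (s₂.trans (s₂.symm hva) (key c (s.trans (L.le₂ _ _ hva) hac)))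
    · exact hn2 (s₂.trans (s₂.symm (key a (s.trans (L.le₂ _ _ hvc) (s.symm hac)))) hvc)
  have n5 : [a, b, e, b', e'].Nodup := by
    simp only [List.nodup_cons, List.mem_cons, List.not_mem_nil, not_or, or_false] at hn ⊢
    grind
  have n4 : [c, d, c', d'].Nodup := by
    simp only [List.nodup_cons, List.mem_cons, List.not_mem_nil, not_or, or_false] at hn ⊢
    grind
  have ha5 := (length_le_card_cls n5 h1).trans (Finset.card_le_card (L.cls_subset a))
  have hc4 : (cls s₂ c).card ≤ 4 := by
    by_contra! hlt
    exact hns (L.pentagon _ _ _ _ _ h.isCyc5 a (by simp) c (by simp) ha5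
      (le_trans hlt (Finset.card_le_card (L.cls_subset c))))
  have hva : s₂ v a := hvs.resolve_right fun hvc => by
    rw [cls_congr hvc] at hv5
    omega
  have ha6 : (cls s₂ a).card ≤ 6 := by
    by_contra! hlt
    rw [← cls_congr hva] at hlt
    have := L.contribution_le (t := 7) (by norm_num) (by norm_num) hlt
    norm_num at this
    linarith
  have hmem : ∀ x, s₂ c x → x ∈ [c, d, c', d'] := fun x hx => mem_of_card_cls_le n4 h2 hc4 hx
  have hnot : ∀ x ∈ [c', d'], ¬ G.Adj a' x := by
    intro x hx hadj
    have h3 : μ x ≠ a' := fun hxa => by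
      have := L.mate_eq hxa
      simp at hn hx; grind
    have := hmem a' (s₂.trans (h2 x (by simp at hx ⊢; tauto))
      (L.le₁₂ _ _ (L.rel₁ _ _ hadj.symm h3)))
    simp at hn this; grind
  refine ⟨?_, ?_, hnot c' (by simp), hnot d' (by simp), L.isCloseToSquare_aux hG hred h ha hb hd ha6⟩
  · obtain ⟨y, hy, hμy, hyc⟩ := exists_adj_ne_ne hG ad.2.1.2.2.1.symm (μ c')
    have := hmem y (s₂.trans (h2 c' (by simp)) (L.le₁₂ _ _ (L.rel₁ _ _ hy hμy)))
    have := hy.symm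
    have := hy.ne
    have n4 := h.2.2.2.1
    simp only [IsNbrs, List.nodup_cons, List.mem_cons, List.not_mem_nil, not_or, or_false] at *
    grind
  · exact L.isCloseToSquare_aux hG hred h.reflect ha (L.mate_eq hd) (L.mate_eq hb) ha6

end LocalCover

end PentagonBounds
end CubicTour

namespace CubicTour
open SimpleGraph

/-! ### Averages at induced 5-cycles -/

section PentagonSquare

variable {V : Type*} [Fintype V] [DecidableEq V] {G : SimpleGraph V} {m : Sym2 V → ℕ} {μ : V → V}
  {s₁ s₂ s : Setoid V} {a b c d e a' b' c' d' e' v : V}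

omit [Fintype V] [DecidableEq V] in
lemma IsCloseToSquare.reflect (h : IsCloseToSquare G a' b' c' d' e') :
    IsCloseToSquare G a' e' d' c' b' :=
  ⟨h.1.symm, h.2.2.2.2, h.2.2.2.1, h.2.2.1, h.2.1⟩

namespace LocalCover

/-- Two large classes that meet a 5-cycle are merged. -/
lemma contribution_le_of_two (L : LocalCover G m μ s₁ s₂ s) (h : IsCyc5 G a b c d e) {x y : V}
    (hx : x ∈ [a, b, c, d, e]) (hy : y ∈ [a, b, c, d, e]) (hxy : ¬ s₂ x y) {t u : ℕ} (ht : 5 ≤ t)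
    (ht10 : t ≤ 10) (hu : 5 ≤ u) (htx : t ≤ (cls s₂ x).card) (huy : u ≤ (cls s₂ y).card)
    (hv : s₂ x v ∨ s₂ y v) : contribution m v ≤ 6 / 5 + (10 - t) / (5 * (t + u)) := by
  have hs : s x y := L.pentagon _ _ _ _ _ h x hx y hy
    (ht.trans (htx.trans (Finset.card_le_card (L.cls_subset x))))
    (hu.trans (huy.trans (Finset.card_le_card (L.cls_subset y))))
  have hxv : s x v := by
    rcases hv with hv | hv
    · exact L.le₂ _ _ hv
    · exact s.trans hs (L.le₂ _ _ hv)
  have hd : Disjoint (cls s₂ x) (cls s₂ y) := by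
    rw [Finset.disjoint_left]
    intro w hw hw'
    rw [mem_cls] at hw hw'
    exact hxy (s₂.trans hw (s₂.symm hw'))
  have hsub : cls s₂ x ∪ cls s₂ y ⊆ cls s x :=
    Finset.union_subset (L.cls_subset x) (by rw [cls_congr hs]; exact L.cls_subset y)
  have hcard := Finset.card_le_card hsub
  rw [Finset.card_union_of_disjoint hd, cls_congr hxv] at hcard
  have := L.contribution_le_of_rel (s.symm hxv) (h := t + u) (by omega) htx ht10 (by omega)
  push_cast at this
  exact this

/-- The whole pentagon, `a'`, `e'` and a further neighbour `y` of `a'` lie in one class; `y` differs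
from `e'` because `a'e'` is not an edge. -/
lemma contribution_le_of_three_out [DecidableRel G.Adj] (hG : G.IsRegularOfDegree 3)
    (L : LocalCover G m μ s₁ s₂ s) (h : IsOpenPentagon G a b c d e a' b' c' d' e')
    (hsq : IsCloseToSquare G a' b' c' d' e') (hv : v ∈ [a, b, c, d, e]) (he : μ e = a)
    (hb : μ b = b') (hc : μ c = c') (hd : μ d = d') : contribution m v ≤ 51 / 40 := by
  have ad := h.adj
  have ha := L.mate_eq he
  have hn := h.2.2.2.2.2
  simp only [List.nodup_cons, List.mem_cons, List.not_mem_nil, not_or, or_false] at hn hv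
  obtain ⟨y, hy, hμy, hya⟩ := exists_adj_ne_ne hG ad.1.2.2.1.symm (μ a')
  have r1 := L.cls_eq_of_adj ad.1.1 (by grind)
  have r2 := L.cls_eq_of_adj ad.2.1.1 (by grind)
  have r3 := L.cls_eq_of_adj ad.2.1.2.1 (by grind)
  have r4 := L.cls_eq_of_adj ad.2.1.2.2.2.2.1 (by grind)
  have r5 := L.cls_eq_of_adj ad.1.2.2.1 (by grind)
  have r6 := L.cls_eq_of_adj ad.2.2.2.2 (by grind)
  have r7 := L.cls_eq_of_adj hy hμy
  have hva : cls s₂ v = cls s₂ a := by rcases hv with rfl | rfl | rfl | rfl | rfl <;> grind -ext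
  have h8 : [a, b, c, d, e, a', e', y].length ≤ (cls s₂ a).card := by
    refine length_le_card_cls ?_ ?_
    · obtain ⟨n1, n2, n3, n4, n5, -⟩ := h
      have hye : y ≠ e' := fun hc => hsq.2.2.2.2 (hc ▸ hy)
      have := hy.symm
      have := hy.ne
      simp only [List.nodup_cons, List.mem_cons, List.not_mem_nil, not_or, or_false]
      simp only [IsNbrs] at n1 n2 n3 n4 n5
      clear r1 r2 r3 r4 r5 r6 r7 hva
      grind
    · simp only [List.mem_cons, List.not_mem_nil, or_false, forall_eq_or_imp, forall_eq,
        ← cls_eq_iff]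
      clear hn
      and_intros <;> grind -ext
  rw [← hva] at h8
  have := L.contribution_le (t := 8) (by norm_num) (by norm_num) h8
  norm_num at this
  linarith

/-- The matching leaves the paths `a' a b c c'` and `d' d e e'`. If their classes differ, the edge
`c'd'` is in the matching, so both classes continue, to `p` and `q`. They have at least 6 and 5
vertices and are merged by (U3), giving 6/5 + 4/55 < 51/40. -/
lemma contribution_le_of_out_b [DecidableRel G.Adj] (hG : G.IsRegularOfDegree 3)
    (hred : IsReduced G)
    (L : LocalCover G m μ s₁ s₂ s) (h : IsOpenPentagon G a b c d e a' b' c' d' e')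
    (hsq : IsCloseToSquare G a' b' c' d' e') (hv : v ∈ [a, b, c, d, e]) (he : μ e = a)
    (hb : μ b = b') (hc : μ c = d) : contribution m v ≤ 51 / 40 := by
  by_cases hbd : s₂ b d
  · have := L.nine_le_of_pentagon (v := v) h.rotate hb hc he hbd (by simp at hv ⊢; tauto)
    linarith
  have ad := h.adj
  obtain ⟨h1, h2⟩ := L.rel_of_pentagon_one h.rotate hb hc he
  have hn := h.2.2.2.2.2
  have hd := L.mate_eq hc
  simp only [List.nodup_cons, List.mem_cons, List.not_mem_nil, not_or, or_false] at hn hv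
  have hc' : μ c' = d' := by
    by_contra hne
    exact hbd (s₂.trans (h1 c' (by simp)) (s₂.trans (L.le₁₂ _ _ (L.rel₁ _ _ hsq.1 hne))
      (s₂.symm (h2 d' (by simp)))))
  have hd' := L.mate_eq hc'
  have hne1 : c ≠ d' := by grind
  have hne2 : d ≠ c' := by grind
  obtain ⟨p, np⟩ := exists_isNbrs hG ad.2.1.2.2.1.symm hsq.1 hne1
  obtain ⟨q, nq⟩ := exists_isNbrs hG ad.2.1.2.2.2.2.2.symm hsq.1.symm hne2
  have hp := (np.2.2.2 p).2 (by simp)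
  have hq := (nq.2.2.2 q).2 (by simp)
  have hsp := s₂.trans (h1 c' (by simp)) (L.le₁₂ _ _ (L.rel₁ _ _ hp (by rw [hc']; exact np.2.2.1)))
  have hsq' := s₂.trans (h2 d' (by simp)) (L.le₁₂ _ _ (L.rel₁ _ _ hq (by rw [hd']; exact nq.2.2.1)))
  have hpa : p ≠ a' := fun hc => hsq.2.2.1 (hc ▸ hp.symm)
  have hqe : q ≠ e' := fun hc => h.not_adj hred hsq.1 (hc ▸ hq)
  have l6 : [b, c, a, c', a', p].length ≤ (cls s₂ b).card := by
    refine length_le_card_cls ?_ ?_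
    · obtain ⟨n1, n2, n3, n4, n5, -⟩ := h
      have := hp.symm
      have := np.ne
      simp only [List.nodup_cons, List.mem_cons, List.not_mem_nil, not_or, or_false]
      simp only [IsNbrs] at n1 n2 n3 np
      clear hsp hsq' nq hq hqe h1 h2 n4 n5
      grind
    · simp only [List.mem_cons, List.not_mem_nil, or_false, forall_eq_or_imp, forall_eq] at h1 ⊢
      tauto
  have l5 : [d, e, d', e', q].length ≤ (cls s₂ d).card := by
    refine length_le_card_cls ?_ ?_
    · obtain ⟨n1, n2, n3, n4, n5, -⟩ := h
      have := hq.symm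
      have := nq.ne
      simp only [List.nodup_cons, List.mem_cons, List.not_mem_nil, not_or, or_false]
      simp only [IsNbrs] at n4 n5 nq
      clear hsp hsq' np hp hpa h1 h2 n1 n2 n3
      grind
    · simp only [List.mem_cons, List.not_mem_nil, or_false, forall_eq_or_imp, forall_eq] at h2 ⊢
      tauto
  have := L.contribution_le_of_two (v := v) h.isCyc5 (x := b) (y := d) (by simp) (by simp) hbd
    (by norm_num) (by norm_num) (by norm_num) l6 l5 (by
      simp only [List.mem_cons, List.not_mem_nil, or_false, forall_eq_or_imp, forall_eq] at h1 h2
      rcases hv with rfl | rfl | rfl | rfl | rfl <;> tauto)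
  norm_num at this
  linarith

/-- Here `dd'` is in the matching, so the edges `c'd'` and `d'q` extend the path `c' c d e e'` to
seven vertices, while `y` extends `a' a b b'` to five. Different classes are merged by (U3), giving
6/5 + 3/60 = 5/4. -/
lemma contribution_le_of_out_d [DecidableRel G.Adj] (hG : G.IsRegularOfDegree 3)
    (hred : IsReduced G)
    (L : LocalCover G m μ s₁ s₂ s) (h : IsOpenPentagon G a b c d e a' b' c' d' e')
    (hsq : IsCloseToSquare G a' b' c' d' e') (hv : v ∈ [a, b, c, d, e]) (he : μ e = a)
    (hb : μ b = c) (hd : μ d = d') : contribution m v ≤ 51 / 40 := by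
  by_cases hda : s₂ d a
  · have := L.nine_le_of_pentagon (v := v) h.rotate.rotate.rotate hd he hb hda (by simp at hv ⊢; tauto)
    linarith
  have ad := h.adj
  obtain ⟨h1, h2⟩ := L.rel_of_pentagon_one h.rotate.rotate.rotate hd he hb
  have hn := h.2.2.2.2.2
  simp only [List.nodup_cons, List.mem_cons, List.not_mem_nil, not_or, or_false] at hn hv
  have hd' := L.mate_eq hd
  obtain ⟨y, hy, hμy, hya⟩ := exists_adj_ne_ne hG ad.1.2.2.1.symm (μ a')
  have hne2 : d ≠ c' := by grind
  obtain ⟨q, nq⟩ := exists_isNbrs hG ad.2.1.2.2.2.2.2.symm hsq.1.symm hne2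
  have hq := (nq.2.2.2 q).2 (by simp)
  have hqs := s₂.trans (h1 c' (by simp)) (s₂.symm (L.le₁₂ _ _ (L.rel₁ d' c' hsq.1.symm
    (by rw [hd']; exact hne2))))
  have hqq := s₂.trans hqs (L.le₁₂ _ _ (L.rel₁ _ _ hq (by rw [hd']; exact nq.2.1)))
  have hyy := s₂.trans (h2 a' (by simp)) (L.le₁₂ _ _ (L.rel₁ _ _ hy hμy))
  have hyb : y ≠ b' := fun hc => hsq.2.1 (hc ▸ hy)
  have hqe : q ≠ e' := fun hc => h.not_adj hred hsq.1 (hc ▸ hq)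
  have l7 : [d, e, c, e', c', d', q].length ≤ (cls s₂ d).card := by
    refine length_le_card_cls ?_ ?_
    · obtain ⟨n1, n2, n3, n4, n5, -⟩ := h
      have := hq.symm
      have := nq.ne
      simp only [List.nodup_cons, List.mem_cons, List.not_mem_nil, not_or, or_false]
      simp only [IsNbrs] at n3 n4 n5 nq
      clear hqs hqq hyy hy hyb h1 h2 n1 n2
      grind
    · simp only [List.mem_cons, List.not_mem_nil, or_false, forall_eq_or_imp, forall_eq] at h1 ⊢
      tauto
  have l5 : [a, b, a', b', y].length ≤ (cls s₂ a).card := by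
    refine length_le_card_cls ?_ ?_
    · obtain ⟨n1, n2, n3, n4, n5, -⟩ := h
      have := hy.symm
      have := hy.ne
      simp only [List.nodup_cons, List.mem_cons, List.not_mem_nil, not_or, or_false]
      simp only [IsNbrs] at n1 n2
      clear hqs hqq hyy hq nq hqe h1 h2 n3 n4 n5
      grind
    · simp only [List.mem_cons, List.not_mem_nil, or_false, forall_eq_or_imp, forall_eq] at h2 ⊢
      tauto
  have := L.contribution_le_of_two (v := v) h.isCyc5 (x := d) (y := a) (by simp) (by simp) hda
    (by norm_num) (by norm_num) (by norm_num) l7 l5 (by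
      simp only [List.mem_cons, List.not_mem_nil, or_false, forall_eq_or_imp, forall_eq] at h1 h2
      rcases hv with rfl | rfl | rfl | rfl | rfl <;> tauto)
  norm_num at this
  linarith

lemma contribution_le_of_isCloseToSquare [DecidableRel G.Adj] (hG : G.IsRegularOfDegree 3)
    (hred : IsReduced G)
    (L : LocalCover G m μ s₁ s₂ s) (h : IsOpenPentagon G a b c d e a' b' c' d' e')
    (hsq : IsCloseToSquare G a' b' c' d' e') (hv : v ∈ [a, b, c, d, e]) (ha : μ a ≠ a') :
    contribution m v ≤ 51 / 40 := by
  have hv' : v ∈ [a, e, d, c, b] := by simp at hv ⊢; tauto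
  rcases L.pentagon_cases h with h1 | (h1 | h1 | h1 | h1 | h1) | (h1 | h1 | h1 | h1 | h1)
  · exact absurd h1.1 ha
  · exact absurd h1.1 ha
  · exact L.contribution_le_of_out_b hG hred h hsq hv h1.2.2.2.1 h1.1 h1.2.1
  · exact L.contribution_le_of_out_d hG hred h.reflect hsq.reflect hv' h1.2.2.2.2 h1.2.2.1 h1.1
  · exact L.contribution_le_of_out_d hG hred h hsq hv h1.2.1 h1.2.2.2.1 h1.1
  · exact L.contribution_le_of_out_b hG hred h.reflect hsq.reflect hv' h1.2.2.1 h1.1 h1.2.2.2.2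
  · exact L.contribution_le_of_three_out hG h.reflect hsq.reflect hv' h1.2.1 h1.2.2.2.2 h1.2.2.2.1
      h1.2.2.1
  · exact absurd h1.2.2.2.2 ha
  · exact absurd h1.2.2.2.1 ha
  · exact absurd h1.2.2.1 ha
  · exact L.contribution_le_of_three_out hG h hsq hv h1.1 h1.2.2.1 h1.2.2.2.1 h1.2.2.2.2

end LocalCover

end PentagonSquare

section PentagonAverages

variable {V : Type*} [Fintype V] [DecidableEq V] {G : SimpleGraph V} [DecidableRel G.Adj]
  {k : ℕ} {lam : Fin k → ℝ} {Γ : Fin k → Sym2 V → ℕ} {μ : Fin k → V → V}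
  {a b c d e a' b' c' d' e' v : V} {m : Sym2 V → ℕ} {f : V → V} {s₁ s₂ s : Setoid V}

/-- A component with at most `6` vertices at a vertex outside the chorded 4-cycles is an induced
cycle. -/
lemma LocalCover.lt_card (L : LocalCover G m f s₁ s₂ s)
    (hG : G.IsRegularOfDegree 3) (hv : ∀ D, IsChordedFourCycle G D → v ∉ D) {n : ℕ} (hn : n ≤ 6)
    (h : ∀ j, 4 ≤ j → j ≤ n → ∀ (u : V) (p : G.Walk u u), ¬ IsInducedCycleAt m j v p) :
    n < (cls s v).card := by
  have h4 := (L.four_le_card hG v).trans (Finset.card_le_card (L.cls_subset v))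
  by_contra! hlt
  obtain ⟨u, p, hp⟩ := L.induced v _ rfl (by omega) hv
  exact h _ h4 hlt u p hp

omit [DecidableRel G.Adj] in
/-- In a cover without small components at `v`, the contribution of `v` is small. -/
lemma LocalCover.contribution_le_of_lt_card (L : LocalCover G m f s₁ s₂ s) {t : ℕ} (ht : 0 < t)
    (ht' : t ≤ 6) (h : t ≤ (cls s v).card) : contribution m v ≤ 1 + 2 / t := by
  by_cases heq : cls s v = cls s₂ v
  · exact L.contribution_le ht (by omega) (heq ▸ h)
  · have h1 := L.contribution_le_of_merged heq
    have h2 : (t : ℝ) ≤ 6 := by exact_mod_cast ht'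
    have h3 : (0 : ℝ) < t := by exact_mod_cast ht
    have h4 : (1 / 3 : ℝ) ≤ 2 / t := by rw [le_div_iff₀ h3]; linarith
    linarith

namespace CoverFamily

/-- The bounds 7/5 with `aa'` in the matching and 51/40 without it have mean 51/40 + 1/24 = 4/3 -
1/60. -/
lemma avg_le_of_isCloseToSquare (H : CoverFamily G lam Γ μ)
    (h : IsOpenPentagon G a b c d e a' b' c' d' e') (hsq : IsCloseToSquare G a' b' c' d' e')
    (hv : v ∈ [a, b, c, d, e]) (h5 : ∀ i s₁ s₂ s, LocalCover G (Γ i) (μ i) s₁ s₂ s →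
      5 ≤ (cls s₂ v).card) : avgContribution lam Γ v ≤ 4 / 3 - 1 / 60 := by
  have := H.avg_le (v := v) (α := 51 / 40) [(1 / 8, a, a')] (by simp [h.adj])
    fun i s₁ s₂ s L => ?_
  · norm_num at this ⊢; linarith
  by_cases ha : μ i a = a'
  · have := L.contribution_le (by norm_num) (by norm_num) (h5 i _ _ _ L)
    norm_num [ha] at this ⊢; linarith
  · have := L.contribution_le_of_isCloseToSquare H.cubic H.reduced h hsq hv ha
    norm_num [ha] at this ⊢; linarith

/-- With 1, 3 or 5 outgoing edges in the matching the contribution is at most 13/10, 9/7 or 7/5,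
hence at most 51/40 plus 1/40 for each such edge. The mean is again 51/40 + 1/24. The bound 13/10
can fail only next to a square, where `avg_le_of_isCloseToSquare` applies. -/
lemma avg_le_of_pentagon (H : CoverFamily G lam Γ μ)
    (h : IsOpenPentagon G a b c d e a' b' c' d' e')
    (hv : v ∈ [a, b, c, d, e]) (h5 : ∀ i s₁ s₂ s, LocalCover G (Γ i) (μ i) s₁ s₂ s →
      5 ≤ (cls s₂ v).card) : avgContribution lam Γ v ≤ 4 / 3 - 1 / 60 := by
  by_contra! hcon
  have good : ∀ i, ∀ a b c d e a' b' c' d' e', IsOpenPentagon G a b c d e a' b' c' d' e' →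
      v ∈ [a, b, c, d, e] → μ i a = a' → μ i b = c → μ i d = e →
      contribution (Γ i) v ≤ 13 / 10 := by
    intro i a b c d e a' b' c' d' e' h hv ha hb hd
    by_contra! hlt
    obtain ⟨s₁, s₂, s, L⟩ := H.localCover i
    have := H.avg_le_of_isCloseToSquare h
      (L.isCloseToSquare H.cubic H.reduced h ha hb hd hv (h5 i _ _ _ L) hlt) hv h5
    linarith
  have := H.avg_le (v := v) (α := 51 / 40) [(1 / 40, a, a'), (1 / 40, b, b'), (1 / 40, c, c'),
    (1 / 40, d, d'), (1 / 40, e, e')] (by simp [h.adj]) fun i s₁ s₂ s L => ?_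
  · norm_num at this hcon; linarith
  have c5 := L.contribution_le (by norm_num) (by norm_num) (h5 i _ _ _ L)
  have c7 := L.contribution_le (v := v) (t := 7) (by norm_num) (by norm_num)
  norm_num at c5 c7
  have hv2 : v ∈ [b, c, d, e, a] := by simp at hv ⊢; tauto
  have hv3 : v ∈ [c, d, e, a, b] := by simp at hv ⊢; tauto
  have hv4 : v ∈ [d, e, a, b, c] := by simp at hv ⊢; tauto
  have hv5 : v ∈ [e, a, b, c, d] := by simp at hv ⊢; tauto
  have hr1 := h.rotate
  have hr2 := hr1.rotate
  have hr3 := hr2.rotate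
  have hr4 := hr3.rotate
  have hn := h.2.2.2.2.2
  simp only [List.nodup_cons, List.mem_cons, List.not_mem_nil, not_or, or_false] at hn
  have hcase := L.pentagon_cases h
  have key : contribution (Γ i) v ≤ 51 / 40 + 1 / 40 *
      ((if μ i a = a' then 1 else 0) + (if μ i b = b' then 1 else 0) +
        (if μ i c = c' then 1 else 0) + (if μ i d = d' then 1 else 0) +
        (if μ i e = e' then (1 : ℝ) else 0)) := by
    rcases hcase with h1 | (h1 | h1 | h1 | h1 | h1) | (h1 | h1 | h1 | h1 | h1)
    · simp only [h1]
      norm_num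
      linarith
    · have := good i _ _ _ _ _ _ _ _ _ _ h hv h1.1 h1.2.1 h1.2.2.2.1
      simp only [h1, hn]
      norm_num
      linarith
    · have := good i _ _ _ _ _ _ _ _ _ _ hr1 hv2 h1.1 h1.2.1 h1.2.2.2.1
      simp only [h1, hn]
      norm_num
      linarith
    · have := good i _ _ _ _ _ _ _ _ _ _ hr2 hv3 h1.1 h1.2.1 h1.2.2.2.1
      simp only [h1, hn]
      norm_num
      linarith
    · have := good i _ _ _ _ _ _ _ _ _ _ hr3 hv4 h1.1 h1.2.1 h1.2.2.2.1
      simp only [h1, hn]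
      norm_num
      linarith
    · have := good i _ _ _ _ _ _ _ _ _ _ hr4 hv5 h1.1 h1.2.1 h1.2.2.2.1
      simp only [h1, hn]
      norm_num
      linarith
    · have := c7 (L.seven_le_of_pentagon h hv h1.1 h1.2.1 h1.2.2.1 h1.2.2.2.1 h1.2.2.2.2)
      simp only [h1, hn]
      norm_num
      linarith
    · have := c7 (L.seven_le_of_pentagon hr1 hv2 h1.1 h1.2.1 h1.2.2.1 h1.2.2.2.1 h1.2.2.2.2)
      simp only [h1, hn]
      norm_num
      linarith
    · have := c7 (L.seven_le_of_pentagon hr2 hv3 h1.1 h1.2.1 h1.2.2.1 h1.2.2.2.1 h1.2.2.2.2)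
      simp only [h1, hn]
      norm_num
      linarith
    · have := c7 (L.seven_le_of_pentagon hr3 hv4 h1.1 h1.2.1 h1.2.2.1 h1.2.2.2.1 h1.2.2.2.2)
      simp only [h1, hn]
      norm_num
      linarith
    · have := c7 (L.seven_le_of_pentagon hr4 hv5 h1.1 h1.2.1 h1.2.2.1 h1.2.2.2.1 h1.2.2.2.2)
      simp only [h1, hn]
      norm_num
      linarith
  simp only [List.map_cons, List.map_nil, List.sum_cons, List.sum_nil]
  linarith

theorem avg_le_of_hasInducedCycle_five (H : CoverFamily G lam Γ μ)
    (hv : ∀ D, IsChordedFourCycle G D → v ∉ D) (h4 : ¬ HasInducedCycle G Γ 4 v)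
    (h : HasInducedCycle G Γ 5 v) : avgContribution lam Γ v ≤ 4 / 3 - 1 / 60 := by
  obtain ⟨i, u, p, hp⟩ := h
  obtain ⟨s₁, s₂, s, L⟩ := H.localCover i
  obtain ⟨a, b, c, d, e, a', b', c', d', e', h, hvm⟩ := L.exists_isOpenPentagon H.cubic hp
  refine H.avg_le_of_pentagon h hvm fun i s₁ s₂ s L => ?_
  have h5 : 4 < (cls s v).card := L.lt_card H.cubic hv (by norm_num) fun j hj hj' u p hp =>
    h4 ⟨i, u, p, by rwa [show j = 4 by omega] at hp⟩
  rcases L.unmerged_or_merged v with h | h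
  · rwa [h] at h5
  · exact h.2 v (s.refl v)

lemma six_le_card (h4 : ¬ HasInducedCycle G Γ 4 v) (h5 : ¬ HasInducedCycle G Γ 5 v)
    (H : CoverFamily G lam Γ μ) (hv : ∀ D, IsChordedFourCycle G D → v ∉ D) {i : Fin k}
    (L : LocalCover G (Γ i) (μ i) s₁ s₂ s) : 6 ≤ (cls s v).card :=
  L.lt_card (n := 5) H.cubic hv (by norm_num) fun j hj hj' u p hp => by
    obtain rfl | rfl : j = 4 ∨ j = 5 := by omega
    · exact h4 ⟨i, u, p, hp⟩
    · exact h5 ⟨i, u, p, hp⟩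

/-- Every component at `v` is either a cycle on at least seven vertices, contributing at most 9/7,
or merged, contributing at most 13/10. -/
theorem avg_le_of_not_hasInducedCycle (H : CoverFamily G lam Γ μ)
    (hv : ∀ D, IsChordedFourCycle G D → v ∉ D) (h4 : ¬ HasInducedCycle G Γ 4 v)
    (h5 : ¬ HasInducedCycle G Γ 5 v) (h6 : ¬ HasInducedCycle G Γ 6 v) :
    avgContribution lam Γ v ≤ 13 / 10 := by
  have := H.avg_le (v := v) (α := 13 / 10) [] (by simp) fun i s₁ s₂ s L => ?_
  · simpa using this
  have h7 : 6 < (cls s v).card := L.lt_card H.cubic hv le_rfl fun j hj hj' u p hp => by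
    obtain rfl | rfl | rfl : j = 4 ∨ j = 5 ∨ j = 6 := by omega
    · exact h4 ⟨i, u, p, hp⟩
    · exact h5 ⟨i, u, p, hp⟩
    · exact h6 ⟨i, u, p, hp⟩
  by_cases heq : cls s v = cls s₂ v
  · rw [heq] at h7
    have := L.contribution_le (t := 7) (by norm_num) (by norm_num) h7
    norm_num at this ⊢; linarith
  · simpa using L.contribution_le_of_merged heq

theorem avg_le_four_thirds (H : CoverFamily G lam Γ μ) (v : V) :
    avgContribution lam Γ v ≤ 4 / 3 := by
  by_cases hv : ∀ D, IsChordedFourCycle G D → v ∉ D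
  · by_cases h4 : HasInducedCycle G Γ 4 v
    · linarith [H.avg_le_of_hasInducedCycle_four hv h4]
    by_cases h5 : HasInducedCycle G Γ 5 v
    · linarith [H.avg_le_of_hasInducedCycle_five hv h4 h5]
    have := H.avg_le (v := v) (α := 4 / 3) [] (by simp) fun i s₁ s₂ s L => ?_
    · simpa using this
    have := L.contribution_le_of_lt_card (by norm_num) (by norm_num) (six_le_card h4 h5 H hv L)
    norm_num at this ⊢; linarith
  · push Not at hv
    obtain ⟨D, hD, hv⟩ := hv
    exact H.avg_le_of_isChordedFourCycle hD hv

end CoverFamily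

end PentagonAverages
end CubicTour

namespace CubicTour
open SimpleGraph

/-! ### Induced 6-cycles -/

section OpenHexagon

variable {V : Type*} {G : SimpleGraph V} {a b c d e f a' b' c' d' e' f' : V}

/-- An induced 6-cycle `a b c d e f` whose vertices have distinct outer neighbours. -/
def IsOpenHexagon (G : SimpleGraph V) (a b c d e f a' b' c' d' e' f' : V) : Prop :=
  IsNbrs G a b f a' ∧ IsNbrs G b a c b' ∧ IsNbrs G c b d c' ∧ IsNbrs G d c e d' ∧
    IsNbrs G e d f e' ∧ IsNbrs G f e a f' ∧ [a, b, c, d, e, f, a', b', c', d', e', f'].Nodup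

lemma IsOpenHexagon.rotate (h : IsOpenHexagon G a b c d e f a' b' c' d' e' f') :
    IsOpenHexagon G b c d e f a b' c' d' e' f' a' := by
  simp only [IsOpenHexagon, List.nodup_cons, List.mem_cons, List.not_mem_nil, not_or,
    or_false] at *
  simp only [IsNbrs] at *
  grind

lemma IsOpenHexagon.reflect (h : IsOpenHexagon G a b c d e f a' b' c' d' e' f') :
    IsOpenHexagon G a f e d c b a' f' e' d' c' b' := by
  simp only [IsOpenHexagon, List.nodup_cons, List.mem_cons, List.not_mem_nil, not_or,
    or_false] at *
  simp only [IsNbrs] at *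
  grind

lemma IsOpenHexagon.adj (h : IsOpenHexagon G a b c d e f a' b' c' d' e' f') :
    (G.Adj a b ∧ G.Adj a f ∧ G.Adj a a' ∧ G.Adj b a ∧ G.Adj b c ∧ G.Adj b b') ∧
    (G.Adj c b ∧ G.Adj c d ∧ G.Adj c c' ∧ G.Adj d c ∧ G.Adj d e ∧ G.Adj d d') ∧
    G.Adj e d ∧ G.Adj e f ∧ G.Adj e e' ∧ G.Adj f e ∧ G.Adj f a ∧ G.Adj f f' := by
  simp only [IsOpenHexagon, IsNbrs] at h
  grind

lemma IsOpenHexagon.isCyc6 (h : IsOpenHexagon G a b c d e f a' b' c' d' e' f') :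
    IsCyc6 G a b c d e f := by
  have := h.adj
  have hn := h.2.2.2.2.2.2
  refine ⟨?_, by grind⟩
  simp only [List.nodup_cons, List.mem_cons, List.not_mem_nil, not_or, or_false] at hn ⊢
  grind

end OpenHexagon

section HexagonBounds

variable {V : Type*} [Fintype V] [DecidableEq V] {G : SimpleGraph V} {m : Sym2 V → ℕ} {μ : V → V}
  {s₁ s₂ s : Setoid V} {a b c d e f a' b' c' d' e' f' v : V}

namespace LocalCover

lemma exists_isOpenHexagon [DecidableRel G.Adj] (hG : G.IsRegularOfDegree 3)
    (L : LocalCover G m μ s₁ s₂ s) {u : V} {p : G.Walk u u} (hp : IsInducedCycleAt m 6 v p) :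
    ∃ a b c d e f a' b' c' d' e' f', IsOpenHexagon G a b c d e f a' b' c' d' e' f' ∧
      (∀ x, x ∈ p.support ↔ x ∈ [a, b, c, d, e, f]) ∧
      ∀ x, s v x ↔ x ∈ [a, b, c, d, e, f] := by
  obtain ⟨hcyc, hlen, hchord, hcomp, -⟩ := hp
  obtain ⟨b, c, d, e, f, h, hs, he⟩ := exists_isCyc6 hcyc hlen
  have hsup : ∀ x, x ∈ p.support ↔ x ∈ [u, b, c, d, e, f] := by
    intro x
    rw [hs]
    simp only [List.mem_cons, List.not_mem_nil, or_false]
    tauto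
  have hcls : ∀ w, s v w ↔ w ∈ [u, b, c, d, e, f] := by
    intro w
    rw [← L.mem_compVerts, hcomp]
    exact hsup w
  rw [Walk.isChordless_iff_forall_mem_edges, he] at hchord
  simp only [hsup] at hchord
  obtain ⟨hn, h1, h2, h3, h4, h5, h6⟩ := h
  simp only [List.nodup_cons, List.mem_cons, List.not_mem_nil, not_or, or_false] at hn
  obtain ⟨a', n1⟩ := exists_isNbrs hG h1 h6.symm hn.2.1.2.2.2
  obtain ⟨b', n2⟩ := exists_isNbrs hG h1.symm h2 hn.1.2.1
  obtain ⟨c', n3⟩ := exists_isNbrs hG h2.symm h3 hn.2.1.2.1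
  obtain ⟨d', n4⟩ := exists_isNbrs hG h3.symm h4 hn.2.2.1.2.1
  obtain ⟨e', n5⟩ := exists_isNbrs hG h4.symm h5 hn.2.2.2.1.2
  obtain ⟨f', n6⟩ := exists_isNbrs hG h5.symm h6 (Ne.symm hn.1.2.2.2.1)
  have hout : ∀ x x', x ∈ [u, b, c, d, e, f] → G.Adj x x' →
      s(x, x') ∉ [s(u, b), s(b, c), s(c, d), s(d, e), s(e, f), s(f, u)] →
      x' ∉ [u, b, c, d, e, f] ∧ μ x = x' := by
    intro x x' hx hxx hx'
    have hx'm : x' ∉ [u, b, c, d, e, f] := fun hc => hx' (hchord hx hc hxx)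
    refine ⟨hx'm, ?_⟩
    by_contra hne
    exact hx'm ((hcls x').1 (s.trans ((hcls x).2 hx)
      (L.le₂ _ _ (L.le₁₂ _ _ (L.rel₁ _ _ hxx hne)))))
  have m := L.mate_mate
  refine ⟨u, b, c, d, e, f, a', b', c', d', e', f', ⟨n1, n2, n3, n4, n5, n6, ?_⟩, hsup, hcls⟩
  have oa := hout u a' (by simp) ((n1.2.2.2 a').2 (by simp))
  have ob := hout b b' (by simp) ((n2.2.2.2 b').2 (by simp))
  have oc := hout c c' (by simp) ((n3.2.2.2 c').2 (by simp))
  have od := hout d d' (by simp) ((n4.2.2.2 d').2 (by simp))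
  have oe := hout e e' (by simp) ((n5.2.2.2 e').2 (by simp))
  have of := hout f f' (by simp) ((n6.2.2.2 f').2 (by simp))
  have e1 := n1.ne
  have e2 := n2.ne
  have e3 := n3.ne
  have e4 := n4.ne
  have e5 := n5.ne
  have e6 := n6.ne
  simp only [List.mem_cons, List.not_mem_nil, or_false, Sym2.eq_iff, not_or] at oa ob oc od oe of
  clear hout hchord hcls he hs hsup
  simp only [IsNbrs] at n1 n2 n3 n4 n5 n6
  have oa := oa (by grind)
  have ob := ob (by grind)
  have oc := oc (by grind)
  have od := od (by grind)
  have oe := oe (by grind)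
  have of := of (by grind)
  have ia := L.mate_eq oa.2
  have ib := L.mate_eq ob.2
  have ic := L.mate_eq oc.2
  have id := L.mate_eq od.2
  have ie := L.mate_eq oe.2
  have ig := L.mate_eq of.2
  clear n1 n2 n3 n4 n5 n6 m
  simp only [List.nodup_cons, List.mem_cons, List.not_mem_nil, not_or, or_false]
  and_intros <;> grind

/-- The path through `a` between two opposite matching edges of a hexagon, in a class with exactly
six vertices. -/
lemma exists_common_nbr [DecidableRel G.Adj] (hG : G.IsRegularOfDegree 3)
    (L : LocalCover G m μ s₁ s₂ s)
    (h : IsOpenHexagon G a b c d e f a' b' c' d' e' f') (ha : μ a = a') (hb : μ b = c)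
    (he : μ e = f) (h6 : (cls s₂ a).card = 6) :
    ¬ s₂ a d ∧ ∃ z, z ∉ [b', b, a, f, f'] ∧ G.Adj z b' ∧ G.Adj z f' ∧
      ∀ x, s₂ a x → x ∈ z :: [b', b, a, f, f'] := by
  have ad := h.adj
  have hc := L.mate_eq hb
  have hf := L.mate_eq he
  have ha' := L.mate_eq ha
  obtain ⟨n1, n2, n3, n4, n5, n6, hn⟩ := h
  simp only [List.nodup_cons, List.mem_cons, List.not_mem_nil, not_or, or_false] at hn
  have r1 := L.le₁₂ _ _ (L.rel₁ _ _ ad.1.1 (by grind))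
  have r2 := L.le₁₂ _ _ (L.rel₁ _ _ ad.1.2.1 (by grind))
  have r3 := s₂.trans r1 (L.le₁₂ _ _ (L.rel₁ _ _ ad.1.2.2.2.2.2 (by grind)))
  have r4 := s₂.trans r2 (L.le₁₂ _ _ (L.rel₁ _ _ ad.2.2.2.2.2.2.2 (by grind)))
  have r5 := L.le₁₂ _ _ (L.rel₁ _ _ ad.2.1.2.1 (by grind))
  have r6 := L.le₁₂ _ _ (L.rel₁ _ _ ad.2.2.1 (by grind))
  have l5 : [b', b, a, f, f'].Nodup := by
    simp only [List.nodup_cons, List.mem_cons, List.not_mem_nil, not_or, or_false]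
    grind
  have hall : ∀ x ∈ [b', b, a, f, f'], s₂ a x := by
    simp [r1, r2, r3, r4]
  have hd : ¬ s₂ a d := by
    -- If `d` were in the class, `c` would be as well, making seven vertices.
    intro hd
    have := length_le_card_cls (r := s₂) (v := a) (l := c :: d :: [b', b, a, f, f'])
      (by
        simp only [List.nodup_cons, List.mem_cons, List.not_mem_nil, not_or, or_false]
        grind)
      (by
        simp only [List.forall_mem_cons (a := c), List.forall_mem_cons (a := d)]
        exact ⟨s₂.trans hd (s₂.symm r5), hd, hall⟩)
    simp at this
    omega
  obtain ⟨z, hz, hzl⟩ : ∃ z, s₂ a z ∧ z ∉ [b', b, a, f, f'] := by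
    by_contra! hcon
    have := Finset.card_le_card (s := cls s₂ a) (t := [b', b, a, f, f'].toFinset) fun x hx =>
      List.mem_toFinset.2 (hcon x (mem_cls.1 hx))
    rw [List.toFinset_card_of_nodup l5] at this
    simp at this
    omega
  have hmem : ∀ x, s₂ a x → x ∈ z :: [b', b, a, f, f'] := fun x hx =>
    mem_of_card_cls_le (List.nodup_cons.2 ⟨hzl, l5⟩)
      (by simp only [List.forall_mem_cons (a := z)]; exact ⟨hz, hall⟩) (by simp; omega) hx
  have hzc : z ≠ c := fun h => hd (s₂.trans (h ▸ hz) r5)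
  have hze : z ≠ e := fun h => hd (s₂.trans (h ▸ hz) r6)
  -- Two non-matching edges at `z` stay inside the six vertices. There `b`, `a`, `f` have no room
  -- for another neighbour, so these edges go to `b'` and `f'`.
  have key : ∀ x, G.Adj z x → μ z ≠ x → x = b' ∨ x = f' := by
    intro x hx hne
    have hxm := hmem x (s₂.trans hz (L.le₁₂ _ _ (L.rel₁ _ _ hx hne)))
    have h1 := hx.symm
    have h2 := hx.ne
    simp only [List.mem_cons, List.not_mem_nil, or_false, not_or] at hxm hzl
    simp only [IsNbrs] at n1 n2 n6
    clear hmem hall n3 n4 n5 r1 r2 r3 r4 r5 r6 hn l5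
    grind
  obtain ⟨p, q, r, nz⟩ := exists_isNbrs_self hG z
  have hp := (nz.2.2.2 p).2 (by simp)
  have hq := (nz.2.2.2 q).2 (by simp)
  have hr := (nz.2.2.2 r).2 (by simp)
  have kp := key p hp
  have kq := key q hq
  have kr := key r hr
  refine ⟨hd, z, hzl, ?_, ?_, hmem⟩
  all_goals
    have hμz := (nz.2.2.2 _).1 (L.adj_mate z)
    obtain ⟨npq, npr, nqr, -⟩ := nz
    clear hmem hall n1 n2 n3 n4 n5 n6 r1 r2 r3 r4 r5 r6 hn l5
    grind

/-- If the two paths of a hexagon between opposite matching edges lie in classes with exactly six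
vertices, then the outer neighbours of `a` and `c` have no common neighbour. -/
lemma no_common_nbr [DecidableRel G.Adj] (hG : G.IsRegularOfDegree 3) (hred : IsReduced G)
    (L : LocalCover G m μ s₁ s₂ s)
    (h : IsOpenHexagon G a b c d e f a' b' c' d' e' f') (ha : μ a = a') (hb : μ b = c)
    (hd : μ d = d') (he : μ e = f) (h6 : (cls s₂ a).card = 6) (h6' : (cls s₂ d).card = 6) {z : V}
    (hza : G.Adj z a') (hzc : G.Adj z c') : False := by
  obtain ⟨had, z₁, hz₁, hzb, hzf, hm₁⟩ := L.exists_common_nbr hG h ha hb he h6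
  obtain ⟨-, z₂, hz₂, hze, hzc', hm₂⟩ := L.exists_common_nbr hG h.rotate.rotate.rotate hd he hb h6'
  have ad := h.adj
  have hc := L.mate_eq hb
  obtain ⟨n1, n2, n3, n4, n5, n6, hn⟩ := h
  simp only [List.nodup_cons, List.mem_cons, List.not_mem_nil, not_or, or_false] at hn
  have hdc : s₁ c d := L.rel₁ _ _ ad.2.1.2.1 (by grind)
  -- Otherwise `a'` is the sixth vertex `z₁`, and the 6-cycle `a b b' a' f' f` has the chord `aa'`.
  have haa : ¬ s₂ a a' := by
    intro haa
    have := hm₁ a' haa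
    have hz : a' = z₁ := by
      simp only [List.mem_cons, List.not_mem_nil, or_false] at this
      grind
    subst hz
    refine (hred.not_adj (a := a) (b := b) (c := b') (d := a') (e := f') (f := f) ?_).2 ad.1.2.2.1
    refine ⟨?_, ad.1.1, ad.1.2.2.2.2.2, hzb.symm, hzf, ad.2.2.2.2.2.2.2.symm, ad.2.2.2.2.2.2.1⟩
    simp only [List.nodup_cons, List.mem_cons, List.not_mem_nil, not_or, or_false]
    grind
  -- Otherwise `a'` is the sixth vertex `z₂` of the other class, so `z` must be `e'`, and the
  -- 6-cycle `c' a' e' e d c` has the chord `c'e'`.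
  have hca : ¬ s₂ c a' := by
    intro hca
    have := hm₂ a' (s₂.trans (s₂.symm (L.le₁₂ _ _ hdc)) hca)
    have hz : a' = z₂ := by
      simp only [List.mem_cons, List.not_mem_nil, or_false] at this
      grind
    subst hz
    have hze' : z = e' := by
      obtain ⟨x, nx⟩ := exists_isNbrs hG hze hzc' (by grind)
      have h1 := (nx.2.2.2 z).1 hza.symm
      have h2 := (nx.2.2.2 a).1 ad.1.2.2.1.symm
      have h3 := hzc.ne
      have h4 : z ≠ a := by
        rintro rfl
        have := (n1.2.2.2 c').1 hzc
        grind
      grind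
    subst hze'
    refine (hred.not_adj (a := c') (b := a') (c := z) (d := e) (e := d) (f := c) ?_).1 hzc.symm
    refine ⟨?_, hzc'.symm, hze, ad.2.2.2.2.1.symm, ad.2.2.1, ad.2.1.2.2.2.1, ad.2.1.2.2.1⟩
    simp only [List.nodup_cons, List.mem_cons, List.not_mem_nil, not_or, or_false]
    grind
  -- This 6-cycle meets the three different classes of `a`, `c` and `a'`, so (U1) would still be
  -- applicable.
  have h6c : IsCyc6 G a a' z c' c b := by
    refine ⟨?_, ad.1.2.2.1, hza.symm, hzc, ad.2.1.2.2.1.symm, ad.2.1.1, ad.1.2.2.2.1⟩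
    have h1 := hza.ne
    have h2 := hzc.ne
    simp only [IsNbrs] at n1 n2 n3
    simp only [List.nodup_cons, List.mem_cons, List.not_mem_nil, not_or, or_false]
    clear hm₁ hm₂ n4 n5 n6
    grind
  rcases L.hexagon _ _ _ _ _ _ h6c a (by simp) c (by simp) a' (by simp) with h | h | h
  · exact had (L.le₁₂ _ _ (s₁.trans h hdc))
  · exact haa (L.le₁₂ _ _ h)
  · exact hca (L.le₁₂ _ _ h)

end LocalCover

end HexagonBounds
end CubicTour

namespace CubicTour
open SimpleGraph

/-! ### Averages at induced 6-cycles -/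

section HexagonGood

variable {V : Type*} [Fintype V] [DecidableEq V] {G : SimpleGraph V} {m : Sym2 V → ℕ} {μ : V → V}
  {s₁ s₂ s : Setoid V} {a b c d e f a' b' c' d' e' f' v : V}

namespace LocalCover

/-- If the matching contains three edges of a hexagon, then some class at it is large. -/
lemma three_edges_false (L : LocalCover G m μ s₁ s₂ s)
    (h : IsOpenHexagon G a b c d e f a' b' c' d' e' f')
    (h6 : ∀ w ∈ [a, b, c, d, e, f], (cls s₂ w).card = 6) (ha : μ a = b) (hc : μ c = d)
    (he : μ e = f) : False := by
  have ad := h.adj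
  have hb := L.mate_eq ha
  have hd := L.mate_eq hc
  have hf := L.mate_eq he
  have hhex := L.hexagon _ _ _ _ _ _ h.isCyc6 b (by simp) d (by simp) f (by simp)
  have hn := h.2.2.2.2.2.2
  simp only [List.nodup_cons, List.mem_cons, List.not_mem_nil, not_or, or_false] at hn
  have b1 := L.le₁₂ _ _ (L.rel₁ _ _ ad.1.2.2.2.2.1 (by grind))
  have b2 := L.le₁₂ _ _ (L.rel₁ _ _ ad.1.2.2.2.2.2 (by grind))
  have b3 := s₂.trans b1 (L.le₁₂ _ _ (L.rel₁ _ _ ad.2.1.2.2.1 (by grind)))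
  have d1 := L.le₁₂ _ _ (L.rel₁ _ _ ad.2.1.2.2.2.2.1 (by grind))
  have d2 := L.le₁₂ _ _ (L.rel₁ _ _ ad.2.1.2.2.2.2.2 (by grind))
  have d3 := s₂.trans d1 (L.le₁₂ _ _ (L.rel₁ _ _ ad.2.2.2.2.1 (by grind)))
  have f1 := L.le₁₂ _ _ (L.rel₁ _ _ ad.2.2.2.2.2.2.1 (by grind))
  have f2 := L.le₁₂ _ _ (L.rel₁ _ _ ad.2.2.2.2.2.2.2 (by grind))
  have f3 := s₂.trans f1 (L.le₁₂ _ _ (L.rel₁ _ _ ad.1.2.2.1 (by grind)))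
  have key : ∀ x x₁ x₂ x₃ y y₁ y₂ y₃, [x, x₁, x₂, x₃, y, y₁, y₂, y₃].Nodup →
      (cls s₂ x).card = 6 → s₂ x y → s₂ x x₁ → s₂ x x₂ → s₂ x x₃ → s₂ y y₁ → s₂ y y₂ →
      s₂ y y₃ → False := by
    intro x x₁ x₂ x₃ y y₁ y₂ y₃ hl h6 hxy h1 h2 h3 g1 g2 g3
    have := length_le_card_cls (r := s₂) (v := x) hl (by
      simp [hxy, h1, h2, h3, s₂.trans hxy g1, s₂.trans hxy g2, s₂.trans hxy g3])
    simp at this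
    omega
  rcases hhex with hx | hx | hx
  · refine key b c b' c' d e d' e' ?_ (h6 b (by simp)) (L.le₁₂ _ _ hx) b1 b2 b3 d1 d2 d3
    simp only [List.nodup_cons, List.mem_cons, List.not_mem_nil, not_or, or_false]
    grind
  · refine key b c b' c' f a f' a' ?_ (h6 b (by simp)) (L.le₁₂ _ _ hx) b1 b2 b3 f1 f2 f3
    simp only [List.nodup_cons, List.mem_cons, List.not_mem_nil, not_or, or_false]
    grind
  · refine key d e d' e' f a f' a' ?_ (h6 d (by simp)) (L.le₁₂ _ _ hx) d1 d2 d3 f1 f2 f3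
    simp only [List.nodup_cons, List.mem_cons, List.not_mem_nil, not_or, or_false]
    grind

/-- In a class with exactly six vertices, the long path of a hexagon is closed by an edge between
opposite outer neighbours. -/
lemma adj_opposite [DecidableRel G.Adj] (hG : G.IsRegularOfDegree 3)
    (L : LocalCover G m μ s₁ s₂ s) (h : IsOpenHexagon G a b c d e f a' b' c' d' e' f')
    (h6 : ∀ w ∈ [a, b, c, d, e, f], (cls s₂ w).card = 6) (ha : μ a ≠ a') (hc : μ c = d)
    (hβ : ¬ (μ b = b' ∧ μ c = d ∧ μ e = e' ∧ μ f = a)) : G.Adj a' d' ∧ μ a' ≠ d' := by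
  have h3 := L.three_edges_false h h6
  have ad := h.adj
  have hd := L.mate_eq hc
  obtain ⟨n1, n2, n3, n4, n5, n6, hn⟩ := h
  simp only [List.nodup_cons, List.mem_cons, List.not_mem_nil, not_or, or_false] at hn
  have c1 := L.cases_nbrs n1
  have c2 := L.cases_nbrs n2
  have c5 := L.cases_nbrs n5
  have c6 := L.cases_nbrs n6
  -- Matching `a` to `f` would be the split along `b`–`e` excluded by `hβ`. Once `a` is matched to
  -- `b`, three matching edges on the hexagon are impossible, so `e` and `f` are matched outside and
  -- the class is the path `a' a f e d d'`.
  have hab : μ a = b := by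
    clear n1 n2 n3 n4 n5 n6
    grind
  have he : μ e = e' := by
    clear n1 n2 n3 n4 n5 n6
    grind
  have hf : μ f = f' := by
    clear n1 n2 n3 n4 n5 n6
    grind
  clear c1 c2 c5 c6
  have r1 := L.le₁₂ _ _ (L.rel₁ _ _ ad.1.2.1 (by grind))
  have r2 := L.le₁₂ _ _ (L.rel₁ _ _ ad.1.2.2.1 ha)
  have r3 := s₂.trans r1 (L.le₁₂ _ _ (L.rel₁ _ _ ad.2.2.2.2.2.1 (by grind)))
  have r4 := s₂.trans r3 (L.le₁₂ _ _ (L.rel₁ _ _ ad.2.2.1 (by grind)))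
  have r5 := s₂.trans r4 (L.le₁₂ _ _ (L.rel₁ _ _ ad.2.1.2.2.2.2.2 (by grind)))
  obtain ⟨y, hy, hμy, hya⟩ := exists_adj_ne_ne hG ad.1.2.2.1.symm (μ a')
  have hym := mem_of_card_cls_le (r := s₂) (v := a) (l := [a, f, e, d, a', d'])
    (by
      simp only [List.nodup_cons, List.mem_cons, List.not_mem_nil, not_or, or_false]
      grind)
    (by simp [r1, r2, r3, r4, r5]) (by simp [h6 a])
    (s₂.trans r2 (L.le₁₂ _ _ (L.rel₁ _ _ hy hμy)))
  have hyd : y = d' := by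
    have h1 := hy.symm
    have h2 := hy.ne
    simp only [List.mem_cons, List.not_mem_nil, or_false] at hym
    simp only [IsNbrs] at n4 n5 n6
    clear n1 n2 n3 r1 r2 r3 r4 r5
    grind
  exact hyd ▸ ⟨hy, hμy⟩

end LocalCover

end HexagonGood

/-! ### Averaging over an induced 6-cycle. -/

section HexagonAverages

variable {V : Type*} [Fintype V] [DecidableEq V] {G : SimpleGraph V} [DecidableRel G.Adj]
  {k : ℕ} {lam : Fin k → ℝ} {Γ : Fin k → Sym2 V → ℕ} {μ : Fin k → V → V}
  {a b c d e f a' b' c' d' e' f' v : V} {m : Sym2 V → ℕ} {s₁ s₂ s : Setoid V}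

omit [DecidableRel G.Adj] in
lemma LocalCover.card_eq_six {ν : V → V} (L : LocalCover G m ν s₁ s₂ s) (h6 : 6 ≤ (cls s v).card)
    (hc : 13 / 10 < contribution m v) : (cls s₂ v).card = 6 := by
  have heq : cls s v = cls s₂ v := by
    by_contra hne
    linarith [L.contribution_le_of_merged hne]
  rw [heq] at h6
  refine le_antisymm ?_ h6
  by_contra! hlt
  have := L.contribution_le (t := 7) (by norm_num) (by norm_num) hlt
  norm_num at this
  linarith

/-- A vertex of an induced 6-cycle of a cover is in no chorded 4-cycle. -/
lemma LocalCover.not_mem_chorded (hG : G.IsRegularOfDegree 3) {ν : V → V}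
    (L : LocalCover G m ν s₁ s₂ s) (h : IsOpenHexagon G a b c d e f a' b' c' d' e' f')
    (hs : ∀ x, s v x ↔ x ∈ [a, b, c, d, e, f]) {D : Set V} (hD : IsChordedFourCycle G D) {w : V}
    (hw : w ∈ [a, b, c, d, e, f]) : w ∉ D := by
  intro hwD
  obtain ⟨p, q, r, t, p', r', hk, rfl⟩ := hD.exists_isKite hG
  have hsq := L.square _ _ _ _ hk.isCyc4 w (by simpa using hwD)
  have hq : ∀ x ∈ [p, q, r, t], x ∈ [a, b, c, d, e, f] := fun x hx =>
    (hs x).1 (s.trans ((hs w).2 hw) (L.le₂ _ _ (hsq x hx)))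
  have key : ∀ x, G.Adj q x → x ∈ [a, b, c, d, e, f] := by
    intro x hx
    rcases (hk.2.1.2.2.2 x).1 hx with rfl | rfl | rfl
    · exact hq _ (by simp)
    · exact hq _ (by simp)
    · exact hq _ (by simp)
  have hqm := hq q (by simp)
  have hn := h.2.2.2.2.2.2
  have ad := h.adj
  simp only [List.nodup_cons, List.mem_cons, List.not_mem_nil, not_or, or_false] at hn hqm key
  clear hq hsq hs h
  rcases hqm with rfl | rfl | rfl | rfl | rfl | rfl
  · have := key a' ad.1.2.2.1; grind
  · have := key b' ad.1.2.2.2.2.2; grind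
  · have := key c' ad.2.1.2.2.1; grind
  · have := key d' ad.2.1.2.2.2.2.2; grind
  · have := key e' ad.2.2.2.2.1; grind
  · have := key f' ad.2.2.2.2.2.2.2; grind

namespace CoverFamily

/-- All vertices of the list have a large contribution in the cover `Γ i`. -/
def IsHeavy (Γ : Fin k → Sym2 V → ℕ) (l : List V) (i : Fin k) : Prop :=
  ∀ w ∈ l, 13 / 10 < contribution (Γ i) w

/-- The case where splits along `b`–`e` and `c`–`f` do not occur in heavy covers. A heavy cover with
`aa'` outside the matching and `d` matched along the hexagon then forces the edge `a'd'`, outside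
the matching. -/
lemma sum_le_of_hexagon (H : CoverFamily G lam Γ μ)
    (h : IsOpenHexagon G a b c d e f a' b' c' d' e' f')
    (h6 : ∀ i s₁ s₂ s, LocalCover G (Γ i) (μ i) s₁ s₂ s →
      ∀ w ∈ [a, b, c, d, e, f], 6 ≤ (cls s w).card)
    (hb : ∀ i, IsHeavy Γ [a, b, c, d, e, f] i →
      ¬ (μ i b = b' ∧ μ i c = d ∧ μ i e = e' ∧ μ i f = a))
    (hc : ∀ i, IsHeavy Γ [a, b, c, d, e, f] i →
      ¬ (μ i c = c' ∧ μ i d = e ∧ μ i f = f' ∧ μ i a = b)) :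
    avgContribution lam Γ a + avgContribution lam Γ b + avgContribution lam Γ c +
      avgContribution lam Γ d + avgContribution lam Γ e + avgContribution lam Γ f ≤
      8 - 1 / 90 := by
  have hle : ∀ i, ∀ w ∈ [a, b, c, d, e, f], contribution (Γ i) w ≤ 4 / 3 := by
    intro i w hw
    obtain ⟨s₁, s₂, s, L⟩ := H.localCover i
    have := L.contribution_le_of_lt_card (by norm_num) (by norm_num) (h6 i _ _ _ L w hw)
    norm_num at this ⊢; linarith
  -- A cover that is not heavy saves 4/3 - 13/10 = 1/30 at some vertex. It suffices to find such `B`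
  -- with mean 1/3.
  have hmain : ∀ i, ∀ B : ℝ, B ≤ 1 → (IsHeavy Γ [a, b, c, d, e, f] i → B ≤ 0) →
      contribution (Γ i) a + contribution (Γ i) b + contribution (Γ i) c + contribution (Γ i) d +
        contribution (Γ i) e + contribution (Γ i) f ≤ 8 - 1 / 30 * B := by
    intro i B hB1 hB0
    have hl := hle i
    simp only [List.mem_cons, List.not_mem_nil, or_false, forall_eq_or_imp, forall_eq] at hl
    obtain ⟨l1, l2, l3, l4, l5, l6⟩ := hl
    by_cases hg : IsHeavy Γ [a, b, c, d, e, f] i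
    · have := hB0 hg
      linarith
    · unfold IsHeavy at hg
      push Not at hg
      obtain ⟨w, hw, hwc⟩ := hg
      simp only [List.mem_cons, List.not_mem_nil, or_false] at hw
      rcases hw with rfl | rfl | rfl | rfl | rfl | rfl <;> linarith
  have hopp : ∀ i, IsHeavy Γ [a, b, c, d, e, f] i → μ i a ≠ a' → (μ i c = d ∨ μ i d = e) →
      G.Adj a' d' ∧ μ i a' ≠ d' := by
    intro i hg ha hcde
    obtain ⟨s₁, s₂, s, L⟩ := H.localCover i
    have hs : ∀ w ∈ [a, b, c, d, e, f], (cls s₂ w).card = 6 := fun w hw =>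
      L.card_eq_six (h6 i _ _ _ L w hw) (hg w hw)
    rcases hcde with hcd | hde
    · exact L.adj_opposite H.cubic h hs ha hcd (hb i hg)
    · refine L.adj_opposite H.cubic h.reflect (fun w hw => hs w (by simp at hw ⊢; tauto)) ha
        (L.mate_eq hde) fun ⟨g1, g2, g3, g4⟩ => hc i hg ⟨g3, hde, g1, L.mate_eq g4⟩
  have hsum : avgContribution lam Γ a + avgContribution lam Γ b + avgContribution lam Γ c +
      avgContribution lam Γ d + avgContribution lam Γ e + avgContribution lam Γ f =
      ∑ i, lam i * (contribution (Γ i) a + contribution (Γ i) b + contribution (Γ i) c +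
        contribution (Γ i) d + contribution (Γ i) e + contribution (Γ i) f) := by
    simp only [avgContribution, mul_add, Finset.sum_add_distrib]
  rw [hsum]
  have ad := h.adj
  have hn := h.2.2.2.2.2.2
  simp only [List.nodup_cons, List.mem_cons, List.not_mem_nil, not_or, or_false] at hn
  by_cases had : G.Adj a' d'
  · have := sum_mul_le_of_forall_le H.pos H.sum H.prob [(-1 / 30, a', d')] (by simpa using had)
      (α := 8) (g := fun i => contribution (Γ i) a + contribution (Γ i) b + contribution (Γ i) c +
        contribution (Γ i) d + contribution (Γ i) e + contribution (Γ i) f) fun i => ?_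
    · norm_num at this ⊢; linarith
    refine (hmain i (if μ i a' = d' then 1 else 0) (by split_ifs <;> norm_num) ?_).trans
      (by simp; split_ifs <;> norm_num)
    intro hg
    obtain ⟨s₁, s₂, s, L⟩ := H.localCover i
    rw [if_neg]
    intro hμ
    have hμ' := L.mate_eq hμ
    -- With `a'd'` in the matching, neither `aa'` nor `dd'` is; such a cover cannot be heavy, and
    -- `B` is its indicator.
    have hout : μ i a ≠ a' ∧ (μ i c = d ∨ μ i d = e) := by
      have h4 := L.cases_nbrs h.2.2.2.1
      have := L.mate_mate d
      have := L.mate_mate a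
      clear hopp hmain hle hb hc h6
      grind
    exact (hopp i hg hout.1 hout.2).2 hμ
  -- Without the edge `a'd'`, a heavy cover that matches `d` along the hexagon contains `aa'`. So
  -- `B` = [`cd`] + [`de`] - [`aa'`] is at most 0 on heavy covers, and its mean is 1/3.
  · have := sum_mul_le_of_forall_le H.pos H.sum H.prob
      [(-1 / 30, c, d), (-1 / 30, d, e), (1 / 30, a, a')] (by simp [ad])
      (α := 8) (g := fun i => contribution (Γ i) a + contribution (Γ i) b + contribution (Γ i) c +
        contribution (Γ i) d + contribution (Γ i) e + contribution (Γ i) f) fun i => ?_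
    · norm_num at this ⊢; linarith
    have hcde : ¬ (μ i c = d ∧ μ i d = e) := by
      obtain ⟨s₁, s₂, s, L⟩ := H.localCover i
      rintro ⟨g1, g2⟩
      have := L.mate_eq g1
      grind
    refine (hmain i ((if μ i c = d then 1 else 0) + (if μ i d = e then 1 else 0) -
      (if μ i a = a' then 1 else 0)) ?_ ?_).trans
      (by simp; split_ifs <;> norm_num)
    · by_cases g1 : μ i c = d
      · rw [if_neg fun g2 => hcde ⟨g1, g2⟩]
        split_ifs <;> norm_num
      · rw [if_neg g1]
        split_ifs <;> norm_num
    · intro hg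
      by_cases ha : μ i a = a'
      · by_cases g1 : μ i c = d
        · rw [if_neg fun g2 => hcde ⟨g1, g2⟩, if_pos g1, if_pos ha]
          norm_num
        · simp only [ha, g1, if_true, if_false]
          split_ifs <;> norm_num
      · have g1 : μ i c ≠ d := fun g => had (hopp i hg ha (.inl g)).1
        have g2 : μ i d ≠ e := fun g => had (hopp i hg ha (.inr g)).1
        simp [ha, g1, g2]

/-- At most one of the three ways to split a hexagon occurs in a heavy cover. -/
lemma not_split_of_split (H : CoverFamily G lam Γ μ)
    (h : IsOpenHexagon G a b c d e f a' b' c' d' e' f')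
    (h6 : ∀ i s₁ s₂ s, LocalCover G (Γ i) (μ i) s₁ s₂ s →
      ∀ w ∈ [a, b, c, d, e, f], 6 ≤ (cls s w).card) {i j : Fin k}
    (hi : IsHeavy Γ [a, b, c, d, e, f] i) (hj : IsHeavy Γ [a, b, c, d, e, f] j)
    (ha : μ i a = a' ∧ μ i b = c ∧ μ i d = d' ∧ μ i e = f) :
    ¬ (μ j b = b' ∧ μ j c = d ∧ μ j e = e' ∧ μ j f = a) := by
  rintro ⟨g1, g2, g3, g4⟩
  obtain ⟨_, _, _, L⟩ := H.localCover i
  obtain ⟨_, _, _, L'⟩ := H.localCover j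
  -- The split along `b`–`e` gives `a'` and `c'` a common neighbour, which the split along `a`–`d`
  -- forbids.
  obtain ⟨-, z, -, hzc, hza, -⟩ := L'.exists_common_nbr H.cubic h.rotate g1 g2 g4
    (L'.card_eq_six (h6 j _ _ _ L' b (by simp)) (hj b (by simp)))
  exact L.no_common_nbr H.cubic H.reduced h ha.1 ha.2.1 ha.2.2.1 ha.2.2.2
    (L.card_eq_six (h6 i _ _ _ L a (by simp)) (hi a (by simp)))
    (L.card_eq_six (h6 i _ _ _ L d (by simp)) (hi d (by simp))) hza hzc

/-- If an axis is split in some heavy cover, no other axis is; rotate the hexagon so that this axis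
is `a`–`d`. If none is split, any rotation will do. -/
lemma sum_le_of_isOpenHexagon (H : CoverFamily G lam Γ μ)
    (h : IsOpenHexagon G a b c d e f a' b' c' d' e' f')
    (h6 : ∀ i s₁ s₂ s, LocalCover G (Γ i) (μ i) s₁ s₂ s →
      ∀ w ∈ [a, b, c, d, e, f], 6 ≤ (cls s w).card) :
    avgContribution lam Γ a + avgContribution lam Γ b + avgContribution lam Γ c +
      avgContribution lam Γ d + avgContribution lam Γ e + avgContribution lam Γ f ≤
      8 - 1 / 90 := by
  have m2 : ∀ w, w ∈ [b, c, d, e, f, a] ↔ w ∈ [a, b, c, d, e, f] := by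
    intro w; simp only [List.mem_cons, List.not_mem_nil, or_false]; tauto
  have m3 : ∀ w, w ∈ [c, d, e, f, a, b] ↔ w ∈ [a, b, c, d, e, f] := by
    intro w; simp only [List.mem_cons, List.not_mem_nil, or_false]; tauto
  have e2 : ∀ i, IsHeavy Γ [b, c, d, e, f, a] i ↔ IsHeavy Γ [a, b, c, d, e, f] i := by
    intro i; simp only [IsHeavy, m2]
  have e3 : ∀ i, IsHeavy Γ [c, d, e, f, a, b] i ↔ IsHeavy Γ [a, b, c, d, e, f] i := by
    intro i; simp only [IsHeavy, m3]
  have s1 := H.sum_le_of_hexagon h h6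
  have s2 := H.sum_le_of_hexagon h.rotate (by simpa only [m2] using h6)
  have s3 := H.sum_le_of_hexagon h.rotate.rotate (by simpa only [m3] using h6)
  have t1 := fun i j => H.not_split_of_split h h6 (i := i) (j := j)
  have t2 := fun i j =>
    H.not_split_of_split h.rotate (by simpa only [m2] using h6) (i := i) (j := j)
  have t3 := fun i j =>
    H.not_split_of_split h.rotate.rotate (by simpa only [m3] using h6) (i := i) (j := j)
  simp only [e2, e3] at s2 s3 t2 t3
  by_cases hb : ∃ j, IsHeavy Γ [a, b, c, d, e, f] j ∧
      (μ j b = b' ∧ μ j c = d ∧ μ j e = e' ∧ μ j f = a)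
  · obtain ⟨j, hj, hβ⟩ := hb
    linarith [s2 (fun i hi => t2 j i hj hi hβ)
      fun i hi ⟨g1, g2, g3, g4⟩ => t1 i j hi hj ⟨g3, g4, g1, g2⟩ hβ]
  by_cases hc : ∃ j, IsHeavy Γ [a, b, c, d, e, f] j ∧
      (μ j c = c' ∧ μ j d = e ∧ μ j f = f' ∧ μ j a = b)
  · obtain ⟨j, hj, hγ⟩ := hc
    linarith [s3 (fun i hi => t3 j i hj hi hγ)
      fun i hi ⟨g1, g2, g3, g4⟩ => hb ⟨i, hi, g3, g4, g1, g2⟩]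
  · exact s1 (fun i hi hβ => hb ⟨i, hi, hβ⟩) fun i hi hγ => hc ⟨i, hi, hγ⟩

theorem sum_le_of_isInducedCycleAt (H : CoverFamily G lam Γ μ) {i : Fin k} {u : V}
    {γ : G.Walk u u} (hγ : IsInducedCycleAt (Γ i) 6 v γ) :
    ∑ w ∈ γ.support.toFinset, avgContribution lam Γ w ≤ 8 - 1 / 90 := by
  obtain ⟨s₁, s₂, s, L⟩ := H.localCover i
  obtain ⟨a, b, c, d, e, f, a', b', c', d', e', f', h, hsup, hs⟩ :=
    L.exists_isOpenHexagon H.cubic hγ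
  have hfin : γ.support.toFinset = [a, b, c, d, e, f].toFinset := by
    ext x; rw [List.mem_toFinset, List.mem_toFinset, hsup]
  have hnd : [a, b, c, d, e, f].Nodup := h.isCyc6.1
  rw [hfin, List.sum_toFinset _ hnd]
  have hch : ∀ w ∈ [a, b, c, d, e, f], ∀ D, IsChordedFourCycle G D → w ∉ D := fun w hw D hD =>
    L.not_mem_chorded H.cubic h hs hD hw
  -- One such vertex already saves 1/60 > 1/90. Otherwise no vertex of the hexagon lies in an
  -- induced 4- or 5-cycle of any cover, and all components at it have at least six vertices.
  by_cases hsmall : ∃ w ∈ [a, b, c, d, e, f], avgContribution lam Γ w ≤ 4 / 3 - 1 / 60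
  · obtain ⟨w, hw, hwle⟩ := hsmall
    have h1 := H.avg_le_four_thirds a
    have h2 := H.avg_le_four_thirds b
    have h3 := H.avg_le_four_thirds c
    have h4 := H.avg_le_four_thirds d
    have h5 := H.avg_le_four_thirds e
    have h6 := H.avg_le_four_thirds f
    simp only [List.map_cons, List.map_nil, List.sum_cons, List.sum_nil]
    simp only [List.mem_cons, List.not_mem_nil, or_false] at hw
    rcases hw with rfl | rfl | rfl | rfl | rfl | rfl <;> linarith
  · push Not at hsmall
    have := H.sum_le_of_isOpenHexagon h fun j t₁ t₂ t L' w hw => by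
      have h4 : ¬ HasInducedCycle G Γ 4 w := fun h4 => by
        linarith [hsmall w hw, H.avg_le_of_hasInducedCycle_four (hch w hw) h4]
      have h5 : ¬ HasInducedCycle G Γ 5 w := fun h5 => by
        linarith [hsmall w hw, H.avg_le_of_hasInducedCycle_five (hch w hw) h4 h5]
      exact six_le_card h4 h5 H (hch w hw) L'
    simp only [List.map_cons, List.map_nil, List.sum_cons, List.sum_nil]
    linarith

end CoverFamily

end HexagonAverages
end CubicTour

/-! ### The theorem. -/

theorem mainTheorem4 {V : Type*} [Fintype V] [DecidableEq V] (G : SimpleGraph V)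
    [DecidableRel G.Adj]
    (hcubic : G.IsRegularOfDegree 3)
    (hconn : CubicTour.IsTwoConnected G)
    (hred : CubicTour.IsReduced G)
    (hcard : 10 ≤ Fintype.card V)
    {k : ℕ} (M : Fin k → G.Subgraph) (lam : Fin k → ℝ)
    (hM : ∀ i, CubicTour.IsThreeCutPerfect (M i))
    (hpos : ∀ i, 0 < lam i)
    (hsum : ∑ i, lam i = 1)
    (hconv : ∀ e ∈ G.edgeSet, ∑ i, lam i * (M i).edgeSet.indicator (fun _ => (1 : ℝ)) e = 1 / 3)
    (Γ : Fin k → Sym2 V → ℕ)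
    (hΓ : ∀ i, CubicTour.IsFinalCover G (M i) (Γ i))
    (v : V) :
    -- (P1)
    (∀ D, CubicTour.IsChordedFourCycle G D → v ∈ D → CubicTour.IsIsolated G D →
      CubicTour.avgContribution lam Γ v ≤ 4 / 3) ∧
    -- (P2)
    (∀ D, CubicTour.IsChordedFourCycle G D → v ∈ D → ¬ CubicTour.IsIsolated G D →
      CubicTour.avgContribution lam Γ v ≤ 13 / 10) ∧
    ((∀ D, CubicTour.IsChordedFourCycle G D → v ∉ D) →
      -- (P3)
      (CubicTour.HasInducedCycle G Γ 4 v →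
        CubicTour.avgContribution lam Γ v ≤ 4 / 3 - 1 / 60) ∧
      -- (P4)
      (¬ CubicTour.HasInducedCycle G Γ 4 v → CubicTour.HasInducedCycle G Γ 5 v →
        CubicTour.avgContribution lam Γ v ≤ 4 / 3 - 1 / 60) ∧
      -- (P5)
      (¬ CubicTour.HasInducedCycle G Γ 4 v → ¬ CubicTour.HasInducedCycle G Γ 5 v →
        ∀ (i : Fin k) (u : V) (γ : G.Walk u u), CubicTour.IsInducedCycleAt (Γ i) 6 v γ →
          CubicTour.avgContribution lam Γ v ≤ 4 / 3 ∧
          ∑ w ∈ γ.support.toFinset, CubicTour.avgContribution lam Γ w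
            ≤ 6 * (4 / 3 - 1 / 729)) ∧
      -- (P6)
      (¬ CubicTour.HasInducedCycle G Γ 4 v → ¬ CubicTour.HasInducedCycle G Γ 5 v →
        ¬ CubicTour.HasInducedCycle G Γ 6 v →
        CubicTour.avgContribution lam Γ v ≤ 13 / 10)) := by
  choose μ hμ using fun i => CubicTour.exists_isMate (hM i).1
  have H : CubicTour.CoverFamily G lam Γ μ :=
    { cubic := hcubic
      conn := hconn.2.1
      reduced := hred
      card := hcard
      pos := hpos
      sum := hsum
      prob := fun u w huw => by
        rw [← hconv s(u, w) huw]
        refine Finset.sum_congr rfl fun i _ => ?_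
        simp only [Set.indicator, (hμ i).mem_edgeSet]
      localCover := fun i => (hΓ i).localCover hcubic hred hM hsum hconv hμ }
  refine ⟨fun D hD hv _ => H.avg_le_of_isChordedFourCycle hD hv,
    fun D hD hv hi => H.avg_le_of_not_isIsolated hD hi hv, fun hv => ⟨?_, ?_, ?_, ?_⟩⟩
  · exact H.avg_le_of_hasInducedCycle_four hv
  · exact H.avg_le_of_hasInducedCycle_five hv
  · intro _ _ i u γ hγ
    refine ⟨H.avg_le_four_thirds v, (H.sum_le_of_isInducedCycleAt hγ).trans ?_⟩
    -- The saving 1/90 exceeds the required 6/729.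
    norm_num
  · exact H.avg_le_of_not_hasInducedCycle hv
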